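/- **The system.** Layers are $i\in\{0,1\}$. Global variables $u$ and context variables $g$ are bound in global contexts, local variables $x$ in local contexts (de Bruijn indices; the weakening $p$ below shifts indices). *Syntax.* Types $S,T ::= \mathsf{Nat}\mid \square(\Gamma\vdash T)\mid S\to T\mid (g:\mathsf{Ctx})\Rightarrow T$; local contexts $\Gamma,\Delta ::= \cdot\mid g\mid \Gamma,x:T$; global contexts $\Psi,\Phi ::= \cdot\mid \Psi,g:\mathsf{Ctx}\mid \Psi,u:(\Gamma\vdash T)$; terms $s,t ::= x\mid u^\delta\mid \mathsf{zero}\mid \mathsf{succ}\,t\mid \mathsf{box}\,t\mid \mathsf{letbox}\,u\leftarrow s\,\mathsf{in}\,t\mid \lambda x.t\mid t\,s\mid \Lambda g.t\mid t\,\$\,\Gamma$; local substitutions $\delta ::= \cdot^m\mid\cdot_g^m\mid \mathsf{wk}_g^m\mid \delta,t/x$ ($m\in\mathbb N$); global substitutions $\sigma ::= \cdot\mid\sigma,t/u\mid\sigma,\Gamma/g$. $|\Gamma|$ is the number of local variables of $\Gamma$; $\Gamma$ *ends with* $\cdot$ or with a context variable $g$. *Well-formedness.* $\vdash\cdot$;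 $\vdash\Psi,g:\mathsf{Ctx}$ if $\vdash\Psi$; $\vdash\Psi,u:(\Gamma\vdash T)$ if $\Psi\vdash_0\Gamma$, $\Psi\vdash_0T$. $\Psi\vdash_i\cdot$ if $\vdash\Psi$; $\Psi\vdash_ig$ if $\vdash\Psi$, $g:\mathsf{Ctx}\in\Psi$; $\Psi\vdash_i\Gamma,x:T$ if $\Psi\vdash_i\Gamma$, $\Psi\vdash_iT$. $\Psi\vdash_i\mathsf{Nat}$ if $\vdash\Psi$; $\Psi\vdash_iS\to T$ if $\Psi\vdash_iS$, $\Psi\vdash_iT$; $\Psi\vdash_1\square(\Delta\vdash T)$ if $\Psi\vdash_0\Delta$, $\Psi\vdash_0T$; $\Psi\vdash_1(g:\mathsf{Ctx})\Rightarrow T$ if $\Psi,g:\mathsf{Ctx}\vdash_1T$. *Weakenings.* These are built from $\mathrm{id}$, $p(\cdot)$ (drop the last binding), $q(\cdot)$ (keep it): $\gamma:\Psi\Rightarrow_g\Phi$ between well-formed global contexts, $\tau:\Psi;\Gamma\Rightarrow_i\Delta$ between local contexts that are well-formed at layer $i$ over $\Psi$, and $\gamma;\tau:\Psi;\Gamma\Rightarrow\Phi;\Delta$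 if $\gamma:\Psi\Rightarrow_g\Phi$ and $\tau:\Psi;\Gamma\Rightarrow_1\Delta[\gamma]$. Then $t[\gamma;\tau]=t[\gamma][\tau]$. A local weakening adds its number of $p$'s to the $m$ of the bases of local substitutions. *Substitution.* $\mathsf{wk}^m_\cdot=\cdot^m$, $\mathsf{wk}^m_g=\mathsf{wk}_g^m$, $\mathsf{wk}^m_{\Gamma,x:T}=\mathsf{wk}^{1+m}_\Gamma,x/x$, and $\mathrm{id}_\Gamma=\mathsf{wk}^0_\Gamma$; $\mathrm{id}_\Psi$ maps each $g$ to $g$ and each $u:(\Gamma\vdash T)$ to $u^{\mathrm{id}_\Gamma}$. Local substitution $t[\delta]$ is capture-avoiding, $u^{\delta'}[\delta]=u^{\delta'\circ\delta}$, $(\mathsf{box}\,t)[\delta]=\mathsf{box}\,t$; if the base of $\delta$ carries the number $\hat\delta$ and the optional variable $\check\delta$, then $\mathsf{wk}_g^m\circ\delta=\mathsf{wk}_g^{\hat\delta}$, $\cdot^m\circ\delta=\cdot_{\check\delta}^{\hat\delta}$, $\cdot_g^m\circ\delta=\cdot_g^{\hat\delta}$, $(\delta',t/x)\circ\delta=(\delta'\circ\delta),t[\delta]/x$.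 Global substitution is capture-avoiding on types, local contexts, terms and local substitutions, with $g[\sigma]=\sigma(g)$, $u^\delta[\sigma]=\sigma(u)[\delta[\sigma]]$, $\mathsf{wk}_g^m[\sigma]=\mathsf{wk}^m_{\sigma(g)}$, $\cdot^m[\sigma]=\cdot^m$, and $\cdot_g^m[\sigma]=\cdot_{h}^{|\sigma(g)|+m}$, where $h$ is the context variable with which $\sigma(g)$ ends (absent if it ends with $\cdot$). *Typing* $\Psi;\Gamma\vdash_it:T$ and $\Psi;\Gamma\vdash_i\delta:\Delta$. At both layers: $x:T$ if $\Psi\vdash_i\Gamma$, $x:T\in\Gamma$; $u^\delta:T$ if $\Psi;\Gamma\vdash_i\delta:\Delta$, $u:(\Delta\vdash T)\in\Psi$; the usual rules for $\mathsf{zero}$ (if $\Psi\vdash_i\Gamma$), $\mathsf{succ}$, $\lambda$ and application. At layer 1 only: $\mathsf{box}\,t:\square(\Delta\vdash T)$ if $\Psi\vdash_1\Gamma$, $\Psi;\Delta\vdash_0t:T$; $\mathsf{letbox}\,u\leftarrow s\,\mathsf{in}\,t:T'$ if $s:\square(\Delta\vdash T)$, $\Psi\vdash_0\Delta$, $\Psi\vdash_0T$,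 $\Psi\vdash_1T'$, $\Psi,u:(\Delta\vdash T);\Gamma[p(\mathrm{id})]\vdash_1t:T'[p(\mathrm{id})]$; $\Lambda g.t:(g:\mathsf{Ctx})\Rightarrow T$ if $\Psi\vdash_1\Gamma$, $\Psi,g:\mathsf{Ctx};\Gamma[p(\mathrm{id})]\vdash_1t:T$; $t\,\$\,\Delta:T[\mathrm{id}_\Psi,\Delta/g]$ if $t:(g:\mathsf{Ctx})\Rightarrow T$, $\Psi\vdash_0\Delta$. For local substitutions, with $\Psi\vdash_i\Gamma$ and $|\Gamma|=m$: $\cdot^m:\cdot$ if $\Gamma$ ends with $\cdot$; $\cdot_g^m:\cdot$ and $\mathsf{wk}_g^m:g$ if $\Gamma$ ends with $g$, $g:\mathsf{Ctx}\in\Psi$; and $\delta,t/x:(\Delta,x:T)$ if $\delta:\Delta$, $t:T$. *Equivalence* $\Psi;\Gamma\vdash_it\approx t':T$ and $\Psi;\Gamma\vdash_i\delta\approx\delta':\Delta$: symmetry and transitivity for terms, a congruence rule for each typing rule, and, at layer 1 only, for well-typed instances, $(\lambda x.t)\,s\approx t[\mathrm{id}_\Gamma,s/x]$, $t\approx\lambda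 x.(t[\mathrm{id};p(\mathrm{id})]\,x)$, $\mathsf{letbox}\,u\leftarrow\mathsf{box}\,s\,\mathsf{in}\,t\approx t[\mathrm{id}_\Psi,s/u]$, $(\Lambda g.t)\,\$\,\Delta\approx t[\mathrm{id}_\Psi,\Delta/g]$, $t\approx\Lambda g.(t[p(\mathrm{id})]\,\$\,g)$. *Reduction.* Neutral forms $v::=x\mid u^\delta\mid v\,t\mid\mathsf{letbox}\,u\leftarrow v\,\mathsf{in}\,t\mid v\,\$\,\Gamma$; weak head normal forms $w::=v\mid\mathsf{zero}\mid\mathsf{succ}\,t\mid\mathsf{box}\,t\mid\lambda x.t\mid\Lambda g.t$. Typed weak head reduction $\Psi;\Gamma\vdash t\rightsquigarrow t':T$ consists of the three $\beta$ rules above (at layer 1), closed under the head positions of application, $\mathsf{letbox}$ and $\$$; $\rightsquigarrow^*$ is its reflexive transitive closure on the terms $t$ with $\Psi;\Gamma\vdash_1t:T$. Below, $t\searrow w:T$ means $t\rightsquigarrow^*w:T$ with $w$ a weak head normal form. **Generic equivalences.** A generic equivalence at layer $i$ is a pair of relations $\Psi;\Gamma\vdash t\simeq t':T$ between terms and $\Psi;\Gamma\vdash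 v\sim v':T$ between neutral terms with the following laws; $\simeq$ is extended to local substitutions by the congruence rules with base cases as in the typing rules at layer 1. (1) $v\sim v'$ implies $v\simeq v'$, and $t\simeq t':T$ implies $\Psi;\Gamma\vdash_1t\approx t':T$. (2) Both are symmetric and transitive. (3) Both are preserved by all weakenings $\gamma;\tau$. (4) If $t\searrow w:T$, $t'\searrow w':T$ and $w\simeq w':T$, then $t\simeq t':T$. (5) $\mathsf{zero}\simeq\mathsf{zero}:\mathsf{Nat}$ if $\Psi\vdash_1\Gamma$; $\mathsf{succ}\,t\simeq\mathsf{succ}\,t':\mathsf{Nat}$ if $t\simeq t':\mathsf{Nat}$; if $t,t':S\to T$ at layer 1 and $t[\mathrm{id};p(\mathrm{id})]\,x\simeq t'[\mathrm{id};p(\mathrm{id})]\,x:T$ in $\Psi;\Gamma,x:S$, then $t\simeq t':S\to T$. (6) $x\sim x:T$ if $\Psi;\Gamma\vdash_1x:T$; $u^\delta\sim u^{\delta'}:T$ if $u:(\Delta\vdash T)\in\Psi$, $\delta\simeq\delta':\Delta$; $v\,t\sim v'\,t':T$ if $v\sim v':S\to T$, $t\simeq t':S$. (7) Only for $i=1$: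 $\mathsf{box}\,t\simeq\mathsf{box}\,t:\square(\Delta\vdash T)$ if $\Psi\vdash_1\Gamma$, $\Psi;\Delta\vdash_0t:T$; if $t,t':(g:\mathsf{Ctx})\Rightarrow T$ at layer 1 and $t[p(\mathrm{id})]\,\$\,g\simeq t'[p(\mathrm{id})]\,\$\,g:T$ in $\Psi,g:\mathsf{Ctx};\Gamma[p(\mathrm{id})]$, then $t\simeq t':(g:\mathsf{Ctx})\Rightarrow T$; $\mathsf{letbox}\,u\leftarrow v\,\mathsf{in}\,t\sim\mathsf{letbox}\,u\leftarrow v'\,\mathsf{in}\,t':T'$ if $\Psi\vdash_1T'$, $v\sim v':\square(\Delta\vdash T)$ and $t\simeq t':T'[p(\mathrm{id})]$ in $\Psi,u:(\Delta\vdash T);\Gamma[p(\mathrm{id})]$; $v\,\$\,\Delta\sim v'\,\$\,\Delta:T[\mathrm{id}_\Psi,\Delta/g]$ if $v\sim v':(g:\mathsf{Ctx})\Rightarrow T$, $\Psi\vdash_0\Delta$. Fix a generic equivalence $(\simeq_i,\sim_i)$ at each layer $i\in\{0,1\}$. **Reducibility.** *Semantic types* $\Psi\vDash_iT$, inductively: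 $\Psi\vDash_i\mathsf{Nat}$ if $\vdash\Psi$; $\Psi\vDash_iS\to T$ if $\Phi\vDash_iS[\gamma]$ and $\Phi\vDash_iT[\gamma]$ for all $\gamma:\Phi\Rightarrow_g\Psi$; $\Psi\vDash_1\square(\Delta\vdash T)$ if $\Psi\vdash_0\Delta$ and $\Phi\vDash_0T[\gamma]$ for all such $\gamma$; $\Psi\vDash_1(g:\mathsf{Ctx})\Rightarrow T$ if $\Psi,g:\mathsf{Ctx}\vdash_1T$ and $\Phi\vDash_1T[q(\gamma)][\mathrm{id}_\Phi,\Gamma/g]$ for all such $\gamma$ and all $\Phi\vdash_0\Gamma$. *Semantic local contexts* $\Psi\vDash_i\Gamma$: as $\Psi\vdash_i\Gamma$, with $\Psi\vDash_iT$ in place of $\Psi\vdash_iT$. *Reducible terms* $\Psi;\Gamma\vDash_it\approx t':T$, by recursion on the layer and then on $\Psi\vDash_iT$: there are $w,w'$ with $t\searrow w:T$, $t'\searrow w':T$, $w\simeq_iw':T$, and - $T=\mathsf{Nat}$: (inductively) $w=w'=\mathsf{zero}$, or $w=\mathsf{succ}\,s$, $w'=\mathsf{succ}\,s'$ with $\Psi;\Gamma\vDash_is\approx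 s':\mathsf{Nat}$, or $w\sim_iw':\mathsf{Nat}$; - $T=S\to T'$: for all $\gamma;\tau:\Phi;\Delta\Rightarrow\Psi;\Gamma$ and $\Phi;\Delta\vDash_is\approx s':S[\gamma]$, $\Phi;\Delta\vDash_iw[\gamma;\tau]\,s\approx w'[\gamma;\tau]\,s':T'[\gamma]$; - $T=\square(\Delta\vdash T')$ ($i=1$): $w\sim_1w':T$, or $w=w'=\mathsf{box}\,s$ with $\Psi;\Delta\vdash_0s:T'$ and $\Psi;\Delta'\vDash_0s[\delta]\approx s[\delta']:T'$ for all $\Psi;\Delta'\vDash_0\delta\approx\delta':\Delta$; - $T=(g:\mathsf{Ctx})\Rightarrow T'$ ($i=1$): for all $\gamma;\tau:\Phi;\Delta\Rightarrow\Psi;\Gamma$ and $\Phi\vdash_0\Delta'$, $\Phi;\Delta\vDash_1w[\gamma;\tau]\,\$\,\Delta'\approx w'[\gamma;\tau]\,\$\,\Delta':T'[q(\gamma)][\mathrm{id}_\Phi,\Delta'/g]$. *Reducible local substitutions* $\Psi;\Gamma\vDash_i\delta\approx\delta':\Delta$, for $\Psi\vDash_i\Delta$ and $\Psi\vdash_1\Gamma$: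 for $\Delta=\cdot$, $\delta=\delta'=\cdot^{|\Gamma|}$ if $\Gamma$ ends with $\cdot$, and $\delta=\delta'=\cdot_g^{|\Gamma|}$ if it ends with $g$; for $\Delta=g$, $\Gamma$ ends with $g$ and $\delta=\delta'=\mathsf{wk}_g^{|\Gamma|}$; for $\Delta,x:T$, $\delta=\delta_1,t/x$ and $\delta'=\delta_1',t'/x$ with $\delta_1,\delta_1'$ related at $\Delta$ and $t,t'$ related at $T$. **Validity.** *Valid global substitutions* $\Phi\vDash^v\sigma:\Psi$: at $\cdot$, $\vdash\Phi$ and $\sigma=\cdot$; at $\Psi,g:\mathsf{Ctx}$, $\sigma=\sigma_1,\Gamma/g$ with $\Phi\vdash_0\Gamma$ and $\Phi\vDash^v\sigma_1:\Psi$; at $\Psi,u:(\Gamma\vdash T)$, $\sigma=\sigma_1,t/u$ with $\Phi\vDash^v\sigma_1:\Psi$, $\Phi;\Gamma[\sigma_1]\vdash_0t:T[\sigma_1]$, and $\Phi;\Delta\vDash_0t[\delta]\approx t[\delta']:T[\sigma_1]$ for all $\Phi;\Delta\vDash_0\delta\approx\delta':\Gamma[\sigma_1]$. $\Psi\vDash^v_iT$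 means $\Psi\vDash_iT$, and $\Phi\vDash_iT[\sigma]$ for all $\Phi\vDash^v\sigma:\Psi$. $\Psi\vDash^v_i\Gamma$ is defined as $\Psi\vdash_i\Gamma$ with $\Psi\vDash^v_iT$ for all types $T$ of $\Gamma$; $\vDash^v\cdot$; $\vDash^v\Psi,g:\mathsf{Ctx}$ if $\vDash^v\Psi$; $\vDash^v\Psi,u:(\Gamma\vdash T)$ if $\vDash^v\Psi$, $\Psi\vDash^v_0\Gamma$, $\Psi\vDash^v_0T$. $\Psi;\Gamma\vDash^v_it\approx t':T$ means: for all $\Phi\vDash^v\sigma:\Psi$ and $\Phi;\Delta\vDash_i\delta\approx\delta':\Gamma[\sigma]$, $\Phi;\Delta\vDash_it[\sigma][\delta]\approx t'[\sigma][\delta']:T[\sigma]$. $\Psi;\Gamma\vDash^v_i\delta\approx\delta':\Delta$ means: for all $\Phi\vDash^v\sigma:\Psi$ and $\Phi;\Delta'\vDash_i\varepsilon\approx\varepsilon':\Gamma[\sigma]$, $\Phi;\Delta'\vDash_i\delta[\sigma]\circ\varepsilon\approx\delta'[\sigma]\circ\varepsilon':\Delta[\sigma]$. **Theorem.** For every choice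 of the generic equivalences, both layers $i$, and all $\Psi,\Gamma,\Delta,t,t',T,\delta,\delta'$: *Completeness.* - If $\Psi\vdash_iT$, then $\Psi\vDash_iT$. - If $\Psi;\Gamma\vdash_it\approx t':T$, then $\Psi\vDash_iT$ and $\Psi;\Gamma\vDash_it\approx t':T$. - If $\Psi;\Gamma\vdash_i\delta\approx\delta':\Delta$, then $\Psi\vDash_i\Delta$ and $\Psi;\Gamma\vDash_i\delta\approx\delta':\Delta$. *Fundamental theorem for contexts and types.* - If $\vdash\Psi$, then $\vDash^v\Psi$. - If $\Psi\vdash_iT$, then $\Psi\vDash^v_iT$. - If $\Psi\vdash_i\Gamma$, then $\Psi\vDash^v_i\Gamma$. *Fundamental theorem for terms and local substitutions.* - If $\Psi;\Gamma\vdash_it:T$, then $\Psi;\Gamma\vDash^v_it\approx t:T$. - If $\Psi;\Gamma\vdash_i\delta:\Delta$, then $\Psi;\Gamma\vDash^v_i\delta\approx\delta:\Delta$. - If $\Psi;\Gamma\vdash_it\approx t':T$, then $\Psi;\Gamma\vDash^v_it\approx t':T$. - If $\Psi;\Gamma\vdash_i\delta\approx\delta':\Delta$, then $\Psi;\Gamma\vDash^v_i\delta\approx\delta':\Delta$.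 -/

import Mathlib

/-!
The 2-layered modal type theory with context variables.

Names are de Bruijn indices.  There are two separate name spaces:
* global variables `u` and context variables `g` index the global context `Ψ`
  (one common list of bindings, most recent binding first);
* local variables `x` index the local context `Γ` (most recent one is `0`).
-/

namespace CtxModal

/-- The layers `0` (`zero`) and `1` (`one`). -/
inductive Layer : Type
  | zero
  | one

mutual
  /-- Types `S, T ::= Nat | □ (Γ ⊢ T) | S ⟶ T | (g : Ctx) ⇒ T`. -/
  inductive Ty : Type
    | nat : Ty
    | arr : Ty → Ty → Ty
    | box : LCtx → Ty → Ty
    | pi : Ty → Ty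
  /-- Local contexts `Γ, Δ ::= · | g | Γ, x : T`. -/
  inductive LCtx : Type
    | nil : LCtx
    | var : ℕ → LCtx
    | snoc : LCtx → Ty → LCtx
end

/-- Global bindings `g : Ctx` and `u : (Γ ⊢ T)`. -/
inductive GBind : Type
  | ctx : GBind
  | code : LCtx → Ty → GBind

/-- Global contexts, the most recent binding being the head of the list. -/
abbrev GCtx : Type := List GBind

mutual
  /-- Terms.  `gvar u δ` is `u^δ`, `mlam`/`mapp` are `Λ g. t` and `t $ Γ`. -/
  inductive Tm : Type
    | var : ℕ → Tm
    | gvar : ℕ → LSub → Tm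
    | zero : Tm
    | succ : Tm → Tm
    | box : Tm → Tm
    | letbox : Tm → Tm → Tm
    | lam : Tm → Tm
    | app : Tm → Tm → Tm
    | mlam : Tm → Tm
    | mapp : Tm → LCtx → Tm
  /-- Local substitutions: `emp g? m` is the empty substitution `·_{g?}^m`, `wk g m` is `wk_g^m`,
  `snoc δ t` is `δ, t/x`. -/
  inductive LSub : Type
    | emp : Option ℕ → ℕ → LSub
    | wk : ℕ → ℕ → LSub
    | snoc : LSub → Tm → LSub
end

/-- `|Γ|`, the number of local variables. -/
def LCtx.len : LCtx → ℕ
  | .nil => 0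
  | .var _ => 0
  | .snoc Γ _ => Γ.len + 1

/-- What `Γ` ends with: `none` for `·`, `some g` for a context variable `g`. -/
def LCtx.base : LCtx → Option ℕ
  | .nil => none
  | .var g => some g
  | .snoc Γ _ => Γ.base

/-! ### Weakenings -/

/-- Weakenings `id | p(γ) | q(γ)`; used both as global and as local ones. -/
inductive Wk : Type
  | id : Wk
  | p : Wk → Wk
  | q : Wk → Wk

/-- Action of a weakening on de Bruijn indices. -/
def Wk.act : Wk → ℕ → ℕ
  | .id, n => n
  | .p γ, n => γ.act n + 1
  | .q _, 0 => 0
  | .q γ, n + 1 => γ.act n + 1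

/-- The number of `p` constructors. -/
def Wk.count : Wk → ℕ
  | .id => 0
  | .p γ => γ.count + 1
  | .q γ => γ.count

/-- `p^m(id)`. -/
def Wk.pn : ℕ → Wk
  | 0 => .id
  | m + 1 => .p (Wk.pn m)

mutual
  /-- `T[γ]`. -/
  def Ty.gwk : Ty → Wk → Ty
    | .nat, _ => .nat
    | .arr S T, γ => .arr (S.gwk γ) (T.gwk γ)
    | .box Γ T, γ => .box (Γ.gwk γ) (T.gwk γ)
    | .pi T, γ => .pi (T.gwk (.q γ))
  /-- `Γ[γ]`. -/
  def LCtx.gwk : LCtx → Wk → LCtx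
    | .nil, _ => .nil
    | .var g, γ => .var (γ.act g)
    | .snoc Γ T, γ => .snoc (Γ.gwk γ) (T.gwk γ)
end

/-- `B[γ]`. -/
def GBind.gwk : GBind → Wk → GBind
  | .ctx, _ => .ctx
  | .code Γ T, γ => .code (Γ.gwk γ) (T.gwk γ)

mutual
  /-- Global weakening of terms, `t[γ]`. -/
  def Tm.gwk : Tm → Wk → Tm
    | .var x, _ => .var x
    | .gvar u δ, γ => .gvar (γ.act u) (δ.gwk γ)
    | .zero, _ => .zero
    | .succ t, γ => .succ (t.gwk γ)
    | .box t, γ => .box (t.gwk γ)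
    | .letbox s t, γ => .letbox (s.gwk γ) (t.gwk (.q γ))
    | .lam t, γ => .lam (t.gwk γ)
    | .app t s, γ => .app (t.gwk γ) (s.gwk γ)
    | .mlam t, γ => .mlam (t.gwk (.q γ))
    | .mapp t Γ, γ => .mapp (t.gwk γ) (Γ.gwk γ)
  /-- Global weakening of local substitutions, `δ[γ]`. -/
  def LSub.gwk : LSub → Wk → LSub
    | .emp g m, γ => .emp (g.map γ.act) m
    | .wk g m, γ => .wk (γ.act g) m
    | .snoc δ t, γ => .snoc (δ.gwk γ) (t.gwk γ)
end

mutual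
  /-- Local weakening of terms, `t[τ]`. -/
  def Tm.lwk : Tm → Wk → Tm
    | .var x, τ => .var (τ.act x)
    | .gvar u δ, τ => .gvar u (δ.lwk τ)
    | .zero, _ => .zero
    | .succ t, τ => .succ (t.lwk τ)
    | .box t, _ => .box t
    | .letbox s t, τ => .letbox (s.lwk τ) (t.lwk τ)
    | .lam t, τ => .lam (t.lwk (.q τ))
    | .app t s, τ => .app (t.lwk τ) (s.lwk τ)
    | .mlam t, τ => .mlam (t.lwk τ)
    | .mapp t Γ, τ => .mapp (t.lwk τ) Γ
  /-- Local weakening of local substitutions, `δ[τ]`. -/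
  def LSub.lwk : LSub → Wk → LSub
    | .emp g m, τ => .emp g (m + τ.count)
    | .wk g m, τ => .wk g (m + τ.count)
    | .snoc δ t, τ => .snoc (δ.lwk τ) (t.lwk τ)
end

/-! ### Local substitutions -/

/-- The number `m` at the base of a local substitution (written with a wide hat). -/
def LSub.hat : LSub → ℕ
  | .emp _ m => m
  | .wk _ m => m
  | .snoc δ _ => δ.hat

/-- The context variable at the base of a local substitution, if any (written with a check). -/
def LSub.chk : LSub → Option ℕ
  | .emp g _ => g
  | .wk g _ => some g
  | .snoc δ _ => δ.chk

/-- `δ(x)`; the value off the domain of `δ` is irrelevant. -/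
def LSub.lookup : LSub → ℕ → Tm
  | .snoc _ t, 0 => t
  | .snoc δ _, x + 1 => δ.lookup x
  | .emp _ _, _ => .zero
  | .wk _ _, _ => .zero

mutual
  /-- `t[δ]`. -/
  def Tm.lsub : Tm → LSub → Tm
    | .var x, δ => δ.lookup x
    | .gvar u δ', δ => .gvar u (δ'.comp δ)
    | .zero, _ => .zero
    | .succ t, δ => .succ (t.lsub δ)
    | .box t, _ => .box t
    | .letbox s t, δ => .letbox (s.lsub δ) (t.lsub (δ.gwk (.p .id)))
    | .lam t, δ => .lam (t.lsub (.snoc (δ.lwk (.p .id)) (.var 0)))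
    | .app t s, δ => .app (t.lsub δ) (s.lsub δ)
    | .mlam t, δ => .mlam (t.lsub (δ.gwk (.p .id)))
    | .mapp t Γ, δ => .mapp (t.lsub δ) Γ
  /-- `δ' ∘ δ`. -/
  def LSub.comp : LSub → LSub → LSub
    | .emp none _, δ => .emp δ.chk δ.hat
    | .emp (some g) _, δ => .emp (some g) δ.hat
    | .wk g _, δ => .wk g δ.hat
    | .snoc δ' t, δ => .snoc (δ'.comp δ) (t.lsub δ)
end

/-- The local weakening substitution `wk^m_Γ`. -/
def LSub.wkOf : ℕ → LCtx → LSub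
  | m, .nil => .emp none m
  | m, .var g => .wk g m
  | m, .snoc Γ _ => .snoc (LSub.wkOf (m + 1) Γ) (.var m)

/-- The local identity substitution `id_Γ`. -/
def LSub.idOf (Γ : LCtx) : LSub := LSub.wkOf 0 Γ

/-! ### Global substitutions -/

/-- Entries of global substitutions: `t/u`, `Γ/g`, and `v^id/u`.  The last form is used only when a
substitution is pushed under the binder `u` of `letbox`, where `id` is the identity of the
(unrecorded) local context of the bound variable; since `(v^id)[δ] = v^(id ∘ δ) = v^δ`, it is
represented by `v` alone. -/
inductive GEntry : Type
  | tm : Tm → GEntry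
  | ctx : LCtx → GEntry
  | bv : ℕ → GEntry

/-- Global substitutions, the most recent entry being the head of the list. -/
abbrev GSub : Type := List GEntry

def GEntry.gwk : GEntry → Wk → GEntry
  | .tm t, γ => .tm (t.gwk γ)
  | .ctx Γ, γ => .ctx (Γ.gwk γ)
  | .bv u, γ => .bv (γ.act u)

/-- `σ[γ]`. -/
def GSub.gwk (σ : GSub) (γ : Wk) : GSub := σ.map fun e => e.gwk γ

/-- `σ(g)`; the value is irrelevant if `g` is not bound to a local context. -/
def GSub.lookupCtx (σ : GSub) (g : ℕ) : LCtx :=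
  match σ[g]? with
  | some (.ctx Γ) => Γ
  | _ => .nil

/-- `σ(u)[δ]`; the value is irrelevant if `u` is not bound to a term. -/
def GSub.appVar (σ : GSub) (u : ℕ) (δ : LSub) : Tm :=
  match σ[u]? with
  | some (.tm t) => t.lsub δ
  | some (.bv v) => .gvar v δ
  | _ => .zero

/-- `q(σ) = σ[p(id)], g/g`. -/
def GSub.qCtx (σ : GSub) : GSub := .ctx (.var 0) :: GSub.gwk σ (.p .id)

/-- `q(σ) = σ[p(id)], u^id/u`. -/
def GSub.qTm (σ : GSub) : GSub := .bv 0 :: GSub.gwk σ (.p .id)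

mutual
  /-- `T[σ]`. -/
  def Ty.gsub : Ty → GSub → Ty
    | .nat, _ => .nat
    | .arr S T, σ => .arr (S.gsub σ) (T.gsub σ)
    | .box Γ T, σ => .box (Γ.gsub σ) (T.gsub σ)
    | .pi T, σ => .pi (T.gsub (GSub.qCtx σ))
  /-- `Γ[σ]`. -/
  def LCtx.gsub : LCtx → GSub → LCtx
    | .nil, _ => .nil
    | .var g, σ => GSub.lookupCtx σ g
    | .snoc Γ T, σ => .snoc (Γ.gsub σ) (T.gsub σ)
end

mutual
  /-- `t[σ]`. -/
  def Tm.gsub : Tm → GSub → Tm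
    | .var x, _ => .var x
    | .gvar u δ, σ => GSub.appVar σ u (δ.gsub σ)
    | .zero, _ => .zero
    | .succ t, σ => .succ (t.gsub σ)
    | .box t, σ => .box (t.gsub σ)
    | .letbox s t, σ => .letbox (s.gsub σ) (t.gsub (GSub.qTm σ))
    | .lam t, σ => .lam (t.gsub σ)
    | .app t s, σ => .app (t.gsub σ) (s.gsub σ)
    | .mlam t, σ => .mlam (t.gsub (GSub.qCtx σ))
    | .mapp t Γ, σ => .mapp (t.gsub σ) (Γ.gsub σ)
  /-- `δ[σ]`. -/
  def LSub.gsub : LSub → GSub → LSub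
    | .emp none m, _ => .emp none m
    | .emp (some g) m, σ =>
        .emp (GSub.lookupCtx σ g).base ((GSub.lookupCtx σ g).len + m)
    | .wk g m, σ => (LSub.idOf (GSub.lookupCtx σ g)).lwk (Wk.pn m)
    | .snoc δ t, σ => .snoc (δ.gsub σ) (t.gsub σ)
end

/-- The global weakening substitution `wk^m_Ψ`. -/
def GSub.wkOf : ℕ → GCtx → GSub
  | _, [] => []
  | m, .ctx :: Ψ => .ctx (.var m) :: GSub.wkOf (m + 1) Ψ
  | m, .code Γ _ :: Ψ =>
      .tm (.gvar m ((LSub.idOf Γ).gwk (Wk.pn (m + 1)))) :: GSub.wkOf (m + 1) Ψ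

/-- The global identity substitution `id_Ψ`. -/
def GSub.idOf (Ψ : GCtx) : GSub := GSub.wkOf 0 Ψ

/-! ### Well-formedness -/

/-- Lookup `u : B ∈ Ψ`, taking global weakening into account. -/
inductive HasG : GCtx → ℕ → GBind → Prop
  | here {Ψ : GCtx} {B : GBind} : HasG (B :: Ψ) 0 (B.gwk (.p .id))
  | there {Ψ : GCtx} {B B' : GBind} {u : ℕ} :
      HasG Ψ u B → HasG (B' :: Ψ) (u + 1) (B.gwk (.p .id))

/-- Lookup `x : T ∈ Γ`. -/
inductive HasL : LCtx → ℕ → Ty → Prop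
  | here {Γ : LCtx} {T : Ty} : HasL (.snoc Γ T) 0 T
  | there {Γ : LCtx} {T T' : Ty} {x : ℕ} : HasL Γ x T → HasL (.snoc Γ T') (x + 1) T

mutual
  /-- `⊢ Ψ`. -/
  inductive WfG : GCtx → Prop
    | nil : WfG []
    | ctx {Ψ : GCtx} : WfG Ψ → WfG (.ctx :: Ψ)
    | code {Ψ : GCtx} {Γ : LCtx} {T : Ty} :
        WfL .zero Ψ Γ → WfT .zero Ψ T → WfG (.code Γ T :: Ψ)
  /-- `Ψ ⊢ᵢ Γ`. -/
  inductive WfL : Layer → GCtx → LCtx → Prop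
    | nil {i : Layer} {Ψ : GCtx} : WfG Ψ → WfL i Ψ .nil
    | var {i : Layer} {Ψ : GCtx} {g : ℕ} : WfG Ψ → HasG Ψ g .ctx → WfL i Ψ (.var g)
    | snoc {i : Layer} {Ψ : GCtx} {Γ : LCtx} {T : Ty} :
        WfL i Ψ Γ → WfT i Ψ T → WfL i Ψ (.snoc Γ T)
  /-- `Ψ ⊢ᵢ T`. -/
  inductive WfT : Layer → GCtx → Ty → Prop
    | nat {i : Layer} {Ψ : GCtx} : WfG Ψ → WfT i Ψ .nat
    | arr {i : Layer} {Ψ : GCtx} {S T : Ty} :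
        WfT i Ψ S → WfT i Ψ T → WfT i Ψ (.arr S T)
    | box {Ψ : GCtx} {Δ : LCtx} {T : Ty} :
        WfL .zero Ψ Δ → WfT .zero Ψ T → WfT .one Ψ (.box Δ T)
    | pi {Ψ : GCtx} {T : Ty} : WfT .one (.ctx :: Ψ) T → WfT .one Ψ (.pi T)
end

/-- `Ψ ⊢ B` for global bindings. -/
inductive WfB : GCtx → GBind → Prop
  | ctx {Ψ : GCtx} : WfG Ψ → WfB Ψ .ctx
  | code {Ψ : GCtx} {Γ : LCtx} {T : Ty} :
      WfL .zero Ψ Γ → WfT .zero Ψ T → WfB Ψ (.code Γ T)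

/-- `GWk γ Ψ Φ` is `γ : Ψ ⟹g Φ`. -/
inductive GWk : Wk → GCtx → GCtx → Prop
  | id {Ψ : GCtx} : WfG Ψ → GWk .id Ψ Ψ
  | p {γ : Wk} {Ψ Φ : GCtx} {B : GBind} : GWk γ Ψ Φ → WfB Ψ B → GWk (.p γ) (B :: Ψ) Φ
  | q {γ : Wk} {Ψ Φ : GCtx} {B : GBind} :
      GWk γ Ψ Φ → WfB Φ B → WfB Ψ (B.gwk γ) → GWk (.q γ) (B.gwk γ :: Ψ) (B :: Φ)

/-- `LWk i Ψ τ Γ Δ` is `τ : Ψ; Γ ⟹ᵢ Δ`. -/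
inductive LWk : Layer → GCtx → Wk → LCtx → LCtx → Prop
  | id {i : Layer} {Ψ : GCtx} {Γ : LCtx} : WfL i Ψ Γ → LWk i Ψ .id Γ Γ
  | p {i : Layer} {Ψ : GCtx} {τ : Wk} {Γ Δ : LCtx} {T : Ty} :
      LWk i Ψ τ Γ Δ → WfT i Ψ T → LWk i Ψ (.p τ) (.snoc Γ T) Δ
  | q {i : Layer} {Ψ : GCtx} {τ : Wk} {Γ Δ : LCtx} {T : Ty} :
      LWk i Ψ τ Γ Δ → WfT i Ψ T → LWk i Ψ (.q τ) (.snoc Γ T) (.snoc Δ T)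

/-- `DWk γ τ Ψ Γ Φ Δ` is `γ; τ : Ψ; Γ ⟹ Φ; Δ` (at layer `1`). -/
def DWk (γ τ : Wk) (Ψ : GCtx) (Γ : LCtx) (Φ : GCtx) (Δ : LCtx) : Prop :=
  GWk γ Ψ Φ ∧ LWk .one Ψ τ Γ (Δ.gwk γ)

/-- `t[γ; τ] = t[γ][τ]`. -/
def Tm.dwk (t : Tm) (γ τ : Wk) : Tm := (t.gwk γ).lwk τ

/-! ### Typing and equivalence -/

mutual
  /-- `Ψ; Γ ⊢ᵢ t : T`. -/
  inductive TmTy : Layer → GCtx → LCtx → Tm → Ty → Prop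
    | var {i : Layer} {Ψ : GCtx} {Γ : LCtx} {x : ℕ} {T : Ty} :
        WfL i Ψ Γ → HasL Γ x T → TmTy i Ψ Γ (.var x) T
    | gvar {i : Layer} {Ψ : GCtx} {Γ Δ : LCtx} {u : ℕ} {δ : LSub} {T : Ty} :
        LSubTy i Ψ Γ δ Δ → HasG Ψ u (.code Δ T) → TmTy i Ψ Γ (.gvar u δ) T
    | zero {i : Layer} {Ψ : GCtx} {Γ : LCtx} : WfL i Ψ Γ → TmTy i Ψ Γ .zero .nat
    | succ {i : Layer} {Ψ : GCtx} {Γ : LCtx} {t : Tm} :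
        TmTy i Ψ Γ t .nat → TmTy i Ψ Γ (.succ t) .nat
    | lam {i : Layer} {Ψ : GCtx} {Γ : LCtx} {t : Tm} {S T : Ty} :
        TmTy i Ψ (.snoc Γ S) t T → TmTy i Ψ Γ (.lam t) (.arr S T)
    | app {i : Layer} {Ψ : GCtx} {Γ : LCtx} {t s : Tm} {S T : Ty} :
        TmTy i Ψ Γ t (.arr S T) → TmTy i Ψ Γ s S → TmTy i Ψ Γ (.app t s) T
    | box {Ψ : GCtx} {Γ Δ : LCtx} {t : Tm} {T : Ty} :
        WfL .one Ψ Γ → TmTy .zero Ψ Δ t T → TmTy .one Ψ Γ (.box t) (.box Δ T)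
    | letbox {Ψ : GCtx} {Γ Δ : LCtx} {s t : Tm} {T T' : Ty} :
        TmTy .one Ψ Γ s (.box Δ T) → WfL .zero Ψ Δ → WfT .zero Ψ T → WfT .one Ψ T' →
        TmTy .one (.code Δ T :: Ψ) (Γ.gwk (.p .id)) t (T'.gwk (.p .id)) →
        TmTy .one Ψ Γ (.letbox s t) T'
    | mlam {Ψ : GCtx} {Γ : LCtx} {t : Tm} {T : Ty} :
        WfL .one Ψ Γ → TmTy .one (.ctx :: Ψ) (Γ.gwk (.p .id)) t T →
        TmTy .one Ψ Γ (.mlam t) (.pi T)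
    | mapp {Ψ : GCtx} {Γ Δ : LCtx} {t : Tm} {T : Ty} :
        TmTy .one Ψ Γ t (.pi T) → WfL .zero Ψ Δ →
        TmTy .one Ψ Γ (.mapp t Δ) (T.gsub (.ctx Δ :: GSub.idOf Ψ))
  /-- `Ψ; Γ ⊢ᵢ δ : Δ`. -/
  inductive LSubTy : Layer → GCtx → LCtx → LSub → LCtx → Prop
    | emp {i : Layer} {Ψ : GCtx} {Γ : LCtx} :
        WfL i Ψ Γ → Γ.base = none → LSubTy i Ψ Γ (.emp none Γ.len) .nil
    | empVar {i : Layer} {Ψ : GCtx} {Γ : LCtx} {g : ℕ} :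
        WfL i Ψ Γ → HasG Ψ g .ctx → Γ.base = some g →
        LSubTy i Ψ Γ (.emp (some g) Γ.len) .nil
    | wk {i : Layer} {Ψ : GCtx} {Γ : LCtx} {g : ℕ} :
        WfL i Ψ Γ → HasG Ψ g .ctx → Γ.base = some g →
        LSubTy i Ψ Γ (.wk g Γ.len) (.var g)
    | snoc {i : Layer} {Ψ : GCtx} {Γ Δ : LCtx} {δ : LSub} {t : Tm} {T : Ty} :
        LSubTy i Ψ Γ δ Δ → TmTy i Ψ Γ t T → LSubTy i Ψ Γ (.snoc δ t) (.snoc Δ T)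
end

mutual
  /-- `Ψ; Γ ⊢ᵢ t ≈ t' : T`.  The `β` and `η` rules exist at layer `1` only. -/
  inductive TmEq : Layer → GCtx → LCtx → Tm → Tm → Ty → Prop
    | symm {i : Layer} {Ψ : GCtx} {Γ : LCtx} {t t' : Tm} {T : Ty} :
        TmEq i Ψ Γ t t' T → TmEq i Ψ Γ t' t T
    | trans {i : Layer} {Ψ : GCtx} {Γ : LCtx} {t t' t'' : Tm} {T : Ty} :
        TmEq i Ψ Γ t t' T → TmEq i Ψ Γ t' t'' T → TmEq i Ψ Γ t t'' T
    | var {i : Layer} {Ψ : GCtx} {Γ : LCtx} {x : ℕ} {T : Ty} :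
        WfL i Ψ Γ → HasL Γ x T → TmEq i Ψ Γ (.var x) (.var x) T
    | gvar {i : Layer} {Ψ : GCtx} {Γ Δ : LCtx} {u : ℕ} {δ δ' : LSub} {T : Ty} :
        LSubEq i Ψ Γ δ δ' Δ → HasG Ψ u (.code Δ T) →
        TmEq i Ψ Γ (.gvar u δ) (.gvar u δ') T
    | zero {i : Layer} {Ψ : GCtx} {Γ : LCtx} : WfL i Ψ Γ → TmEq i Ψ Γ .zero .zero .nat
    | succ {i : Layer} {Ψ : GCtx} {Γ : LCtx} {t t' : Tm} :
        TmEq i Ψ Γ t t' .nat → TmEq i Ψ Γ (.succ t) (.succ t') .nat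
    | lam {i : Layer} {Ψ : GCtx} {Γ : LCtx} {t t' : Tm} {S T : Ty} :
        TmEq i Ψ (.snoc Γ S) t t' T → TmEq i Ψ Γ (.lam t) (.lam t') (.arr S T)
    | app {i : Layer} {Ψ : GCtx} {Γ : LCtx} {t t' s s' : Tm} {S T : Ty} :
        TmEq i Ψ Γ t t' (.arr S T) → TmEq i Ψ Γ s s' S →
        TmEq i Ψ Γ (.app t s) (.app t' s') T
    | box {Ψ : GCtx} {Γ Δ : LCtx} {t t' : Tm} {T : Ty} :
        WfL .one Ψ Γ → TmEq .zero Ψ Δ t t' T →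
        TmEq .one Ψ Γ (.box t) (.box t') (.box Δ T)
    | letbox {Ψ : GCtx} {Γ Δ : LCtx} {s s' t t' : Tm} {T T' : Ty} :
        TmEq .one Ψ Γ s s' (.box Δ T) → WfL .zero Ψ Δ → WfT .zero Ψ T → WfT .one Ψ T' →
        TmEq .one (.code Δ T :: Ψ) (Γ.gwk (.p .id)) t t' (T'.gwk (.p .id)) →
        TmEq .one Ψ Γ (.letbox s t) (.letbox s' t') T'
    | mlam {Ψ : GCtx} {Γ : LCtx} {t t' : Tm} {T : Ty} :
        WfL .one Ψ Γ → TmEq .one (.ctx :: Ψ) (Γ.gwk (.p .id)) t t' T →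
        TmEq .one Ψ Γ (.mlam t) (.mlam t') (.pi T)
    | mapp {Ψ : GCtx} {Γ Δ : LCtx} {t t' : Tm} {T : Ty} :
        TmEq .one Ψ Γ t t' (.pi T) → WfL .zero Ψ Δ →
        TmEq .one Ψ Γ (.mapp t Δ) (.mapp t' Δ) (T.gsub (.ctx Δ :: GSub.idOf Ψ))
    | betaLam {Ψ : GCtx} {Γ : LCtx} {t s : Tm} {S T : Ty} :
        TmTy .one Ψ (.snoc Γ S) t T → TmTy .one Ψ Γ s S →
        TmEq .one Ψ Γ (.app (.lam t) s) (t.lsub (.snoc (LSub.idOf Γ) s)) T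
    | etaLam {Ψ : GCtx} {Γ : LCtx} {t : Tm} {S T : Ty} :
        TmTy .one Ψ Γ t (.arr S T) →
        TmEq .one Ψ Γ t (.lam (.app (t.lwk (.p .id)) (.var 0))) (.arr S T)
    | betaBox {Ψ : GCtx} {Γ Δ : LCtx} {s t : Tm} {T T' : Ty} :
        TmTy .zero Ψ Δ s T → WfL .one Ψ Γ → WfT .one Ψ T' →
        TmTy .one (.code Δ T :: Ψ) (Γ.gwk (.p .id)) t (T'.gwk (.p .id)) →
        TmEq .one Ψ Γ (.letbox (.box s) t) (t.gsub (.tm s :: GSub.idOf Ψ)) T'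
    | betaMlam {Ψ : GCtx} {Γ Δ : LCtx} {t : Tm} {T : Ty} :
        WfL .one Ψ Γ → TmTy .one (.ctx :: Ψ) (Γ.gwk (.p .id)) t T → WfL .zero Ψ Δ →
        TmEq .one Ψ Γ (.mapp (.mlam t) Δ) (t.gsub (.ctx Δ :: GSub.idOf Ψ))
          (T.gsub (.ctx Δ :: GSub.idOf Ψ))
    | etaMlam {Ψ : GCtx} {Γ : LCtx} {t : Tm} {T : Ty} :
        TmTy .one Ψ Γ t (.pi T) →
        TmEq .one Ψ Γ t (.mlam (.mapp (t.gwk (.p .id)) (.var 0))) (.pi T)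
  /-- `Ψ; Γ ⊢ᵢ δ ≈ δ' : Δ`. -/
  inductive LSubEq : Layer → GCtx → LCtx → LSub → LSub → LCtx → Prop
    | emp {i : Layer} {Ψ : GCtx} {Γ : LCtx} :
        WfL i Ψ Γ → Γ.base = none →
        LSubEq i Ψ Γ (.emp none Γ.len) (.emp none Γ.len) .nil
    | empVar {i : Layer} {Ψ : GCtx} {Γ : LCtx} {g : ℕ} :
        WfL i Ψ Γ → HasG Ψ g .ctx → Γ.base = some g →
        LSubEq i Ψ Γ (.emp (some g) Γ.len) (.emp (some g) Γ.len) .nil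
    | wk {i : Layer} {Ψ : GCtx} {Γ : LCtx} {g : ℕ} :
        WfL i Ψ Γ → HasG Ψ g .ctx → Γ.base = some g →
        LSubEq i Ψ Γ (.wk g Γ.len) (.wk g Γ.len) (.var g)
    | snoc {i : Layer} {Ψ : GCtx} {Γ Δ : LCtx} {δ δ' : LSub} {t t' : Tm} {T : Ty} :
        LSubEq i Ψ Γ δ δ' Δ → TmEq i Ψ Γ t t' T →
        LSubEq i Ψ Γ (.snoc δ t) (.snoc δ' t') (.snoc Δ T)
end

/-! ### Weak head reduction -/

/-- Neutral forms `v ::= x | u^δ | v t | letbox u v t | v $ Γ`. -/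
inductive IsNe : Tm → Prop
  | var {x : ℕ} : IsNe (.var x)
  | gvar {u : ℕ} {δ : LSub} : IsNe (.gvar u δ)
  | app {v t : Tm} : IsNe v → IsNe (.app v t)
  | letbox {v t : Tm} : IsNe v → IsNe (.letbox v t)
  | mapp {v : Tm} {Γ : LCtx} : IsNe v → IsNe (.mapp v Γ)

/-- Weak head normal forms `w ::= v | zero | succ t | box t | λ x. t | Λ g. t`. -/
inductive IsNf : Tm → Prop
  | ne {v : Tm} : IsNe v → IsNf v
  | zero : IsNf .zero
  | succ {t : Tm} : IsNf (.succ t)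
  | box {t : Tm} : IsNf (.box t)
  | lam {t : Tm} : IsNf (.lam t)
  | mlam {t : Tm} : IsNf (.mlam t)

/-- One-step weak head reduction `Ψ; Γ ⊢ t ⤳ t' : T` (at layer `1`). -/
inductive Step : GCtx → LCtx → Tm → Tm → Ty → Prop
  | app {Ψ : GCtx} {Γ : LCtx} {t t' s : Tm} {S T : Ty} :
      Step Ψ Γ t t' (.arr S T) → TmTy .one Ψ Γ s S → Step Ψ Γ (.app t s) (.app t' s) T
  | letbox {Ψ : GCtx} {Γ Δ : LCtx} {s s' t : Tm} {T T' : Ty} :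
      Step Ψ Γ s s' (.box Δ T) → WfT .one Ψ T' →
      TmTy .one (.code Δ T :: Ψ) (Γ.gwk (.p .id)) t (T'.gwk (.p .id)) →
      Step Ψ Γ (.letbox s t) (.letbox s' t) T'
  | mapp {Ψ : GCtx} {Γ Δ : LCtx} {t t' : Tm} {T : Ty} :
      Step Ψ Γ t t' (.pi T) → WfL .zero Ψ Δ →
      Step Ψ Γ (.mapp t Δ) (.mapp t' Δ) (T.gsub (.ctx Δ :: GSub.idOf Ψ))
  | betaLam {Ψ : GCtx} {Γ : LCtx} {t s : Tm} {S T : Ty} :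
      TmTy .one Ψ (.snoc Γ S) t T → TmTy .one Ψ Γ s S →
      Step Ψ Γ (.app (.lam t) s) (t.lsub (.snoc (LSub.idOf Γ) s)) T
  | betaMlam {Ψ : GCtx} {Γ Δ : LCtx} {t : Tm} {T : Ty} :
      WfL .one Ψ Γ → TmTy .one (.ctx :: Ψ) (Γ.gwk (.p .id)) t T → WfL .zero Ψ Δ →
      Step Ψ Γ (.mapp (.mlam t) Δ) (t.gsub (.ctx Δ :: GSub.idOf Ψ))
        (T.gsub (.ctx Δ :: GSub.idOf Ψ))
  | betaBox {Ψ : GCtx} {Γ Δ : LCtx} {s t : Tm} {T T' : Ty} :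
      TmTy .zero Ψ Δ s T → WfL .one Ψ Γ → WfT .one Ψ T' →
      TmTy .one (.code Δ T :: Ψ) (Γ.gwk (.p .id)) t (T'.gwk (.p .id)) →
      Step Ψ Γ (.letbox (.box s) t) (t.gsub (.tm s :: GSub.idOf Ψ)) T'

/-- The reflexive transitive closure `Ψ; Γ ⊢ t ⤳* t' : T`, as a relation on terms of type `T`. -/
inductive Steps : GCtx → LCtx → Tm → Tm → Ty → Prop
  | refl {Ψ : GCtx} {Γ : LCtx} {t : Tm} {T : Ty} : TmTy .one Ψ Γ t T → Steps Ψ Γ t t T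
  | head {Ψ : GCtx} {Γ : LCtx} {t t' t'' : Tm} {T : Ty} :
      Step Ψ Γ t t' T → Steps Ψ Γ t' t'' T → Steps Ψ Γ t t'' T

/-- `Ψ; Γ ⊢ t ↘ w : T`: `t` reduces to the weak head normal form `w`. -/
def Whnf (Ψ : GCtx) (Γ : LCtx) (t w : Tm) (T : Ty) : Prop :=
  Steps Ψ Γ t w T ∧ IsNf w

/-! ### Generic equivalence -/

/-- Typed binary relations on terms. -/
abbrev TmRel : Type := GCtx → LCtx → Tm → Tm → Ty → Prop

/-- The extension of a typed relation on terms to local substitutions. -/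
inductive GenLSub (R : TmRel) : GCtx → LCtx → LSub → LSub → LCtx → Prop
  | emp {Ψ : GCtx} {Γ : LCtx} :
      WfL .one Ψ Γ → Γ.base = none →
      GenLSub R Ψ Γ (.emp none Γ.len) (.emp none Γ.len) .nil
  | empVar {Ψ : GCtx} {Γ : LCtx} {g : ℕ} :
      WfL .one Ψ Γ → HasG Ψ g .ctx → Γ.base = some g →
      GenLSub R Ψ Γ (.emp (some g) Γ.len) (.emp (some g) Γ.len) .nil
  | wk {Ψ : GCtx} {Γ : LCtx} {g : ℕ} :
      WfL .one Ψ Γ → HasG Ψ g .ctx → Γ.base = some g →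
      GenLSub R Ψ Γ (.wk g Γ.len) (.wk g Γ.len) (.var g)
  | snoc {Ψ : GCtx} {Γ Δ : LCtx} {δ δ' : LSub} {t t' : Tm} {T : Ty} :
      GenLSub R Ψ Γ δ δ' Δ → R Ψ Γ t t' T →
      GenLSub R Ψ Γ (.snoc δ t) (.snoc δ' t') (.snoc Δ T)

/-- A generic equivalence at layer `i`: a relation `tm` between terms (`t ≃ t'`) and a relation `ne`
between neutral terms (`v ∼ v'`), subject to the following laws.  The laws for `□` and for
meta-functions are imposed at layer `1` only. -/
structure GenericEq (i : Layer) where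
  tm : TmRel
  ne : TmRel
  ne_isNe : ∀ {Ψ Γ v v' T}, ne Ψ Γ v v' T → IsNe v ∧ IsNe v'
  -- subsumption
  ne_tm : ∀ {Ψ Γ v v' T}, ne Ψ Γ v v' T → tm Ψ Γ v v' T
  tm_eq : ∀ {Ψ Γ t t' T}, tm Ψ Γ t t' T → TmEq .one Ψ Γ t t' T
  -- partial equivalence relations
  tm_symm : ∀ {Ψ Γ t t' T}, tm Ψ Γ t t' T → tm Ψ Γ t' t T
  tm_trans : ∀ {Ψ Γ t t' t'' T}, tm Ψ Γ t t' T → tm Ψ Γ t' t'' T → tm Ψ Γ t t'' T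
  ne_symm : ∀ {Ψ Γ v v' T}, ne Ψ Γ v v' T → ne Ψ Γ v' v T
  ne_trans : ∀ {Ψ Γ v v' v'' T}, ne Ψ Γ v v' T → ne Ψ Γ v' v'' T → ne Ψ Γ v v'' T
  -- monotonicity
  tm_mono : ∀ {γ τ Ψ Γ Φ Δ t t' T}, DWk γ τ Ψ Γ Φ Δ → tm Φ Δ t t' T →
    tm Ψ Γ (t.dwk γ τ) (t'.dwk γ τ) (T.gwk γ)
  ne_mono : ∀ {γ τ Ψ Γ Φ Δ v v' T}, DWk γ τ Ψ Γ Φ Δ → ne Φ Δ v v' T →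
    ne Ψ Γ (v.dwk γ τ) (v'.dwk γ τ) (T.gwk γ)
  -- weak head closure
  whead : ∀ {Ψ Γ t t' w w' T}, Whnf Ψ Γ t w T → Whnf Ψ Γ t' w' T → tm Ψ Γ w w' T →
    tm Ψ Γ t t' T
  -- congruence
  tm_zero : ∀ {Ψ Γ}, WfL .one Ψ Γ → tm Ψ Γ .zero .zero .nat
  tm_succ : ∀ {Ψ Γ t t'}, tm Ψ Γ t t' .nat → tm Ψ Γ (.succ t) (.succ t') .nat
  tm_fun : ∀ {Ψ Γ t t' S T}, TmTy .one Ψ Γ t (.arr S T) → TmTy .one Ψ Γ t' (.arr S T) →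
    tm Ψ (.snoc Γ S) (.app (t.lwk (.p .id)) (.var 0)) (.app (t'.lwk (.p .id)) (.var 0)) T →
    tm Ψ Γ t t' (.arr S T)
  tm_box : i = .one → ∀ {Ψ Γ Δ t T}, WfL .one Ψ Γ → TmTy .zero Ψ Δ t T →
    tm Ψ Γ (.box t) (.box t) (.box Δ T)
  tm_mfun : i = .one → ∀ {Ψ Γ t t' T},
    TmTy .one Ψ Γ t (.pi T) → TmTy .one Ψ Γ t' (.pi T) →
    tm (.ctx :: Ψ) (Γ.gwk (.p .id)) (.mapp (t.gwk (.p .id)) (.var 0))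
      (.mapp (t'.gwk (.p .id)) (.var 0)) T →
    tm Ψ Γ t t' (.pi T)
  -- congruence of neutrals
  ne_var : ∀ {Ψ Γ x T}, TmTy .one Ψ Γ (.var x) T → ne Ψ Γ (.var x) (.var x) T
  ne_gvar : ∀ {Ψ Γ Δ u δ δ' T}, HasG Ψ u (.code Δ T) → GenLSub tm Ψ Γ δ δ' Δ →
    ne Ψ Γ (.gvar u δ) (.gvar u δ') T
  ne_app : ∀ {Ψ Γ v v' t t' S T}, ne Ψ Γ v v' (.arr S T) → tm Ψ Γ t t' S →
    ne Ψ Γ (.app v t) (.app v' t') T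
  ne_letbox : i = .one → ∀ {Ψ Γ Δ v v' t t' T T'}, WfT .one Ψ T' →
    ne Ψ Γ v v' (.box Δ T) →
    tm (.code Δ T :: Ψ) (Γ.gwk (.p .id)) t t' (T'.gwk (.p .id)) →
    ne Ψ Γ (.letbox v t) (.letbox v' t') T'
  ne_mapp : i = .one → ∀ {Ψ Γ Δ v v' T}, ne Ψ Γ v v' (.pi T) → WfL .zero Ψ Δ →
    ne Ψ Γ (.mapp v Δ) (.mapp v' Δ) (T.gsub (.ctx Δ :: GSub.idOf Ψ))

/-! ### Reducibility -/

/-- Semantic well-formedness of types, `Ψ ⊨ᵢ T`. -/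
inductive SemTy : Layer → GCtx → Ty → Prop
  | nat {i : Layer} {Ψ : GCtx} : WfG Ψ → SemTy i Ψ .nat
  | arr {i : Layer} {Ψ : GCtx} {S T : Ty} :
      (∀ γ Φ, GWk γ Φ Ψ → SemTy i Φ (S.gwk γ)) →
      (∀ γ Φ, GWk γ Φ Ψ → SemTy i Φ (T.gwk γ)) → SemTy i Ψ (.arr S T)
  | box {Ψ : GCtx} {Δ : LCtx} {T : Ty} :
      WfL .zero Ψ Δ → (∀ γ Φ, GWk γ Φ Ψ → SemTy .zero Φ (T.gwk γ)) →
      SemTy .one Ψ (.box Δ T)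
  | pi {Ψ : GCtx} {T : Ty} :
      WfT .one (.ctx :: Ψ) T →
      (∀ γ Φ Γ, GWk γ Φ Ψ → WfL .zero Φ Γ →
        SemTy .one Φ ((T.gwk (.q γ)).gsub (.ctx Γ :: GSub.idOf Φ))) →
      SemTy .one Ψ (.pi T)

/-- Semantic well-formedness of local contexts, `Ψ ⊨ᵢ Γ`. -/
inductive SemLCtx : Layer → GCtx → LCtx → Prop
  | nil {i : Layer} {Ψ : GCtx} : WfG Ψ → SemLCtx i Ψ .nil
  | var {i : Layer} {Ψ : GCtx} {g : ℕ} : WfG Ψ → HasG Ψ g .ctx → SemLCtx i Ψ (.var g)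
  | snoc {i : Layer} {Ψ : GCtx} {Δ : LCtx} {T : Ty} :
      SemLCtx i Ψ Δ → SemTy i Ψ T → SemLCtx i Ψ (.snoc Δ T)

mutual
  /-- Reducibility at type `Nat` with respect to relations `R` (`≃`) and `N` (`∼`). -/
  inductive RedNat (R N : TmRel) (Ψ : GCtx) (Γ : LCtx) : Tm → Tm → Prop
    | mk {t t' w w' : Tm} :
        Whnf Ψ Γ t w .nat → Whnf Ψ Γ t' w' .nat → R Ψ Γ w w' .nat →
        RedNatNf R N Ψ Γ w w' → RedNat R N Ψ Γ t t'
  inductive RedNatNf (R N : TmRel) (Ψ : GCtx) (Γ : LCtx) : Tm → Tm → Prop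
    | zero : RedNatNf R N Ψ Γ .zero .zero
    | succ {t t' : Tm} : RedNat R N Ψ Γ t t' → RedNatNf R N Ψ Γ (.succ t) (.succ t')
    | ne {v v' : Tm} : N Ψ Γ v v' .nat → RedNatNf R N Ψ Γ v v'
end

/-- The extension of a reducibility predicate for terms to local substitutions, by recursion on
the local context. -/
def RedLSub (R : TmRel) (Ψ : GCtx) (Γ : LCtx) : LSub → LSub → LCtx → Prop
  | δ, δ', .nil =>
      WfL .one Ψ Γ ∧ δ = .emp Γ.base Γ.len ∧ δ' = .emp Γ.base Γ.len
  | δ, δ', .var g =>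
      WfL .one Ψ Γ ∧ Γ.base = some g ∧ δ = .wk g Γ.len ∧ δ' = .wk g Γ.len
  | δ, δ', .snoc Δ T =>
      ∃ δ₁ δ₁' t t', δ = .snoc δ₁ t ∧ δ' = .snoc δ₁' t' ∧
        RedLSub R Ψ Γ δ₁ δ₁' Δ ∧ R Ψ Γ t t' T

/-- Reducibility of weak head normal forms at type `□ (Δ ⊢ T)`, where `R₀` is the reducibility
predicate at layer `0` and `N` is `∼`. -/
inductive RedBoxNf (R₀ N : TmRel) (Ψ : GCtx) (Γ : LCtx) (Δ : LCtx) (T : Ty) : Tm → Tm → Prop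
  | box {t : Tm} :
      TmTy .zero Ψ Δ t T →
      (∀ Δ' δ δ', RedLSub R₀ Ψ Δ' δ δ' Δ → R₀ Ψ Δ' (t.lsub δ) (t.lsub δ') T) →
      RedBoxNf R₀ N Ψ Γ Δ T (.box t) (.box t)
  | ne {v v' : Tm} : N Ψ Γ v v' (.box Δ T) → RedBoxNf R₀ N Ψ Γ Δ T v v'

/-- Size of a type, not counting local contexts; a measure for the recursion below. -/
def Ty.size : Ty → ℕ
  | .nat => 1
  | .arr S T => S.size + T.size + 1
  | .box _ T => T.size + 1
  | .pi T => T.size + 1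

theorem Ty.size_gwk : ∀ (T : Ty) (γ : Wk), (T.gwk γ).size = T.size
  | .nat, _ => rfl
  | .arr S T, γ => by simp [Ty.gwk, Ty.size, Ty.size_gwk S γ, Ty.size_gwk T γ]
  | .box _ T, γ => by simp [Ty.gwk, Ty.size, Ty.size_gwk T γ]
  | .pi T, γ => by simp [Ty.gwk, Ty.size, Ty.size_gwk T (.q γ)]

theorem Ty.size_gsub : ∀ (T : Ty) (σ : GSub), (T.gsub σ).size = T.size
  | .nat, _ => rfl
  | .arr S T, σ => by simp [Ty.gsub, Ty.size, Ty.size_gsub S σ, Ty.size_gsub T σ]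
  | .box _ T, σ => by simp [Ty.gsub, Ty.size, Ty.size_gsub T σ]
  | .pi T, σ => by simp [Ty.gsub, Ty.size, Ty.size_gsub T (GSub.qCtx σ)]

/-- The layer as a number. -/
def Layer.num : Layer → ℕ
  | .zero => 0
  | .one => 1

/-- The clauses of the reducibility predicate for terms, by recursion on the layer and on the type
(the types `□ (Δ ⊢ T)` and `(g : Ctx) ⇒ T` do not exist at layer `0`). -/
def RedTm (E : (i : Layer) → GenericEq i) : Layer → Ty → GCtx → LCtx → Tm → Tm → Prop
  | i, .nat, Ψ, Γ, t, t' => RedNat (E i).tm (E i).ne Ψ Γ t t'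
  | i, .arr S T, Ψ, Γ, t, t' =>
      ∃ w w', Whnf Ψ Γ t w (.arr S T) ∧ Whnf Ψ Γ t' w' (.arr S T) ∧
        (E i).tm Ψ Γ w w' (.arr S T) ∧
        ∀ γ τ Φ Δ, DWk γ τ Φ Δ Ψ Γ → ∀ s s', RedTm E i (S.gwk γ) Φ Δ s s' →
          RedTm E i (T.gwk γ) Φ Δ (.app (w.dwk γ τ) s) (.app (w'.dwk γ τ) s')
  | .one, .box Δ T, Ψ, Γ, t, t' =>
      ∃ w w', Whnf Ψ Γ t w (.box Δ T) ∧ Whnf Ψ Γ t' w' (.box Δ T) ∧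
        (E .one).tm Ψ Γ w w' (.box Δ T) ∧
        RedBoxNf (fun Φ Δ' s s' S => RedTm E .zero S Φ Δ' s s') (E .one).ne Ψ Γ Δ T w w'
  | .one, .pi T, Ψ, Γ, t, t' =>
      ∃ w w', Whnf Ψ Γ t w (.pi T) ∧ Whnf Ψ Γ t' w' (.pi T) ∧
        (E .one).tm Ψ Γ w w' (.pi T) ∧
        ∀ γ τ Φ Δ, DWk γ τ Φ Δ Ψ Γ → ∀ Δ', WfL .zero Φ Δ' →
          RedTm E .one ((T.gwk (.q γ)).gsub (.ctx Δ' :: GSub.idOf Φ)) Φ Δ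
            (.mapp (w.dwk γ τ) Δ') (.mapp (w'.dwk γ τ) Δ')
  | .zero, .box _ _, _, _, _, _ => False
  | .zero, .pi _, _, _, _, _ => False
termination_by i T => (i.num, T.size)
decreasing_by
  · exact Prod.Lex.right _ (by simp only [Ty.size_gwk, Ty.size]; omega)
  · exact Prod.Lex.right _ (by simp only [Ty.size_gwk, Ty.size]; omega)
  · exact Prod.Lex.left _ _ (by decide)
  · exact Prod.Lex.right _ (by simp only [Ty.size_gwk, Ty.size_gsub, Ty.size]; omega)

/-- `Ψ; Γ ⊨ᵢ t ≈ t' : T`: the type is semantically well-formed and the terms are related by the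
reducibility predicate. -/
def SemTmEq (E : (i : Layer) → GenericEq i) (i : Layer) (Ψ : GCtx) (Γ : LCtx) (t t' : Tm)
    (T : Ty) : Prop :=
  SemTy i Ψ T ∧ RedTm E i T Ψ Γ t t'

/-- `Ψ; Γ ⊨ᵢ δ ≈ δ' : Δ`. -/
def SemLSubEq (E : (i : Layer) → GenericEq i) (i : Layer) (Ψ : GCtx) (Γ : LCtx) (δ δ' : LSub)
    (Δ : LCtx) : Prop :=
  SemLCtx i Ψ Δ ∧ RedLSub (fun Φ Γ' t t' T => RedTm E i T Φ Γ' t t') Ψ Γ δ δ' Δ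

/-! ### Validity -/

/-- Valid global substitutions, `Φ ⊨ᵛ σ : Ψ`. -/
def ValidGSub (E : (i : Layer) → GenericEq i) (Φ : GCtx) : GSub → GCtx → Prop
  | σ, [] => WfG Φ ∧ σ = []
  | σ, .ctx :: Ψ =>
      ∃ σ₁ Γ, σ = .ctx Γ :: σ₁ ∧ WfL .zero Φ Γ ∧ ValidGSub E Φ σ₁ Ψ
  | σ, .code Γ T :: Ψ =>
      ∃ σ₁ t, σ = .tm t :: σ₁ ∧ ValidGSub E Φ σ₁ Ψ ∧
        TmTy .zero Φ (Γ.gsub σ₁) t (T.gsub σ₁) ∧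
        ∀ Δ δ δ', SemLSubEq E .zero Φ Δ δ δ' (Γ.gsub σ₁) →
          SemTmEq E .zero Φ Δ (t.lsub δ) (t.lsub δ') (T.gsub σ₁)

/-- Valid types, `Ψ ⊨ᵛᵢ T`. -/
def ValidTy (E : (i : Layer) → GenericEq i) (i : Layer) (Ψ : GCtx) (T : Ty) : Prop :=
  SemTy i Ψ T ∧ ∀ Φ σ, ValidGSub E Φ σ Ψ → SemTy i Φ (T.gsub σ)

/-- Valid local contexts, `Ψ ⊨ᵛᵢ Γ`, pointwise. -/
inductive ValidLCtx (E : (i : Layer) → GenericEq i) : Layer → GCtx → LCtx → Prop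
  | nil {i : Layer} {Ψ : GCtx} : WfG Ψ → ValidLCtx E i Ψ .nil
  | var {i : Layer} {Ψ : GCtx} {g : ℕ} : WfG Ψ → HasG Ψ g .ctx → ValidLCtx E i Ψ (.var g)
  | snoc {i : Layer} {Ψ : GCtx} {Γ : LCtx} {T : Ty} :
      ValidLCtx E i Ψ Γ → ValidTy E i Ψ T → ValidLCtx E i Ψ (.snoc Γ T)

/-- Valid global contexts, `⊨ᵛ Ψ`. -/
inductive ValidGCtx (E : (i : Layer) → GenericEq i) : GCtx → Prop
  | nil : ValidGCtx E []
  | ctx {Ψ : GCtx} : ValidGCtx E Ψ → ValidGCtx E (.ctx :: Ψ)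
  | code {Ψ : GCtx} {Γ : LCtx} {T : Ty} :
      ValidGCtx E Ψ → ValidLCtx E .zero Ψ Γ → ValidTy E .zero Ψ T →
      ValidGCtx E (.code Γ T :: Ψ)

/-- Valid equivalence of terms, `Ψ; Γ ⊨ᵛᵢ t ≈ t' : T`. -/
def ValidTmEq (E : (i : Layer) → GenericEq i) (i : Layer) (Ψ : GCtx) (Γ : LCtx) (t t' : Tm)
    (T : Ty) : Prop :=
  ∀ Φ σ, ValidGSub E Φ σ Ψ → ∀ Δ δ δ', SemLSubEq E i Φ Δ δ δ' (Γ.gsub σ) →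
    SemTmEq E i Φ Δ ((t.gsub σ).lsub δ) ((t'.gsub σ).lsub δ') (T.gsub σ)

/-- Valid equivalence of local substitutions, `Ψ; Γ ⊨ᵛᵢ δ ≈ δ' : Δ`. -/
def ValidLSubEq (E : (i : Layer) → GenericEq i) (i : Layer) (Ψ : GCtx) (Γ : LCtx) (δ δ' : LSub)
    (Δ : LCtx) : Prop :=
  ∀ Φ σ, ValidGSub E Φ σ Ψ → ∀ Δ' ε ε', SemLSubEq E i Φ Δ' ε ε' (Γ.gsub σ) →
    SemLSubEq E i Φ Δ' ((δ.gsub σ).comp ε) ((δ'.gsub σ).comp ε') (Δ.gsub σ)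

end CtxModal

namespace CtxModal

/-! ### Algebra of weakenings -/

attribute [simp] Wk.act Wk.count Wk.pn Ty.gwk LCtx.gwk Tm.gwk LSub.gwk Tm.lwk LSub.lwk
  LCtx.len LCtx.base LSub.hat LSub.chk LSub.lookup Tm.lsub LSub.comp LSub.wkOf
  Ty.gsub LCtx.gsub Tm.gsub LSub.gsub GSub.wkOf

-- The proof is a Kripke logical-relations argument. Reducibility is a partial equivalence relation
-- (`RedTm.symm`, `RedTm.trans`), contains related neutral terms (`SemTy.redTm_of_ne`), is contained
-- in `≃` (`RedTm.tm`), and is closed under weak head expansion (`RedTm.of_steps`). By induction on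
-- derivations every derivable judgement holds under all reducible instances. The β rules hold by
-- closure under expansion, the η rules because functions and meta-functions are compared by
-- applying them. Completeness is the instance at the identity substitutions, which are reducible
-- because variables are neutral.
--
-- For types there is little to prove. A type depends on its global context only through context
-- variables, and these occur only inside local contexts, which `Ty.size` does not count. Hence an
-- instance of `T` is smaller than `(g : Ctx) ⇒ T`, an induction on size gives `WfT.semTy`, and
-- validity of types reduces to the stability of syntactic well-formedness under global substitution
-- (`WfT.gsub`).
--
-- The substance lies in code. First, layer `0` has no computation rules, so its equivalence is
-- syntactic identity (`TmEq.eq_of_zero`); this reconciles the congruence rule for `box` with the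
-- clause that asks for `w = w' = box s`. Secondly, that clause describes how `s` acts on
-- substitutions over the present global context and at layer `0` only. It is not visibly stable
-- under global weakening, and it does not say how `s` behaves when `letbox` runs it at layer `1`.
-- Both gaps are closed by `CodeRed`: every well-typed layer-`0` term sends related local
-- substitutions to related terms, at either semantic layer. After that, the semantic conditions on
-- code follow from typing. There is no circularity, since the proof goes in stages: monotonicity at
-- layer `0` involves no boxes; it gives `CodeRed` at layer `0`; this gives monotonicity at layer
-- `1`, and then `CodeRed` at layer `1` (`redMono_of_codeRed`, `RedMono.codeRed`).
--
-- To extract `CodeRed` from validity one must choose a global substitution, and any term entry of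
-- it would presuppose the claim. Therefore validity is proved in the form `ValidAt`, for
-- substitutions that may also have entries `v^id/u`, which leave `u^δ` neutral. The identity
-- `GSub.bvId` has no term entries at all. The same entries serve for the body of a `letbox` whose
-- scrutinee is neutral.
--
-- The rest is substitution calculus. The laws of weakening and the associativity of local
-- substitution hold on raw syntax. The exchange of local and global substitution (`TmTy.lsub_gsub`)
-- and the composition of global substitutions on terms (`TmTy.gsub_gsub`) need typing, because
-- `wk_g^m[σ]` unfolds into a list of variables and only typing ties `m` to the length of the local
-- context.

@[simp] theorem GBind.gwk_ctx (γ : Wk) : GBind.ctx.gwk γ = .ctx := rfl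

@[simp] theorem GBind.gwk_code (Γ : LCtx) (T : Ty) (γ : Wk) :
    (GBind.code Γ T).gwk γ = .code (Γ.gwk γ) (T.gwk γ) := rfl

@[simp] theorem GEntry.gwk_tm (t : Tm) (γ : Wk) : (GEntry.tm t).gwk γ = .tm (t.gwk γ) := rfl

@[simp] theorem GEntry.gwk_ctx (Γ : LCtx) (γ : Wk) :
    (GEntry.ctx Γ).gwk γ = .ctx (Γ.gwk γ) := rfl

@[simp] theorem GEntry.gwk_bv (u : ℕ) (γ : Wk) : (GEntry.bv u).gwk γ = .bv (γ.act u) := rfl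

/-- Composition of weakenings: `γ` first, then `γ'`. -/
def Wk.comp : Wk → Wk → Wk
  | γ, .id => γ
  | γ, .p γ' => .p (γ.comp γ')
  | .id, .q γ' => .q γ'
  | .p γ, .q γ' => .p (γ.comp γ')
  | .q γ, .q γ' => .q (γ.comp γ')

theorem Wk.act_comp : ∀ (γ γ' : Wk) (n : ℕ), (γ.comp γ').act n = γ'.act (γ.act n)
  | γ, .id, n => by simp [Wk.comp]
  | γ, .p γ', n => by simp [Wk.comp, Wk.act_comp γ γ' n]
  | .id, .q γ', n => by simp [Wk.comp]
  | .p γ, .q γ', n => by simp [Wk.comp, Wk.act_comp γ γ' n]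
  | .q γ, .q γ', 0 => by simp [Wk.comp]
  | .q γ, .q γ', n + 1 => by simp [Wk.comp, Wk.act_comp γ γ' n]

theorem Wk.count_comp : ∀ γ γ' : Wk, (γ.comp γ').count = γ.count + γ'.count
  | γ, .id => by simp [Wk.comp]
  | γ, .p γ' => by simp [Wk.comp, Wk.count_comp γ γ', Nat.add_assoc]
  | .id, .q γ' => by simp [Wk.comp]
  | .p γ, .q γ' => by simp [Wk.comp, Wk.count_comp γ γ']; omega
  | .q γ, .q γ' => by simp [Wk.comp, Wk.count_comp γ γ']

theorem Wk.act_q_congr {γ γ' : Wk} (h : ∀ n, γ.act n = γ'.act n) (n : ℕ) :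
    (Wk.q γ).act n = (Wk.q γ').act n := by
  cases n <;> simp [h]

theorem Wk.act_q_id (n : ℕ) : (Wk.q .id).act n = n := by
  cases n <;> simp

theorem Wk.act_pn : ∀ m n : ℕ, (Wk.pn m).act n = n + m
  | 0, n => by simp
  | m + 1, n => by simp [Wk.act_pn m n, Nat.add_assoc]

theorem Wk.count_pn : ∀ m : ℕ, (Wk.pn m).count = m
  | 0 => by simp
  | m + 1 => by simp [Wk.count_pn m]

mutual
  -- Different weakenings can act alike, for example `q id` and `id`, so equations between weakened
  -- objects are derived from equality of actions.
  theorem Ty.gwk_congr : ∀ (T : Ty) {γ γ' : Wk}, (∀ n, γ.act n = γ'.act n) → T.gwk γ = T.gwk γ'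
    | .nat, _, _, _ => by simp
    | .arr S T, _, _, h => by simp [S.gwk_congr h, T.gwk_congr h]
    | .box Γ T, _, _, h => by simp [Γ.gwk_congr h, T.gwk_congr h]
    | .pi T, _, _, h => by simp [T.gwk_congr (Wk.act_q_congr h)]
  theorem LCtx.gwk_congr : ∀ (Γ : LCtx) {γ γ' : Wk}, (∀ n, γ.act n = γ'.act n) →
      Γ.gwk γ = Γ.gwk γ'
    | .nil, _, _, _ => by simp
    | .var g, _, _, h => by simp [h]
    | .snoc Γ T, _, _, h => by simp [Γ.gwk_congr h, T.gwk_congr h]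
end

mutual
  theorem Ty.gwk_comp : ∀ (T : Ty) (γ γ' : Wk), (T.gwk γ).gwk γ' = T.gwk (γ.comp γ')
    | .nat, _, _ => by simp
    | .arr S T, γ, γ' => by simp [S.gwk_comp γ γ', T.gwk_comp γ γ']
    | .box Γ T, γ, γ' => by simp [Γ.gwk_comp γ γ', T.gwk_comp γ γ']
    | .pi T, γ, γ' => by simp [T.gwk_comp (.q γ) (.q γ'), Wk.comp]
  theorem LCtx.gwk_comp : ∀ (Γ : LCtx) (γ γ' : Wk), (Γ.gwk γ).gwk γ' = Γ.gwk (γ.comp γ')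
    | .nil, _, _ => by simp
    | .var g, γ, γ' => by simp [Wk.act_comp]
    | .snoc Γ T, γ, γ' => by simp [Γ.gwk_comp γ γ', T.gwk_comp γ γ']
end

mutual
  @[simp] theorem Ty.gwk_id : ∀ T : Ty, T.gwk .id = T
    | .nat => by simp
    | .arr S T => by simp [S.gwk_id, T.gwk_id]
    | .box Γ T => by simp [Γ.gwk_id, T.gwk_id]
    | .pi T => by
        simp only [Ty.gwk, Ty.pi.injEq]
        rw [T.gwk_congr (γ' := .id) (fun n => by simp [Wk.act_q_id]), T.gwk_id]
  @[simp] theorem LCtx.gwk_id : ∀ Γ : LCtx, Γ.gwk .id = Γ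
    | .nil => by simp
    | .var g => by simp
    | .snoc Γ T => by simp [Γ.gwk_id, T.gwk_id]
end

/-- This commutation of a weakening with the shift past a new binding is transported to every
syntactic class by the `_p_q` lemmas and used at every binder. -/
theorem Wk.act_p_q (γ : Wk) (n : ℕ) :
    (Wk.comp (.p .id) (.q γ)).act n = (Wk.comp γ (.p .id)).act n := by
  simp [Wk.act_comp]

theorem Ty.gwk_p_q (T : Ty) (γ : Wk) :
    (T.gwk (.p .id)).gwk (.q γ) = (T.gwk γ).gwk (.p .id) := by
  rw [T.gwk_comp, T.gwk_comp]; exact T.gwk_congr (Wk.act_p_q γ)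

theorem LCtx.gwk_p_q (Γ : LCtx) (γ : Wk) :
    (Γ.gwk (.p .id)).gwk (.q γ) = (Γ.gwk γ).gwk (.p .id) := by
  rw [Γ.gwk_comp, Γ.gwk_comp]; exact Γ.gwk_congr (Wk.act_p_q γ)

@[simp] theorem GBind.gwk_id (B : GBind) : B.gwk .id = B := by
  cases B <;> simp

theorem GBind.gwk_comp (B : GBind) (γ γ' : Wk) : (B.gwk γ).gwk γ' = B.gwk (γ.comp γ') := by
  cases B <;> simp [Ty.gwk_comp, LCtx.gwk_comp]

theorem GBind.gwk_p_q (B : GBind) (γ : Wk) :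
    (B.gwk (.p .id)).gwk (.q γ) = (B.gwk γ).gwk (.p .id) := by
  cases B <;> simp [Ty.gwk_p_q, LCtx.gwk_p_q]

@[simp] theorem LCtx.len_gwk : ∀ (Γ : LCtx) (γ : Wk), (Γ.gwk γ).len = Γ.len
  | .nil, _ => rfl
  | .var _, _ => rfl
  | .snoc Γ _, γ => by simp [Γ.len_gwk γ]

@[simp] theorem LCtx.base_gwk : ∀ (Γ : LCtx) (γ : Wk), (Γ.gwk γ).base = Γ.base.map γ.act
  | .nil, _ => rfl
  | .var _, _ => rfl
  | .snoc Γ _, γ => by simp [Γ.base_gwk γ]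

mutual
  theorem Tm.gwk_congr : ∀ (t : Tm) {γ γ' : Wk}, (∀ n, γ.act n = γ'.act n) → t.gwk γ = t.gwk γ'
    | .var x, _, _, _ => by simp
    | .gvar u δ, _, _, h => by simp [δ.gwk_congr h, h]
    | .zero, _, _, _ => by simp
    | .succ t, _, _, h => by simp [t.gwk_congr h]
    | .box t, _, _, h => by simp [t.gwk_congr h]
    | .letbox s t, _, _, h => by simp [s.gwk_congr h, t.gwk_congr (Wk.act_q_congr h)]
    | .lam t, _, _, h => by simp [t.gwk_congr h]
    | .app t s, _, _, h => by simp [t.gwk_congr h, s.gwk_congr h]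
    | .mlam t, _, _, h => by simp [t.gwk_congr (Wk.act_q_congr h)]
    | .mapp t Γ, _, _, h => by simp [t.gwk_congr h, Γ.gwk_congr h]
  theorem LSub.gwk_congr : ∀ (δ : LSub) {γ γ' : Wk}, (∀ n, γ.act n = γ'.act n) →
      δ.gwk γ = δ.gwk γ'
    | .emp g m, _, _, h => by simp [funext h]
    | .wk g m, _, _, h => by simp [h]
    | .snoc δ t, _, _, h => by simp [δ.gwk_congr h, t.gwk_congr h]
end

mutual
  theorem Tm.gwk_comp : ∀ (t : Tm) (γ γ' : Wk), (t.gwk γ).gwk γ' = t.gwk (γ.comp γ')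
    | .var x, _, _ => by simp
    | .gvar u δ, γ, γ' => by simp [δ.gwk_comp γ γ', Wk.act_comp]
    | .zero, _, _ => by simp
    | .succ t, γ, γ' => by simp [t.gwk_comp γ γ']
    | .box t, γ, γ' => by simp [t.gwk_comp γ γ']
    | .letbox s t, γ, γ' => by simp [s.gwk_comp γ γ', t.gwk_comp (.q γ) (.q γ'), Wk.comp]
    | .lam t, γ, γ' => by simp [t.gwk_comp γ γ']
    | .app t s, γ, γ' => by simp [t.gwk_comp γ γ', s.gwk_comp γ γ']
    | .mlam t, γ, γ' => by simp [t.gwk_comp (.q γ) (.q γ'), Wk.comp]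
    | .mapp t Γ, γ, γ' => by simp [t.gwk_comp γ γ', Γ.gwk_comp γ γ']
  theorem LSub.gwk_comp : ∀ (δ : LSub) (γ γ' : Wk), (δ.gwk γ).gwk γ' = δ.gwk (γ.comp γ')
    | .emp g m, γ, γ' => by cases g <;> simp [Wk.act_comp]
    | .wk g m, γ, γ' => by simp [Wk.act_comp]
    | .snoc δ t, γ, γ' => by simp [δ.gwk_comp γ γ', t.gwk_comp γ γ']
end

mutual
  @[simp] theorem Tm.gwk_id : ∀ t : Tm, t.gwk .id = t
    | .var x => by simp
    | .gvar u δ => by simp [δ.gwk_id]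
    | .zero => by simp
    | .succ t => by simp [t.gwk_id]
    | .box t => by simp [t.gwk_id]
    | .letbox s t => by
        simp only [Tm.gwk, s.gwk_id]
        rw [t.gwk_congr (γ' := .id) (fun n => by simp [Wk.act_q_id]), t.gwk_id]
    | .lam t => by simp [t.gwk_id]
    | .app t s => by simp [t.gwk_id, s.gwk_id]
    | .mlam t => by
        simp only [Tm.gwk]
        rw [t.gwk_congr (γ' := .id) (fun n => by simp [Wk.act_q_id]), t.gwk_id]
    | .mapp t Γ => by simp [t.gwk_id]
  @[simp] theorem LSub.gwk_id : ∀ δ : LSub, δ.gwk .id = δ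
    | .emp g m => by cases g <;> simp
    | .wk g m => by simp
    | .snoc δ t => by simp [δ.gwk_id, t.gwk_id]
end

theorem Tm.gwk_p_q (t : Tm) (γ : Wk) :
    (t.gwk (.p .id)).gwk (.q γ) = (t.gwk γ).gwk (.p .id) := by
  rw [t.gwk_comp, t.gwk_comp]; exact t.gwk_congr (Wk.act_p_q γ)

theorem LSub.gwk_p_q (δ : LSub) (γ : Wk) :
    (δ.gwk (.p .id)).gwk (.q γ) = (δ.gwk γ).gwk (.p .id) := by
  rw [δ.gwk_comp, δ.gwk_comp]; exact δ.gwk_congr (Wk.act_p_q γ)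

mutual
  -- The count enters beside the action because it is what a local weakening adds to the number at
  -- the base of a local substitution.
  theorem Tm.lwk_congr : ∀ (t : Tm) {τ τ' : Wk}, (∀ n, τ.act n = τ'.act n) →
      τ.count = τ'.count → t.lwk τ = t.lwk τ'
    | .var x, _, _, h, _ => by simp [h]
    | .gvar u δ, _, _, h, hc => by simp [δ.lwk_congr h hc]
    | .zero, _, _, _, _ => by simp
    | .succ t, _, _, h, hc => by simp [t.lwk_congr h hc]
    | .box t, _, _, h, hc => by simp
    | .letbox s t, _, _, h, hc => by simp [s.lwk_congr h hc, t.lwk_congr h hc]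
    | .lam t, τ, τ', h, hc => by
        simp [t.lwk_congr (Wk.act_q_congr h) (by simpa using hc : (Wk.q τ).count = (Wk.q τ').count)]
    | .app t s, _, _, h, hc => by simp [t.lwk_congr h hc, s.lwk_congr h hc]
    | .mlam t, _, _, h, hc => by simp [t.lwk_congr h hc]
    | .mapp t Γ, _, _, h, hc => by simp [t.lwk_congr h hc]
  theorem LSub.lwk_congr : ∀ (δ : LSub) {τ τ' : Wk}, (∀ n, τ.act n = τ'.act n) →
      τ.count = τ'.count → δ.lwk τ = δ.lwk τ'
    | .emp g m, _, _, h, hc => by simp [hc]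
    | .wk g m, _, _, h, hc => by simp [hc]
    | .snoc δ t, _, _, h, hc => by simp [δ.lwk_congr h hc, t.lwk_congr h hc]
end

mutual
  theorem Tm.lwk_comp : ∀ (t : Tm) (τ τ' : Wk), (t.lwk τ).lwk τ' = t.lwk (τ.comp τ')
    | .var x, _, _ => by simp [Wk.act_comp]
    | .gvar u δ, τ, τ' => by simp [δ.lwk_comp τ τ']
    | .zero, _, _ => by simp
    | .succ t, τ, τ' => by simp [t.lwk_comp τ τ']
    | .box t, τ, τ' => by simp
    | .letbox s t, τ, τ' => by simp [s.lwk_comp τ τ', t.lwk_comp τ τ']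
    | .lam t, τ, τ' => by simp [t.lwk_comp (.q τ) (.q τ'), Wk.comp]
    | .app t s, τ, τ' => by simp [t.lwk_comp τ τ', s.lwk_comp τ τ']
    | .mlam t, τ, τ' => by simp [t.lwk_comp τ τ']
    | .mapp t Γ, τ, τ' => by simp [t.lwk_comp τ τ']
  theorem LSub.lwk_comp : ∀ (δ : LSub) (τ τ' : Wk), (δ.lwk τ).lwk τ' = δ.lwk (τ.comp τ')
    | .emp g m, τ, τ' => by simp [Wk.count_comp, Nat.add_assoc]
    | .wk g m, τ, τ' => by simp [Wk.count_comp, Nat.add_assoc]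
    | .snoc δ t, τ, τ' => by simp [δ.lwk_comp τ τ', t.lwk_comp τ τ']
end

mutual
  @[simp] theorem Tm.lwk_id : ∀ t : Tm, t.lwk .id = t
    | .var x => by simp
    | .gvar u δ => by simp [δ.lwk_id]
    | .zero => by simp
    | .succ t => by simp [t.lwk_id]
    | .box t => by simp
    | .letbox s t => by simp [s.lwk_id, t.lwk_id]
    | .lam t => by
        simp only [Tm.lwk]
        rw [t.lwk_congr (τ := .q .id) (τ' := .id) (fun n => by simp [Wk.act_q_id]) rfl, t.lwk_id]
    | .app t s => by simp [t.lwk_id, s.lwk_id]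
    | .mlam t => by simp [t.lwk_id]
    | .mapp t Γ => by simp [t.lwk_id]
  @[simp] theorem LSub.lwk_id : ∀ δ : LSub, δ.lwk .id = δ
    | .emp g m => by simp
    | .wk g m => by simp
    | .snoc δ t => by simp [δ.lwk_id, t.lwk_id]
end

theorem Wk.count_p_q (τ : Wk) :
    (Wk.comp (.p .id) (.q τ)).count = (Wk.comp τ (.p .id)).count := by
  simp [Wk.count_comp, Nat.add_comm]

theorem LSub.lwk_p_q (δ : LSub) (τ : Wk) :
    (δ.lwk (.p .id)).lwk (.q τ) = (δ.lwk τ).lwk (.p .id) := by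
  rw [δ.lwk_comp, δ.lwk_comp]; exact δ.lwk_congr (Wk.act_p_q τ) (Wk.count_p_q τ)

mutual
  theorem Tm.gwk_lwk : ∀ (t : Tm) (γ τ : Wk), (t.gwk γ).lwk τ = (t.lwk τ).gwk γ
    | .var x, _, _ => by simp
    | .gvar u δ, γ, τ => by simp [δ.gwk_lwk γ τ]
    | .zero, _, _ => by simp
    | .succ t, γ, τ => by simp [t.gwk_lwk γ τ]
    | .box t, γ, τ => by simp
    | .letbox s t, γ, τ => by simp [s.gwk_lwk γ τ, t.gwk_lwk (.q γ) τ]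
    | .lam t, γ, τ => by simp [t.gwk_lwk γ (.q τ)]
    | .app t s, γ, τ => by simp [t.gwk_lwk γ τ, s.gwk_lwk γ τ]
    | .mlam t, γ, τ => by simp [t.gwk_lwk (.q γ) τ]
    | .mapp t Γ, γ, τ => by simp [t.gwk_lwk γ τ]
  theorem LSub.gwk_lwk : ∀ (δ : LSub) (γ τ : Wk), (δ.gwk γ).lwk τ = (δ.lwk τ).gwk γ
    | .emp g m, γ, τ => by simp
    | .wk g m, γ, τ => by simp
    | .snoc δ t, γ, τ => by simp [δ.gwk_lwk γ τ, t.gwk_lwk γ τ]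
end

theorem Tm.dwk_dwk (t : Tm) (γ τ γ' τ' : Wk) :
    (t.dwk γ τ).dwk γ' τ' = t.dwk (γ.comp γ') (τ.comp τ') := by
  simp only [Tm.dwk]
  rw [← Tm.gwk_lwk, Tm.lwk_comp, Tm.gwk_comp]

@[simp] theorem Tm.dwk_id_id (t : Tm) : t.dwk .id .id = t := by simp [Tm.dwk]

/-! ### Algebra of local substitutions -/

@[simp] theorem LSub.hat_gwk : ∀ (δ : LSub) (γ : Wk), (δ.gwk γ).hat = δ.hat
  | .emp _ _, _ => rfl
  | .wk _ _, _ => rfl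
  | .snoc δ _, γ => by simp [δ.hat_gwk γ]

@[simp] theorem LSub.chk_gwk : ∀ (δ : LSub) (γ : Wk), (δ.gwk γ).chk = δ.chk.map γ.act
  | .emp _ _, _ => rfl
  | .wk _ _, _ => rfl
  | .snoc δ _, γ => by simp [δ.chk_gwk γ]

@[simp] theorem LSub.hat_lwk : ∀ (δ : LSub) (τ : Wk), (δ.lwk τ).hat = δ.hat + τ.count
  | .emp _ _, _ => rfl
  | .wk _ _, _ => rfl
  | .snoc δ _, τ => by simp [δ.hat_lwk τ]

@[simp] theorem LSub.chk_lwk : ∀ (δ : LSub) (τ : Wk), (δ.lwk τ).chk = δ.chk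
  | .emp _ _, _ => rfl
  | .wk _ _, _ => rfl
  | .snoc δ _, τ => by simp [δ.chk_lwk τ]

@[simp] theorem LSub.hat_comp : ∀ δ ε : LSub, (δ.comp ε).hat = ε.hat
  | .emp none _, _ => by simp
  | .emp (some _) _, _ => by simp
  | .wk _ _, _ => by simp
  | .snoc δ _, ε => by simp [δ.hat_comp ε]

-- A base `·^m` takes over the context variable of `ε`, while a base that already names a variable
-- keeps it; this is the behaviour of `Option.or`, and its associativity underlies
-- `LSub.comp_assoc`.
@[simp] theorem LSub.chk_comp : ∀ δ ε : LSub, (δ.comp ε).chk = δ.chk.or ε.chk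
  | .emp none _, _ => by simp
  | .emp (some _) _, _ => by simp
  | .wk _ _, _ => by simp
  | .snoc δ _, ε => by simp [δ.chk_comp ε]

/-- Off the domain `lookup` returns the closed term `zero`, which all operations fix; this is why
the lookup laws need no typing. -/
theorem LSub.lookup_gwk : ∀ (δ : LSub) (γ : Wk) (x : ℕ),
    (δ.gwk γ).lookup x = (δ.lookup x).gwk γ
  | .emp _ _, _, _ => by simp
  | .wk _ _, _, _ => by simp
  | .snoc δ t, γ, 0 => by simp
  | .snoc δ t, γ, x + 1 => by simp [δ.lookup_gwk γ x]

theorem LSub.lookup_lwk : ∀ (δ : LSub) (τ : Wk) (x : ℕ),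
    (δ.lwk τ).lookup x = (δ.lookup x).lwk τ
  | .emp _ _, _, _ => by simp
  | .wk _ _, _, _ => by simp
  | .snoc δ t, τ, 0 => by simp
  | .snoc δ t, τ, x + 1 => by simp [δ.lookup_lwk τ x]

theorem LSub.lookup_comp : ∀ (δ ε : LSub) (x : ℕ),
    (δ.comp ε).lookup x = (δ.lookup x).lsub ε
  | .emp none _, _, _ => by simp
  | .emp (some _) _, _, _ => by simp
  | .wk _ _, _, _ => by simp
  | .snoc δ t, ε, 0 => by simp
  | .snoc δ t, ε, x + 1 => by simp [δ.lookup_comp ε x]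

mutual
  theorem Tm.lsub_gwk : ∀ (t : Tm) (δ : LSub) (γ : Wk),
      (t.lsub δ).gwk γ = (t.gwk γ).lsub (δ.gwk γ)
    | .var x, δ, γ => by simp [δ.lookup_gwk γ x]
    | .gvar u δ', δ, γ => by simp [δ'.comp_gwk δ γ]
    | .zero, _, _ => by simp
    | .succ t, δ, γ => by simp [t.lsub_gwk δ γ]
    | .box t, δ, γ => by simp
    | .letbox s t, δ, γ => by
        simp [s.lsub_gwk δ γ, t.lsub_gwk (δ.gwk (.p .id)) (.q γ), δ.gwk_p_q γ]
    | .lam t, δ, γ => by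
        simp [t.lsub_gwk _ γ, LSub.gwk_lwk]
    | .app t s, δ, γ => by simp [t.lsub_gwk δ γ, s.lsub_gwk δ γ]
    | .mlam t, δ, γ => by simp [t.lsub_gwk (δ.gwk (.p .id)) (.q γ), δ.gwk_p_q γ]
    | .mapp t Γ, δ, γ => by simp [t.lsub_gwk δ γ]
  theorem LSub.comp_gwk : ∀ (δ' δ : LSub) (γ : Wk),
      (δ'.comp δ).gwk γ = (δ'.gwk γ).comp (δ.gwk γ)
    | .emp none m, _, _ => by simp
    | .emp (some g) m, _, _ => by simp
    | .wk g m, _, _ => by simp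
    | .snoc δ' t, δ, γ => by simp [δ'.comp_gwk δ γ, t.lsub_gwk δ γ]
end

mutual
  -- No typing is needed: composition replaces base numbers by that of `δ`, and weakening `δ`
  -- increases that number exactly as weakening the result does.
  theorem Tm.lsub_lwk : ∀ (t : Tm) (δ : LSub) (τ : Wk),
      (t.lsub δ).lwk τ = t.lsub (δ.lwk τ)
    | .var x, δ, τ => by simp [δ.lookup_lwk τ x]
    | .gvar u δ', δ, τ => by simp [δ'.comp_lwk δ τ]
    | .zero, _, _ => by simp
    | .succ t, δ, τ => by simp [t.lsub_lwk δ τ]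
    | .box t, δ, τ => by simp
    | .letbox s t, δ, τ => by
        simp [s.lsub_lwk δ τ, t.lsub_lwk (δ.gwk (.p .id)) τ, LSub.gwk_lwk]
    | .lam t, δ, τ => by
        simp [t.lsub_lwk _ (.q τ), LSub.lwk_p_q]
    | .app t s, δ, τ => by simp [t.lsub_lwk δ τ, s.lsub_lwk δ τ]
    | .mlam t, δ, τ => by simp [t.lsub_lwk (δ.gwk (.p .id)) τ, LSub.gwk_lwk]
    | .mapp t Γ, δ, τ => by simp [t.lsub_lwk δ τ]
  theorem LSub.comp_lwk : ∀ (δ' δ : LSub) (τ : Wk),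
      (δ'.comp δ).lwk τ = δ'.comp (δ.lwk τ)
    | .emp none m, _, _ => by simp
    | .emp (some g) m, _, _ => by simp
    | .wk g m, _, _ => by simp
    | .snoc δ' t, δ, τ => by simp [δ'.comp_lwk δ τ, t.lsub_lwk δ τ]
end

/-- `ε` is the restriction of `δ` along the weakening `τ`. -/
structure LSub.Restricts (τ : Wk) (δ ε : LSub) : Prop where
  lookup : ∀ x, δ.lookup (τ.act x) = ε.lookup x
  hat : δ.hat = ε.hat
  chk : δ.chk = ε.chk

theorem LSub.Restricts.gwk {τ : Wk} {δ ε : LSub} (h : LSub.Restricts τ δ ε) (γ : Wk) :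
    LSub.Restricts τ (δ.gwk γ) (ε.gwk γ) :=
  ⟨fun x => by simp [LSub.lookup_gwk, h.lookup], by simp [h.hat], by simp [h.chk]⟩

theorem LSub.Restricts.q {τ : Wk} {δ ε : LSub} (h : LSub.Restricts τ δ ε) :
    LSub.Restricts (.q τ) (.snoc (δ.lwk (.p .id)) (.var 0)) (.snoc (ε.lwk (.p .id)) (.var 0)) :=
  ⟨fun x => by cases x <;> simp [LSub.lookup_lwk, h.lookup], by simp [h.hat], by simp [h.chk]⟩

theorem LSub.restricts_p (δ : LSub) (t : Tm) : LSub.Restricts (.p .id) (.snoc δ t) δ :=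
  ⟨fun x => by simp, rfl, rfl⟩

mutual
  -- Composition reads from `δ` only its values on variables, its base number and its base variable,
  -- which are the three fields of `Restricts`.
  theorem Tm.lwk_lsub : ∀ (t : Tm) {τ : Wk} {δ ε : LSub}, LSub.Restricts τ δ ε →
      (t.lwk τ).lsub δ = t.lsub ε
    | .var x, _, _, _, h => by simp [h.lookup]
    | .gvar u δ', _, _, _, h => by simp [δ'.lwk_comp_sub h]
    | .zero, _, _, _, _ => by simp
    | .succ t, _, _, _, h => by simp [t.lwk_lsub h]
    | .box t, _, _, _, h => by simp
    | .letbox s t, _, _, _, h => by simp [s.lwk_lsub h, t.lwk_lsub (h.gwk _)]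
    | .lam t, _, _, _, h => by simp [t.lwk_lsub h.q]
    | .app t s, _, _, _, h => by simp [t.lwk_lsub h, s.lwk_lsub h]
    | .mlam t, _, _, _, h => by simp [t.lwk_lsub (h.gwk _)]
    | .mapp t Γ, _, _, _, h => by simp [t.lwk_lsub h]
  theorem LSub.lwk_comp_sub : ∀ (δ' : LSub) {τ : Wk} {δ ε : LSub}, LSub.Restricts τ δ ε →
      (δ'.lwk τ).comp δ = δ'.comp ε
    | .emp none m, _, _, _, h => by simp [h.hat, h.chk]
    | .emp (some g) m, _, _, _, h => by simp [h.hat]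
    | .wk g m, _, _, _, h => by simp [h.hat]
    | .snoc δ' t, _, _, _, h => by simp [δ'.lwk_comp_sub h, t.lwk_lsub h]
end

theorem Tm.lwk_p_lsub (t : Tm) (δ : LSub) (s : Tm) :
    (t.lwk (.p .id)).lsub (.snoc δ s) = t.lsub δ :=
  t.lwk_lsub (LSub.restricts_p δ s)

theorem LSub.lwk_p_comp (δ' δ : LSub) (s : Tm) :
    (δ'.lwk (.p .id)).comp (.snoc δ s) = δ'.comp δ :=
  δ'.lwk_comp_sub (LSub.restricts_p δ s)

mutual
  theorem Tm.lsub_lsub : ∀ (t : Tm) (δ ε : LSub), (t.lsub δ).lsub ε = t.lsub (δ.comp ε)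
    | .var x, δ, ε => by simp [δ.lookup_comp ε x]
    | .gvar u δ', δ, ε => by simp [δ'.comp_assoc δ ε]
    | .zero, _, _ => by simp
    | .succ t, δ, ε => by simp [t.lsub_lsub δ ε]
    | .box t, δ, ε => by simp
    | .letbox s t, δ, ε => by
        simp [s.lsub_lsub δ ε, t.lsub_lsub (δ.gwk (.p .id)) _, LSub.comp_gwk]
    | .lam t, δ, ε => by
        simp [t.lsub_lsub _ _, LSub.lwk_p_comp, LSub.comp_lwk]
    | .app t s, δ, ε => by simp [t.lsub_lsub δ ε, s.lsub_lsub δ ε]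
    | .mlam t, δ, ε => by simp [t.lsub_lsub (δ.gwk (.p .id)) _, LSub.comp_gwk]
    | .mapp t Γ, δ, ε => by simp [t.lsub_lsub δ ε]
  theorem LSub.comp_assoc : ∀ δ' δ ε : LSub, (δ'.comp δ).comp ε = δ'.comp (δ.comp ε)
    | .emp none m, δ, ε => by
        simp only [LSub.comp, LSub.hat_comp, LSub.chk_comp]
        cases δ.chk <;> simp
    | .emp (some g) m, _, _ => by simp
    | .wk g m, _, _ => by simp
    | .snoc δ' t, δ, ε => by simp [δ'.comp_assoc δ ε, t.lsub_lsub δ ε]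
end

@[simp] theorem LSub.wkOf_gwk : ∀ (m : ℕ) (Γ : LCtx) (γ : Wk),
    (LSub.wkOf m Γ).gwk γ = LSub.wkOf m (Γ.gwk γ)
  | _, .nil, _ => by simp
  | _, .var _, _ => by simp
  | m, .snoc Γ T, γ => by simp [LSub.wkOf_gwk (m + 1) Γ γ]

theorem LSub.idOf_gwk (Γ : LCtx) (γ : Wk) : (LSub.idOf Γ).gwk γ = LSub.idOf (Γ.gwk γ) := by
  simp [LSub.idOf]

theorem LSub.wkOf_lwk_pn : ∀ (m n : ℕ) (Γ : LCtx),
    (LSub.wkOf m Γ).lwk (Wk.pn n) = LSub.wkOf (m + n) Γ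
  | _, _, .nil => by simp [Wk.count_pn]
  | _, _, .var _ => by simp [Wk.count_pn]
  | m, n, .snoc Γ T => by
      simp [LSub.wkOf_lwk_pn (m + 1) n Γ, Wk.act_pn, Nat.add_right_comm]

theorem LSub.idOf_lwk_pn (n : ℕ) (Γ : LCtx) :
    (LSub.idOf Γ).lwk (Wk.pn n) = LSub.wkOf n Γ := by
  simp [LSub.idOf, LSub.wkOf_lwk_pn]

theorem LSub.idOf_snoc (Γ : LCtx) (T : Ty) :
    LSub.idOf (.snoc Γ T) = .snoc ((LSub.idOf Γ).lwk (.p .id)) (.var 0) := by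
  have := LSub.idOf_lwk_pn 1 Γ
  simp only [Wk.pn] at this
  simp [LSub.idOf] at this ⊢
  exact this.symm

@[simp] theorem LSub.hat_wkOf : ∀ (m : ℕ) (Γ : LCtx), (LSub.wkOf m Γ).hat = m + Γ.len
  | _, .nil => by simp
  | _, .var _ => by simp
  | m, .snoc Γ T => by simp [LSub.hat_wkOf (m + 1) Γ]; omega

@[simp] theorem LSub.chk_wkOf : ∀ (m : ℕ) (Γ : LCtx), (LSub.wkOf m Γ).chk = Γ.base
  | _, .nil => by simp
  | _, .var _ => by simp
  | m, .snoc Γ T => by simp [LSub.chk_wkOf (m + 1) Γ]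

/-- `δ` has the shape of a local substitution with codomain `Γ`. -/
inductive LSub.Fits : LSub → LCtx → Prop
  | nil {g : Option ℕ} {m : ℕ} : LSub.Fits (.emp g m) .nil
  | var {g m : ℕ} : LSub.Fits (.wk g m) (.var g)
  | snoc {δ : LSub} {Γ : LCtx} {t : Tm} {T : Ty} :
      LSub.Fits δ Γ → LSub.Fits (.snoc δ t) (.snoc Γ T)

theorem LSub.fits_wkOf : ∀ (m : ℕ) (Γ : LCtx), (LSub.wkOf m Γ).Fits Γ
  | _, .nil => .nil
  | _, .var _ => .var
  | m, .snoc Γ _ => .snoc (LSub.fits_wkOf (m + 1) Γ)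

/-- `δ` without its last `m` entries. -/
def LSub.drop : ℕ → LSub → LSub
  | 0, δ => δ
  | m + 1, .snoc δ _ => δ.drop m
  | _ + 1, .emp g n => .emp g n
  | _ + 1, .wk g n => .wk g n

@[simp] theorem LSub.hat_drop : ∀ (m : ℕ) (δ : LSub), (δ.drop m).hat = δ.hat
  | 0, _ => by simp [LSub.drop]
  | m + 1, .snoc δ _ => by simp [LSub.drop, LSub.hat_drop m δ]
  | _ + 1, .emp _ _ => by simp [LSub.drop]
  | _ + 1, .wk _ _ => by simp [LSub.drop]

@[simp] theorem LSub.chk_drop : ∀ (m : ℕ) (δ : LSub), (δ.drop m).chk = δ.chk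
  | 0, _ => by simp [LSub.drop]
  | m + 1, .snoc δ _ => by simp [LSub.drop, LSub.chk_drop m δ]
  | _ + 1, .emp _ _ => by simp [LSub.drop]
  | _ + 1, .wk _ _ => by simp [LSub.drop]

theorem LSub.drop_eq_snoc : ∀ {m : ℕ} {ε δ : LSub} {t : Tm}, ε.drop m = .snoc δ t →
    ε.drop (m + 1) = δ ∧ ε.lookup m = t
  | 0, ε, δ, t, h => by simp only [LSub.drop] at h; subst h; simp [LSub.drop]
  | m + 1, .snoc ε s, δ, t, h => by
      have := LSub.drop_eq_snoc (m := m) (ε := ε) (by simpa [LSub.drop] using h)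
      simpa [LSub.drop] using this
  | _ + 1, .emp _ _, _, _, h => by simp [LSub.drop] at h
  | _ + 1, .wk _ _, _, _, h => by simp [LSub.drop] at h

/-- This is the left identity law in a form fit for induction: `wk^m` skips the last `m` entries of
`ε`. The shape hypothesis is needed because the base of the composite is rebuilt from that of `Γ`,
so a base of another kind would be lost. -/
theorem LSub.wkOf_comp : ∀ (m : ℕ) (Γ : LCtx) (ε : LSub), (ε.drop m).Fits Γ →
    (LSub.wkOf m Γ).comp ε = ε.drop m
  | m, .nil, ε, h => by
      have h1 := ε.hat_drop m
      have h2 := ε.chk_drop m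
      generalize ε.drop m = ε' at *
      cases h; simp_all
  | m, .var g, ε, h => by
      have h1 := ε.hat_drop m
      generalize ε.drop m = ε' at *
      cases h; simp_all
  | m, .snoc Γ T, ε, h => by
      generalize hε : ε.drop m = ε' at *
      cases h with
      | snoc h =>
        obtain ⟨h1, h2⟩ := LSub.drop_eq_snoc hε
        simp [LSub.wkOf_comp (m + 1) Γ ε (by rwa [h1]), h1, h2]

theorem LSub.Fits.idOf_comp {δ : LSub} {Γ : LCtx} (h : δ.Fits Γ) : (LSub.idOf Γ).comp δ = δ :=
  LSub.wkOf_comp 0 Γ δ (by simpa [LSub.drop] using h)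

/-! ### Algebra of global substitutions -/

theorem GSub.getElem?_gwk (σ : GSub) (γ : Wk) (n : ℕ) :
    (GSub.gwk σ γ)[n]? = σ[n]?.map fun e => e.gwk γ := by
  simp [GSub.gwk]

theorem GSub.lookupCtx_gwk (σ : GSub) (γ : Wk) (n : ℕ) :
    GSub.lookupCtx (GSub.gwk σ γ) n = (GSub.lookupCtx σ n).gwk γ := by
  simp only [GSub.lookupCtx, GSub.getElem?_gwk]
  rcases σ[n]? with _ | _ | _ | _ <;> simp

@[simp] theorem GSub.lookupCtx_cons_succ (e : GEntry) (σ : GSub) (n : ℕ) :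
    GSub.lookupCtx (e :: σ) (n + 1) = GSub.lookupCtx σ n := by
  simp [GSub.lookupCtx]

@[simp] theorem GSub.lookupCtx_cons_zero (Γ : LCtx) (σ : GSub) :
    GSub.lookupCtx (.ctx Γ :: σ) 0 = Γ := by
  simp [GSub.lookupCtx]

theorem GSub.appVar_gwk (σ : GSub) (γ : Wk) (u : ℕ) (δ : LSub) :
    (GSub.appVar σ u δ).gwk γ = GSub.appVar (GSub.gwk σ γ) u (δ.gwk γ) := by
  simp only [GSub.appVar, GSub.getElem?_gwk]
  rcases σ[u]? with _ | _ | _ | _ <;> simp [Tm.lsub_gwk]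

theorem GEntry.gwk_p_q (e : GEntry) (γ : Wk) :
    (e.gwk (.p .id)).gwk (.q γ) = (e.gwk γ).gwk (.p .id) := by
  cases e <;> simp [Tm.gwk_p_q, LCtx.gwk_p_q]

theorem GSub.gwk_p_q (σ : GSub) (γ : Wk) :
    GSub.gwk (GSub.gwk σ (.p .id)) (.q γ) = GSub.gwk (GSub.gwk σ γ) (.p .id) := by
  simp [GSub.gwk, GEntry.gwk_p_q]

theorem GSub.qCtx_gwk (σ : GSub) (γ : Wk) :
    GSub.gwk (GSub.qCtx σ) (.q γ) = GSub.qCtx (GSub.gwk σ γ) := by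
  rw [GSub.qCtx, GSub.qCtx, ← GSub.gwk_p_q]; rfl

theorem GSub.qTm_gwk (σ : GSub) (γ : Wk) :
    GSub.gwk (GSub.qTm σ) (.q γ) = GSub.qTm (GSub.gwk σ γ) := by
  rw [GSub.qTm, GSub.qTm, ← GSub.gwk_p_q]; rfl

@[simp] theorem GEntry.gwk_id (e : GEntry) : e.gwk .id = e := by
  cases e <;> simp

@[simp] theorem GSub.gwk_id (σ : GSub) : GSub.gwk σ .id = σ := by
  simp [GSub.gwk]

/-- Restriction of the context part of a global substitution along a global weakening. -/
def GSub.RestrictsCtx (γ : Wk) (σ σ' : GSub) : Prop :=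
  ∀ n, GSub.lookupCtx σ (γ.act n) = GSub.lookupCtx σ' n

/-- Restriction of a global substitution along a global weakening. -/
def GSub.Restricts (γ : Wk) (σ σ' : GSub) : Prop := ∀ n : ℕ, σ[γ.act n]? = σ'[n]?

theorem GSub.Restricts.ctx {γ : Wk} {σ σ' : GSub} (h : GSub.Restricts γ σ σ') :
    GSub.RestrictsCtx γ σ σ' := fun n => by simp [GSub.lookupCtx, h n]

theorem GSub.RestrictsCtx.q {γ : Wk} {σ σ' : GSub} (h : GSub.RestrictsCtx γ σ σ') :
    GSub.RestrictsCtx (.q γ) (GSub.qCtx σ) (GSub.qCtx σ') := by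
  rintro (_ | n)
  · simp [GSub.qCtx]
  · simp [GSub.qCtx, GSub.lookupCtx_gwk, h n]

theorem GSub.Restricts.cons {γ : Wk} {σ σ' : GSub} (h : GSub.Restricts γ σ σ') (e : GEntry) :
    GSub.Restricts (.q γ) (e :: σ) (e :: σ') := by
  rintro (_ | n)
  · simp
  · simpa using h n

theorem GSub.Restricts.gwk {γ : Wk} {σ σ' : GSub} (h : GSub.Restricts γ σ σ') (γ' : Wk) :
    GSub.Restricts γ (GSub.gwk σ γ') (GSub.gwk σ' γ') := fun n => by
  simp [GSub.getElem?_gwk, h n]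

theorem GSub.restricts_p (e : GEntry) (σ : GSub) : GSub.Restricts (.p .id) (e :: σ) σ :=
  fun n => by simp

mutual
  -- Types and local contexts mention context variables but no global variables `u`, so only the
  -- context entries of `σ` matter.
  theorem Ty.gwk_gsub : ∀ (T : Ty) {γ : Wk} {σ σ' : GSub}, GSub.RestrictsCtx γ σ σ' →
      (T.gwk γ).gsub σ = T.gsub σ'
    | .nat, _, _, _, _ => by simp
    | .arr S T, _, _, _, h => by simp [S.gwk_gsub h, T.gwk_gsub h]
    | .box Γ T, _, _, _, h => by simp [Γ.gwk_gsub h, T.gwk_gsub h]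
    | .pi T, _, _, _, h => by simp [T.gwk_gsub h.q]
  theorem LCtx.gwk_gsub : ∀ (Γ : LCtx) {γ : Wk} {σ σ' : GSub}, GSub.RestrictsCtx γ σ σ' →
      (Γ.gwk γ).gsub σ = Γ.gsub σ'
    | .nil, _, _, _, _ => by simp
    | .var g, _, _, _, h => by simp [h g]
    | .snoc Γ T, _, _, _, h => by simp [Γ.gwk_gsub h, T.gwk_gsub h]
end

mutual
  theorem Ty.gsub_gwk : ∀ (T : Ty) (σ : GSub) (γ : Wk),
      (T.gsub σ).gwk γ = T.gsub (GSub.gwk σ γ)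
    | .nat, _, _ => by simp
    | .arr S T, σ, γ => by simp [S.gsub_gwk σ γ, T.gsub_gwk σ γ]
    | .box Γ T, σ, γ => by simp [Γ.gsub_gwk σ γ, T.gsub_gwk σ γ]
    | .pi T, σ, γ => by simp [T.gsub_gwk (GSub.qCtx σ) (.q γ), GSub.qCtx_gwk]
  theorem LCtx.gsub_gwk : ∀ (Γ : LCtx) (σ : GSub) (γ : Wk),
      (Γ.gsub σ).gwk γ = Γ.gsub (GSub.gwk σ γ)
    | .nil, _, _ => by simp
    | .var g, σ, γ => by simp [GSub.lookupCtx_gwk]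
    | .snoc Γ T, σ, γ => by simp [Γ.gsub_gwk σ γ, T.gsub_gwk σ γ]
end

@[simp] theorem Ty.gwk_p_gsub (T : Ty) (e : GEntry) (σ : GSub) :
    (T.gwk (.p .id)).gsub (e :: σ) = T.gsub σ :=
  T.gwk_gsub (GSub.restricts_p e σ).ctx

@[simp] theorem LCtx.gwk_p_gsub (Γ : LCtx) (e : GEntry) (σ : GSub) :
    (Γ.gwk (.p .id)).gsub (e :: σ) = Γ.gsub σ :=
  Γ.gwk_gsub (GSub.restricts_p e σ).ctx

theorem LCtx.gwk_p_gsub_qCtx (Γ : LCtx) (σ : GSub) :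
    (Γ.gwk (.p .id)).gsub (GSub.qCtx σ) = (Γ.gsub σ).gwk (.p .id) := by
  simp [GSub.qCtx, LCtx.gsub_gwk]

theorem Ty.gwk_p_gsub_qTm (T : Ty) (σ : GSub) :
    (T.gwk (.p .id)).gsub (GSub.qTm σ) = (T.gsub σ).gwk (.p .id) := by
  simp [GSub.qTm, Ty.gsub_gwk]

theorem LCtx.gwk_p_gsub_qTm (Γ : LCtx) (σ : GSub) :
    (Γ.gwk (.p .id)).gsub (GSub.qTm σ) = (Γ.gsub σ).gwk (.p .id) := by
  simp [GSub.qTm, LCtx.gsub_gwk]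

/-- The context part of `σ''` is the composition of those of `σ` and `σ'`. -/
def GSub.ComposesCtx (σ σ' σ'' : GSub) : Prop :=
  ∀ n, (GSub.lookupCtx σ n).gsub σ' = GSub.lookupCtx σ'' n

theorem GSub.ComposesCtx.q {σ σ' σ'' : GSub} (h : GSub.ComposesCtx σ σ' σ'') :
    GSub.ComposesCtx (GSub.qCtx σ) (GSub.qCtx σ') (GSub.qCtx σ'') := by
  rintro (_ | n)
  · simp [GSub.qCtx]
  · have := h n
    simp only [GSub.qCtx, GSub.lookupCtx_cons_succ, GSub.lookupCtx_gwk, LCtx.gwk_p_gsub]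
    rw [← LCtx.gsub_gwk, this]

mutual
  theorem Ty.gsub_gsub : ∀ (T : Ty) {σ σ' σ'' : GSub}, GSub.ComposesCtx σ σ' σ'' →
      (T.gsub σ).gsub σ' = T.gsub σ''
    | .nat, _, _, _, _ => by simp
    | .arr S T, _, _, _, h => by simp [S.gsub_gsub h, T.gsub_gsub h]
    | .box Γ T, _, _, _, h => by simp [Γ.gsub_gsub h, T.gsub_gsub h]
    | .pi T, _, _, _, h => by simp [T.gsub_gsub h.q]
  theorem LCtx.gsub_gsub : ∀ (Γ : LCtx) {σ σ' σ'' : GSub}, GSub.ComposesCtx σ σ' σ'' →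
      (Γ.gsub σ).gsub σ' = Γ.gsub σ''
    | .nil, _, _, _, _ => by simp
    | .var g, _, _, _, h => by simp [h g]
    | .snoc Γ T, _, _, _, h => by simp [Γ.gsub_gsub h, T.gsub_gsub h]
end

/-- The clause `wk_g^m[σ] = wk^m_{σ(g)}` is made for this: identities are sent to identities. -/
theorem LSub.wkOf_gsub : ∀ (m : ℕ) (Γ : LCtx) (σ : GSub),
    (LSub.wkOf m Γ).gsub σ = LSub.wkOf m (Γ.gsub σ)
  | _, .nil, _ => by simp
  | _, .var _, _ => by simp [LSub.idOf_lwk_pn]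
  | m, .snoc Γ T, σ => by simp [LSub.wkOf_gsub (m + 1) Γ σ]

theorem LSub.idOf_gsub (Γ : LCtx) (σ : GSub) : (LSub.idOf Γ).gsub σ = LSub.idOf (Γ.gsub σ) :=
  LSub.wkOf_gsub 0 Γ σ

theorem LSub.Fits.gsub {δ : LSub} {Γ : LCtx} (h : δ.Fits Γ) (σ : GSub) :
    (δ.gsub σ).Fits (Γ.gsub σ) := by
  induction h with
  | @nil g m => cases g <;> simp <;> exact .nil
  | var => simp only [LSub.gsub, LSub.idOf_lwk_pn, LCtx.gsub]; exact LSub.fits_wkOf _ _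
  | snoc _ ih => exact .snoc ih

theorem GSub.appVar_restricts {γ : Wk} {σ σ' : GSub} (h : GSub.Restricts γ σ σ') (u : ℕ)
    (δ : LSub) : GSub.appVar σ (γ.act u) δ = GSub.appVar σ' u δ := by
  simp [GSub.appVar, h u]

mutual
  theorem Tm.gwk_gsub : ∀ (t : Tm) {γ : Wk} {σ σ' : GSub}, GSub.Restricts γ σ σ' →
      (t.gwk γ).gsub σ = t.gsub σ'
    | .var x, _, _, _, _ => by simp
    | .gvar u δ, _, _, _, h => by simp [δ.gwk_gsub h, GSub.appVar_restricts h]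
    | .zero, _, _, _, _ => by simp
    | .succ t, _, _, _, h => by simp [t.gwk_gsub h]
    | .box t, _, _, _, h => by simp [t.gwk_gsub h]
    | .letbox s t, _, _, _, h => by simp [s.gwk_gsub h, t.gwk_gsub ((h.gwk _).cons _), GSub.qTm]
    | .lam t, _, _, _, h => by simp [t.gwk_gsub h]
    | .app t s, _, _, _, h => by simp [t.gwk_gsub h, s.gwk_gsub h]
    | .mlam t, _, _, _, h => by simp [t.gwk_gsub ((h.gwk _).cons _), GSub.qCtx]
    | .mapp t Γ, _, _, _, h => by simp [t.gwk_gsub h, Γ.gwk_gsub h.ctx]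
  theorem LSub.gwk_gsub : ∀ (δ : LSub) {γ : Wk} {σ σ' : GSub}, GSub.Restricts γ σ σ' →
      (δ.gwk γ).gsub σ = δ.gsub σ'
    | .emp none m, _, _, _, _ => by simp
    | .emp (some g) m, _, _, _, h => by simp [h.ctx g]
    | .wk g m, _, _, _, h => by simp [h.ctx g]
    | .snoc δ t, _, _, _, h => by simp [δ.gwk_gsub h, t.gwk_gsub h]
end

mutual
  theorem Tm.gsub_gwk : ∀ (t : Tm) (σ : GSub) (γ : Wk),
      (t.gsub σ).gwk γ = t.gsub (GSub.gwk σ γ)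
    | .var x, _, _ => by simp
    | .gvar u δ, σ, γ => by simp [GSub.appVar_gwk, δ.gsub_gwk σ γ]
    | .zero, _, _ => by simp
    | .succ t, σ, γ => by simp [t.gsub_gwk σ γ]
    | .box t, σ, γ => by simp [t.gsub_gwk σ γ]
    | .letbox s t, σ, γ => by
        simp [s.gsub_gwk σ γ, t.gsub_gwk (GSub.qTm σ) (.q γ), GSub.qTm_gwk]
    | .lam t, σ, γ => by simp [t.gsub_gwk σ γ]
    | .app t s, σ, γ => by simp [t.gsub_gwk σ γ, s.gsub_gwk σ γ]
    | .mlam t, σ, γ => by simp [t.gsub_gwk (GSub.qCtx σ) (.q γ), GSub.qCtx_gwk]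
    | .mapp t Γ, σ, γ => by simp [t.gsub_gwk σ γ, Γ.gsub_gwk σ γ]
  theorem LSub.gsub_gwk : ∀ (δ : LSub) (σ : GSub) (γ : Wk),
      (δ.gsub σ).gwk γ = δ.gsub (GSub.gwk σ γ)
    | .emp none m, _, _ => by simp
    | .emp (some g) m, σ, γ => by simp [GSub.lookupCtx_gwk]
    | .wk g m, σ, γ => by simp [GSub.lookupCtx_gwk, LSub.idOf_lwk_pn]
    | .snoc δ t, σ, γ => by simp [δ.gsub_gwk σ γ, t.gsub_gwk σ γ]
end

@[simp] theorem Tm.gwk_p_gsub (t : Tm) (e : GEntry) (σ : GSub) :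
    (t.gwk (.p .id)).gsub (e :: σ) = t.gsub σ :=
  t.gwk_gsub (GSub.restricts_p e σ)

@[simp] theorem LSub.gwk_p_gsub (δ : LSub) (e : GEntry) (σ : GSub) :
    (δ.gwk (.p .id)).gsub (e :: σ) = δ.gsub σ :=
  δ.gwk_gsub (GSub.restricts_p e σ)

theorem LSub.gwk_p_gsub_qCtx (δ : LSub) (σ : GSub) :
    (δ.gwk (.p .id)).gsub (GSub.qCtx σ) = (δ.gsub σ).gwk (.p .id) := by
  simp [GSub.qCtx, LSub.gsub_gwk]

theorem LSub.gwk_p_gsub_qTm (δ : LSub) (σ : GSub) :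
    (δ.gwk (.p .id)).gsub (GSub.qTm σ) = (δ.gsub σ).gwk (.p .id) := by
  simp [GSub.qTm, LSub.gsub_gwk]

/-! ### Well-formedness -/

mutual
  theorem WfT.wfG : ∀ {T : Ty} {i : Layer} {Ψ : GCtx}, WfT i Ψ T → WfG Ψ
    | .nat, _, _, h => by cases h; assumption
    | .arr S T, _, _, h => by cases h with | arr hS hT => exact hS.wfG
    | .box Γ T, _, _, h => by cases h with | box hΓ hT => exact hT.wfG
    | .pi T, _, _, h => by cases h with | pi hT => cases hT.wfG; assumption
  theorem WfL.wfG : ∀ {Γ : LCtx} {i : Layer} {Ψ : GCtx}, WfL i Ψ Γ → WfG Ψ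
    | .nil, _, _, h => by cases h; assumption
    | .var g, _, _, h => by cases h; assumption
    | .snoc Γ T, _, _, h => by cases h with | snoc hΓ hT => exact hΓ.wfG
end

/-- A layer-`0` type is built from `Nat` and arrows alone, whose rules are the same at both layers.
-/
theorem WfT.lift : ∀ {T : Ty} {Ψ : GCtx}, WfT .zero Ψ T → ∀ i, WfT i Ψ T
  | .nat, _, h, _ => by cases h with | nat h => exact .nat h
  | .arr S T, _, h, i => by cases h with | arr hS hT => exact .arr (hS.lift i) (hT.lift i)
  | .box _ _, _, h, _ => by cases h
  | .pi _, _, h, _ => by cases h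

theorem WfL.lift : ∀ {Γ : LCtx} {Ψ : GCtx}, WfL .zero Ψ Γ → ∀ i, WfL i Ψ Γ
  | .nil, _, h, _ => by cases h with | nil h => exact .nil h
  | .var _, _, h, _ => by cases h with | var h hg => exact .var h hg
  | .snoc Γ T, _, h, i => by cases h with | snoc hΓ hT => exact .snoc (hΓ.lift i) (hT.lift i)

theorem WfT.toOne {i : Layer} {T : Ty} {Ψ : GCtx} (h : WfT i Ψ T) : WfT .one Ψ T := by
  cases i
  · exact h.lift _
  · exact h

theorem WfL.toOne {i : Layer} {Γ : LCtx} {Ψ : GCtx} (h : WfL i Ψ Γ) : WfL .one Ψ Γ := by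
  cases i
  · exact h.lift _
  · exact h

theorem WfB.wfG {Ψ : GCtx} {B : GBind} (h : WfB Ψ B) : WfG Ψ := by
  cases h with
  | ctx h => exact h
  | code h _ => exact h.wfG

theorem WfB.cons {Ψ : GCtx} {B : GBind} (h : WfB Ψ B) : WfG (B :: Ψ) := by
  cases h with
  | ctx h => exact .ctx h
  | code h h' => exact .code h h'

theorem WfG.wfB {Ψ : GCtx} {B : GBind} (h : WfG (B :: Ψ)) : WfB Ψ B := by
  cases h with
  | ctx h => exact .ctx h
  | code h h' => exact .code h h'

theorem GWk.wfG_left {γ : Wk} {Φ Ψ : GCtx} (h : GWk γ Φ Ψ) : WfG Φ := by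
  cases h with
  | id h => exact h
  | p _ h => exact h.cons
  | q _ _ h => exact h.cons

theorem GWk.wfG_right {γ : Wk} {Φ Ψ : GCtx} (h : GWk γ Φ Ψ) : WfG Ψ := by
  induction h with
  | id h => exact h
  | p _ _ ih => exact ih
  | q _ h _ _ => exact h.cons

theorem GWk.pId {Ψ : GCtx} {B : GBind} (h : WfB Ψ B) : GWk (.p .id) (B :: Ψ) Ψ :=
  .p (.id h.wfG) h

theorem GWk.qCtx {γ : Wk} {Φ Ψ : GCtx} (h : GWk γ Φ Ψ) : GWk (.q γ) (.ctx :: Φ) (.ctx :: Ψ) :=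
  .q (B := .ctx) h (.ctx h.wfG_right) (.ctx h.wfG_left)

theorem HasG.gwk {γ : Wk} {Φ Ψ : GCtx} (h : GWk γ Φ Ψ) :
    ∀ {u : ℕ} {B : GBind}, HasG Ψ u B → HasG Φ (γ.act u) (B.gwk γ) := by
  induction h with
  | id _ => intro u B hu; simpa using hu
  | @p γ Φ Ψ B' _ _ ih =>
    intro u B hu
    have := HasG.there (B' := B') (ih hu)
    rw [GBind.gwk_comp] at this
    exact this
  | @q γ Φ Ψ B' _ _ _ ih =>
    intro u B hu
    cases hu with
    | here => rw [GBind.gwk_p_q]; exact .here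
    | there hu => rw [GBind.gwk_p_q]; exact .there (ih hu)

mutual
  theorem WfT.gwk : ∀ {T : Ty} {i : Layer} {γ : Wk} {Φ Ψ : GCtx}, WfT i Ψ T → GWk γ Φ Ψ →
      WfT i Φ (T.gwk γ)
    | .nat, _, _, _, _, _, hγ => .nat hγ.wfG_left
    | .arr S T, _, _, _, _, h, hγ => by
        cases h with | arr hS hT => exact .arr (hS.gwk hγ) (hT.gwk hγ)
    | .box Γ T, _, _, _, _, h, hγ => by
        cases h with | box hΓ hT => exact .box (hΓ.gwk hγ) (hT.gwk hγ)
    | .pi T, _, _, _, _, h, hγ => by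
        cases h with | pi hT => exact .pi (hT.gwk hγ.qCtx)
  theorem WfL.gwk : ∀ {Γ : LCtx} {i : Layer} {γ : Wk} {Φ Ψ : GCtx}, WfL i Ψ Γ → GWk γ Φ Ψ →
      WfL i Φ (Γ.gwk γ)
    | .nil, _, _, _, _, _, hγ => .nil hγ.wfG_left
    | .var g, _, _, _, _, h, hγ => by
        cases h with | var _ hg => exact .var hγ.wfG_left (hg.gwk hγ)
    | .snoc Γ T, _, _, _, _, h, hγ => by
        cases h with | snoc hΓ hT => exact .snoc (hΓ.gwk hγ) (hT.gwk hγ)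
end

theorem WfB.gwk {B : GBind} {γ : Wk} {Φ Ψ : GCtx} (h : WfB Ψ B) (hγ : GWk γ Φ Ψ) :
    WfB Φ (B.gwk γ) := by
  cases h with
  | ctx h => exact .ctx hγ.wfG_left
  | code h h' => exact .code (h.gwk hγ) (h'.gwk hγ)

theorem GWk.qCode {γ : Wk} {Φ Ψ : GCtx} (h : GWk γ Φ Ψ) {Δ : LCtx} {T : Ty}
    (hΔ : WfL .zero Ψ Δ) (hT : WfT .zero Ψ T) :
    GWk (.q γ) (.code (Δ.gwk γ) (T.gwk γ) :: Φ) (.code Δ T :: Ψ) :=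
  .q (B := .code Δ T) h (.code hΔ hT) (.code (hΔ.gwk h) (hT.gwk h))

theorem HasG.wfB {Ψ : GCtx} {u : ℕ} {B : GBind} (h : HasG Ψ u B) : WfG Ψ → WfB Ψ B := by
  induction h with
  | here => intro hΨ; exact hΨ.wfB.gwk (.pId hΨ.wfB)
  | there _ ih => intro hΨ; exact (ih hΨ.wfB.wfG).gwk (.pId hΨ.wfB)

theorem HasG.wfT {Ψ : GCtx} {u : ℕ} {Δ : LCtx} {T : Ty} (h : HasG Ψ u (.code Δ T))
    (hΨ : WfG Ψ) : WfT .zero Ψ T := by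
  cases h.wfB hΨ; assumption

theorem GWk.comp {γ' : Wk} {Φ' Φ : GCtx} (h' : GWk γ' Φ' Φ) :
    ∀ {γ : Wk} {Ψ : GCtx}, GWk γ Φ Ψ → GWk (γ.comp γ') Φ' Ψ := by
  induction h' with
  | id _ => intro γ Ψ h; simpa [Wk.comp] using h
  | p _ hB ih => intro γ Ψ h; exact .p (ih h) hB
  | q h' hB hB' ih =>
    intro γ Ψ h
    cases h with
    | id _ => exact .q h' hB hB'
    | p h _ => exact .p (ih h) hB'
    | @q γ _ _ B h hB₀ _ =>
      have := GWk.q (ih h) hB₀ (hB₀.gwk (ih h))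
      rw [← GBind.gwk_comp] at this
      exact this

theorem LWk.wfL_left {i : Layer} {Ψ : GCtx} {τ : Wk} {Γ Δ : LCtx} (h : LWk i Ψ τ Γ Δ) :
    WfL i Ψ Γ := by
  induction h with
  | id h => exact h
  | p _ hT ih => exact .snoc ih hT
  | q _ hT ih => exact .snoc ih hT

theorem LWk.pId {i : Layer} {Ψ : GCtx} {Γ : LCtx} {T : Ty} (hΓ : WfL i Ψ Γ) (hT : WfT i Ψ T) :
    LWk i Ψ (.p .id) (.snoc Γ T) Γ := .p (.id hΓ) hT

theorem LWk.gwk {i : Layer} {Φ Ψ : GCtx} {γ τ : Wk} {Γ Δ : LCtx} (h : LWk i Ψ τ Γ Δ)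
    (hγ : GWk γ Φ Ψ) : LWk i Φ τ (Γ.gwk γ) (Δ.gwk γ) := by
  induction h with
  | id h => exact .id (h.gwk hγ)
  | p _ hT ih => exact .p ih (hT.gwk hγ)
  | q _ hT ih => exact .q ih (hT.gwk hγ)

theorem LWk.comp {i : Layer} {Ψ : GCtx} {τ' : Wk} {Γ Δ : LCtx} (h' : LWk i Ψ τ' Γ Δ) :
    ∀ {τ : Wk} {Δ' : LCtx}, LWk i Ψ τ Δ Δ' → LWk i Ψ (τ.comp τ') Γ Δ' := by
  induction h' with
  | id _ => intro τ Δ' h; simpa [Wk.comp] using h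
  | p _ hT ih => intro τ Δ' h; exact .p (ih h) hT
  | q h' hT ih =>
    intro τ Δ' h
    cases h with
    | id _ => exact .q h' hT
    | p h _ => exact .p (ih h) hT
    | q h _ => exact .q (ih h) hT

theorem LWk.len_eq {i : Layer} {Ψ : GCtx} {τ : Wk} {Γ Δ : LCtx} (h : LWk i Ψ τ Γ Δ) :
    Γ.len = Δ.len + τ.count := by
  induction h with
  | id h => simp
  | p _ hT ih => simp [ih]; omega
  | q _ hT ih => simp [ih]; omega

theorem LWk.base_eq {i : Layer} {Ψ : GCtx} {τ : Wk} {Γ Δ : LCtx} (h : LWk i Ψ τ Γ Δ) :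
    Γ.base = Δ.base := by
  induction h with
  | id h => rfl
  | p _ hT ih => simp [ih]
  | q _ hT ih => simp [ih]

/-- Past the variables of `Δ`, a weakening is a plain shift. This is the only property of `τ` needed
to exchange it with a global substitution, which may insert variables past the end of the local
context. -/
theorem LWk.act_add_len {i : Layer} {Ψ : GCtx} {τ : Wk} {Γ Δ : LCtx} (h : LWk i Ψ τ Γ Δ) :
    ∀ x, τ.act (x + Δ.len) = x + Δ.len + τ.count := by
  induction h with
  | id h => simp
  | p _ hT ih => intro x; simp [ih]; omega
  | q _ hT ih => intro x; simp [← Nat.add_assoc, ih]; omega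

theorem HasL.lwk {i : Layer} {Ψ : GCtx} {τ : Wk} {Γ Δ : LCtx} (h : LWk i Ψ τ Γ Δ) :
    ∀ {x : ℕ} {T : Ty}, HasL Δ x T → HasL Γ (τ.act x) T := by
  induction h with
  | id h => intro x T hx; exact hx
  | p _ hT ih => intro x T hx; exact .there (ih hx)
  | q _ hT ih =>
    intro x T hx
    cases hx with
    | here => exact .here
    | there hx => exact .there (ih hx)

theorem HasL.gwk {Γ : LCtx} {x : ℕ} {T : Ty} (h : HasL Γ x T) (γ : Wk) :
    HasL (Γ.gwk γ) x (T.gwk γ) := by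
  induction h with
  | here => exact .here
  | there _ ih => exact .there ih

theorem HasL.gsub {Γ : LCtx} {x : ℕ} {T : Ty} (h : HasL Γ x T) (σ : GSub) :
    HasL (Γ.gsub σ) x (T.gsub σ) := by
  induction h with
  | here => exact .here
  | there _ ih => exact .there ih

theorem HasL.wfT {i : Layer} {Ψ : GCtx} {Γ : LCtx} {x : ℕ} {T : Ty} (h : HasL Γ x T) :
    WfL i Ψ Γ → WfT i Ψ T := by
  induction h with
  | here => intro hΓ; cases hΓ; assumption
  | there _ ih => intro hΓ; cases hΓ with | snoc hΓ _ => exact ih hΓ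

theorem WfL.hasG_base : ∀ {Γ : LCtx} {i : Layer} {Ψ : GCtx} {g : ℕ}, WfL i Ψ Γ →
    Γ.base = some g → HasG Ψ g .ctx
  | .nil, _, _, _, _, hb => by simp at hb
  | .var _, _, _, _, h, hb => by cases h; simp at hb; subst hb; assumption
  | .snoc Γ _, _, _, _, h, hb => by cases h with | snoc h _ => exact h.hasG_base (by simpa using hb)

theorem HasG.eq_of_zero {Ψ : GCtx} {B B' : GBind} (h : HasG (B :: Ψ) 0 B') :
    B' = B.gwk (.p .id) := by
  cases h; rfl

theorem HasG.of_succ {Ψ : GCtx} {B B' : GBind} {n : ℕ} (h : HasG (B' :: Ψ) (n + 1) B) :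
    ∃ B₀ : GBind, B = B₀.gwk (.p .id) ∧ HasG Ψ n B₀ := by
  cases h; exact ⟨_, rfl, by assumption⟩

theorem HasG.ctx_of_succ {Ψ : GCtx} {B' : GBind} {n : ℕ} (h : HasG (B' :: Ψ) (n + 1) .ctx) :
    HasG Ψ n .ctx := by
  obtain ⟨B₀, hB, h⟩ := h.of_succ
  cases B₀ with
  | ctx => exact h
  | code => simp at hB

theorem HasG.code_of_succ {Ψ : GCtx} {B' : GBind} {n : ℕ} {Δ : LCtx} {T : Ty}
    (h : HasG (B' :: Ψ) (n + 1) (.code Δ T)) :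
    ∃ Δ₀ T₀, Δ = LCtx.gwk Δ₀ (.p .id) ∧ T = Ty.gwk T₀ (.p .id) ∧ HasG Ψ n (.code Δ₀ T₀) := by
  obtain ⟨B₀, hB, h⟩ := h.of_succ
  cases B₀ with
  | ctx => simp at hB
  | code Δ₀ T₀ =>
    simp only [GBind.gwk_code, GBind.code.injEq] at hB
    exact ⟨Δ₀, T₀, hB.1, hB.2, h⟩

/-! ### The global identity substitution -/

theorem GSub.length_wkOf : ∀ (m : ℕ) (Ψ : GCtx), (GSub.wkOf m Ψ).length = Ψ.length
  | _, [] => by simp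
  | m, .ctx :: Ψ => by simp [GSub.length_wkOf (m + 1) Ψ]
  | m, .code _ _ :: Ψ => by simp [GSub.length_wkOf (m + 1) Ψ]

theorem HasG.exists_of_lt : ∀ {Ψ : GCtx} {n : ℕ}, n < Ψ.length → ∃ B, HasG Ψ n B
  | [], _, h => by simp at h
  | B :: Ψ, 0, _ => ⟨_, .here⟩
  | B :: Ψ, n + 1, h => by
      obtain ⟨B', hB'⟩ := HasG.exists_of_lt (Ψ := Ψ) (n := n) (by simpa using h)
      exact ⟨_, .there hB'⟩

/-- The entry of `wk^m_Ψ` for the binding `B` at position `n`. -/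
def GBind.idEntry (m n : ℕ) : GBind → GEntry
  | .ctx => .ctx (.var (m + n))
  | .code Γ _ => .tm (.gvar (m + n) ((LSub.idOf Γ).gwk (Wk.pn m)))

/-- The offset grows by one with each binding passed, so the induction has to cover all `m`; only
the case `m = 0` is used afterwards. -/
theorem HasG.getElem?_wkOf {Ψ : GCtx} {n : ℕ} {B : GBind} (h : HasG Ψ n B) :
    ∀ m, (GSub.wkOf m Ψ)[n]? = some (B.idEntry m n) := by
  induction h with
  | @here Ψ B =>
    intro m
    cases B with
    | ctx => simp [GBind.idEntry]
    | code Γ T =>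
      simp only [GSub.wkOf, GBind.gwk_code, GBind.idEntry, LSub.idOf_gwk, LCtx.gwk_comp]
      rw [Γ.gwk_congr (γ' := (Wk.p .id).comp (Wk.pn m))]
      · simp
      · intro n; simp [Wk.act_comp, Wk.act_pn]; omega
  | @there Ψ B B' u _ ih =>
    intro m
    have : (GSub.wkOf m (B' :: Ψ))[u + 1]? = (GSub.wkOf (m + 1) Ψ)[u]? := by
      cases B' <;> simp
    rw [this, ih]
    cases B with
    | ctx => simp [GBind.idEntry]; omega
    | code Γ T =>
      simp only [GBind.gwk_code, GBind.idEntry, LSub.idOf_gwk, LCtx.gwk_comp]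
      rw [Γ.gwk_congr (γ' := (Wk.p .id).comp (Wk.pn m))]
      · simp; omega
      · intro n; simp [Wk.act_comp, Wk.act_pn]; omega

theorem HasG.getElem?_idOf_ctx {Ψ : GCtx} {g : ℕ} (h : HasG Ψ g .ctx) :
    (GSub.idOf Ψ)[g]? = some (.ctx (.var g)) := by
  simpa [GBind.idEntry, GSub.idOf] using h.getElem?_wkOf 0

theorem HasG.getElem?_idOf_code {Ψ : GCtx} {u : ℕ} {Γ : LCtx} {T : Ty}
    (h : HasG Ψ u (.code Γ T)) : (GSub.idOf Ψ)[u]? = some (.tm (.gvar u (LSub.idOf Γ))) := by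
  simpa [GBind.idEntry, GSub.idOf] using h.getElem?_wkOf 0

theorem GSub.getElem?_idOf_of_le {Ψ : GCtx} {n : ℕ} (h : Ψ.length ≤ n) :
    (GSub.idOf Ψ)[n]? = none := by
  simp [GSub.idOf, GSub.length_wkOf, h]

theorem GWk.length_le_act {γ : Wk} {Φ Ψ : GCtx} (h : GWk γ Φ Ψ) :
    ∀ {n : ℕ}, Ψ.length ≤ n → Φ.length ≤ γ.act n := by
  induction h with
  | id => intro n h; simpa using h
  | p _ _ ih => intro n h; simpa using ih h
  | q _ _ _ ih =>
    intro n h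
    cases n with
    | zero => simp at h
    | succ n => simpa using ih (by simpa using h)

/-- This makes the instances `T[id_Ψ, Δ/g]` and `t[id_Ψ, s/u]` natural in `Ψ`. Restriction demands
agreement at every index, so indices off `Ψ` must go to indices off `Φ`, which is
`GWk.length_le_act`. -/
theorem GWk.restricts_idOf {γ : Wk} {Φ Ψ : GCtx} (h : GWk γ Φ Ψ) :
    GSub.Restricts γ (GSub.idOf Φ) (GSub.gwk (GSub.idOf Ψ) γ) := by
  intro n
  rw [GSub.getElem?_gwk]
  rcases Nat.lt_or_ge n Ψ.length with hn | hn
  · obtain ⟨B, hB⟩ := HasG.exists_of_lt hn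
    have hB' := hB.gwk h
    cases B with
    | ctx => rw [hB.getElem?_idOf_ctx, HasG.getElem?_idOf_ctx hB']; simp
    | code Γ T =>
      rw [hB.getElem?_idOf_code, HasG.getElem?_idOf_code hB']
      simp [LSub.idOf_gwk]
  · rw [GSub.getElem?_idOf_of_le hn, GSub.getElem?_idOf_of_le (h.length_le_act hn)]; rfl

theorem Ty.gsub_ctx_idOf_gwk {γ : Wk} {Φ Ψ : GCtx} (h : GWk γ Φ Ψ) (T : Ty) (Δ : LCtx) :
    (T.gsub (.ctx Δ :: GSub.idOf Ψ)).gwk γ =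
      (T.gwk (.q γ)).gsub (.ctx (Δ.gwk γ) :: GSub.idOf Φ) := by
  rw [Ty.gsub_gwk]
  exact (T.gwk_gsub (h.restricts_idOf.cons _).ctx).symm

/-! ### Global substitution of types -/

/-- All context entries of `σ` are well-formed over `Φ`. -/
def GSub.WfCtx (Φ : GCtx) (σ : GSub) : Prop := ∀ n, WfL .zero Φ (GSub.lookupCtx σ n)

theorem GSub.WfCtx.wfG {Φ : GCtx} {σ : GSub} (h : GSub.WfCtx Φ σ) : WfG Φ := (h 0).wfG

theorem GSub.WfCtx.gwk {Φ Φ' : GCtx} {σ : GSub} {γ : Wk} (h : GSub.WfCtx Φ σ)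
    (hγ : GWk γ Φ' Φ) : GSub.WfCtx Φ' (GSub.gwk σ γ) := fun n => by
  rw [GSub.lookupCtx_gwk]; exact (h n).gwk hγ

theorem GSub.WfCtx.consCtx {Φ : GCtx} {σ : GSub} {Γ : LCtx} (h : GSub.WfCtx Φ σ)
    (hΓ : WfL .zero Φ Γ) : GSub.WfCtx Φ (.ctx Γ :: σ)
  | 0 => by simpa using hΓ
  | n + 1 => by simpa using h n

theorem GSub.WfCtx.qCtx {Φ : GCtx} {σ : GSub} (h : GSub.WfCtx Φ σ) :
    GSub.WfCtx (.ctx :: Φ) (GSub.qCtx σ) :=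
  (h.gwk (.pId (.ctx h.wfG))).consCtx (.var (.ctx h.wfG) .here)

mutual
  -- Since `lookupCtx` falls back to the empty context, which is always well-formed, `WfCtx` can
  -- speak of all indices, and no relation between the domain of `σ` and `Ψ` is required.
  theorem WfT.gsub : ∀ {T : Ty} {i : Layer} {σ : GSub} {Φ Ψ : GCtx}, WfT i Ψ T →
      GSub.WfCtx Φ σ → WfT i Φ (T.gsub σ)
    | .nat, _, _, _, _, _, hσ => .nat hσ.wfG
    | .arr S T, _, _, _, _, h, hσ => by
        cases h with | arr hS hT => exact .arr (hS.gsub hσ) (hT.gsub hσ)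
    | .box Γ T, _, _, _, _, h, hσ => by
        cases h with | box hΓ hT => exact .box (hΓ.gsub hσ) (hT.gsub hσ)
    | .pi T, _, _, _, _, h, hσ => by
        cases h with | pi hT => exact .pi (hT.gsub hσ.qCtx)
  theorem WfL.gsub : ∀ {Γ : LCtx} {i : Layer} {σ : GSub} {Φ Ψ : GCtx}, WfL i Ψ Γ →
      GSub.WfCtx Φ σ → WfL i Φ (Γ.gsub σ)
    | .nil, _, _, _, _, _, hσ => .nil hσ.wfG
    | .var g, _, _, _, _, _, hσ => (hσ g).lift _
    | .snoc Γ T, _, _, _, _, h, hσ => by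
        cases h with | snoc hΓ hT => exact .snoc (hΓ.gsub hσ) (hT.gsub hσ)
end

/-- `σ` maps every context variable of `Ψ` to itself. -/
def GSub.IsIdCtx (Ψ : GCtx) (σ : GSub) : Prop :=
  ∀ g, HasG Ψ g .ctx → GSub.lookupCtx σ g = .var g

theorem GSub.IsIdCtx.q {Ψ : GCtx} {σ : GSub} (h : GSub.IsIdCtx Ψ σ) :
    GSub.IsIdCtx (.ctx :: Ψ) (GSub.qCtx σ) := by
  intro g hg
  cases g with
  | zero => simp [GSub.qCtx]
  | succ g =>
    simp [GSub.qCtx, GSub.lookupCtx_gwk, h g hg.ctx_of_succ]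

mutual
  theorem WfT.gsub_id : ∀ {T : Ty} {i : Layer} {σ : GSub} {Ψ : GCtx}, WfT i Ψ T →
      GSub.IsIdCtx Ψ σ → T.gsub σ = T
    | .nat, _, _, _, _, _ => by simp
    | .arr S T, _, _, _, h, hσ => by
        cases h with | arr hS hT => simp [hS.gsub_id hσ, hT.gsub_id hσ]
    | .box Γ T, _, _, _, h, hσ => by
        cases h with | box hΓ hT => simp [hΓ.gsub_id hσ, hT.gsub_id hσ]
    | .pi T, _, _, _, h, hσ => by
        cases h with | pi hT => simp [hT.gsub_id hσ.q]
  theorem WfL.gsub_id : ∀ {Γ : LCtx} {i : Layer} {σ : GSub} {Ψ : GCtx}, WfL i Ψ Γ →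
      GSub.IsIdCtx Ψ σ → Γ.gsub σ = Γ
    | .nil, _, _, _, _, _ => by simp
    | .var g, _, _, _, h, hσ => by cases h with | var _ hg => simpa using hσ g hg
    | .snoc Γ T, _, _, _, h, hσ => by
        cases h with | snoc hΓ hT => simp [hΓ.gsub_id hσ, hT.gsub_id hσ]
end

theorem GSub.isIdCtx_idOf (Ψ : GCtx) : GSub.IsIdCtx Ψ (GSub.idOf Ψ) := fun g hg => by
  simp [GSub.lookupCtx, hg.getElem?_idOf_ctx]

theorem WfT.gsub_idOf {T : Ty} {i : Layer} {Ψ : GCtx} (h : WfT i Ψ T) :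
    T.gsub (GSub.idOf Ψ) = T := h.gsub_id (GSub.isIdCtx_idOf Ψ)

theorem WfL.gsub_idOf {Γ : LCtx} {i : Layer} {Ψ : GCtx} (h : WfL i Ψ Γ) :
    Γ.gsub (GSub.idOf Ψ) = Γ := h.gsub_id (GSub.isIdCtx_idOf Ψ)

theorem GSub.lookupCtx_idOf (Ψ : GCtx) (n : ℕ) :
    (HasG Ψ n .ctx ∧ GSub.lookupCtx (GSub.idOf Ψ) n = .var n) ∨
      ((¬ ∃ Γ, (GSub.idOf Ψ)[n]? = some (.ctx Γ)) ∧ GSub.lookupCtx (GSub.idOf Ψ) n = .nil) := by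
  rcases Nat.lt_or_ge n Ψ.length with hn | hn
  · obtain ⟨B, hB⟩ := HasG.exists_of_lt hn
    cases B with
    | ctx => exact .inl ⟨hB, GSub.isIdCtx_idOf Ψ n hB⟩
    | code Γ T => right; simp [GSub.lookupCtx, hB.getElem?_idOf_code]
  · right; simp [GSub.lookupCtx, GSub.getElem?_idOf_of_le hn]

theorem GSub.wfCtx_idOf {Ψ : GCtx} (h : WfG Ψ) : GSub.WfCtx Ψ (GSub.idOf Ψ) := fun n => by
  rcases GSub.lookupCtx_idOf Ψ n with ⟨hn, he⟩ | ⟨_, he⟩ <;> rw [he]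
  · exact .var h hn
  · exact .nil h

/-! ### Typing: weakening and presuppositions -/

mutual
  -- Every rule of layer `0` is also a rule of layer `1`. This is what lets code be run: `u^δ` may
  -- occur at layer `1` although `u` stands for layer-`0` code.
  theorem TmTy.lift : ∀ {t : Tm} {Ψ : GCtx} {Γ : LCtx} {T : Ty}, TmTy .zero Ψ Γ t T →
      ∀ i, TmTy i Ψ Γ t T
    | .var x, _, _, _, h, i => by cases h with | var h hx => exact .var (h.lift i) hx
    | .gvar u δ, _, _, _, h, i => by cases h with | gvar h hu => exact .gvar (h.lift i) hu
    | .zero, _, _, _, h, i => by cases h with | zero h => exact .zero (h.lift i)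
    | .succ t, _, _, _, h, i => by cases h with | succ h => exact .succ (h.lift i)
    | .box t, _, _, _, h, i => by cases h
    | .letbox s t, _, _, _, h, i => by cases h
    | .lam t, _, _, _, h, i => by cases h with | lam h => exact .lam (h.lift i)
    | .app t s, _, _, _, h, i => by cases h with | app h h' => exact .app (h.lift i) (h'.lift i)
    | .mlam t, _, _, _, h, i => by cases h
    | .mapp t Γ, _, _, _, h, i => by cases h
  theorem LSubTy.lift : ∀ {δ : LSub} {Ψ : GCtx} {Γ Δ : LCtx}, LSubTy .zero Ψ Γ δ Δ →
      ∀ i, LSubTy i Ψ Γ δ Δ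
    | .emp g m, _, _, _, h, i => by
        cases h with
        | emp h hb => exact .emp (h.lift i) hb
        | empVar h hg hb => exact .empVar (h.lift i) hg hb
    | .wk g m, _, _, _, h, i => by cases h with | wk h hg hb => exact .wk (h.lift i) hg hb
    | .snoc δ t, _, _, _, h, i => by
        cases h with | snoc h h' => exact .snoc (h.lift i) (h'.lift i)
end

theorem TmTy.toOne {i : Layer} {t : Tm} {Ψ : GCtx} {Γ : LCtx} {T : Ty} (h : TmTy i Ψ Γ t T) :
    TmTy .one Ψ Γ t T := by
  cases i
  · exact h.lift _
  · exact h

mutual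
  theorem TmTy.gwk : ∀ {t : Tm} {i : Layer} {Φ Ψ : GCtx} {Γ : LCtx} {T : Ty} {γ : Wk},
      TmTy i Ψ Γ t T → GWk γ Φ Ψ → TmTy i Φ (Γ.gwk γ) (t.gwk γ) (T.gwk γ)
    | .var x, _, _, _, _, _, _, h, hγ => by
        cases h with | var h hx => exact .var (h.gwk hγ) (hx.gwk _)
    | .gvar u δ, _, _, _, _, _, _, h, hγ => by
        cases h with | gvar h hu => exact .gvar (h.gwk hγ) (hu.gwk hγ)
    | .zero, _, _, _, _, _, _, h, hγ => by cases h with | zero h => exact .zero (h.gwk hγ)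
    | .succ t, _, _, _, _, _, _, h, hγ => by cases h with | succ h => exact .succ (h.gwk hγ)
    | .box t, _, _, _, _, _, _, h, hγ => by
        cases h with | box h h' => exact .box (h.gwk hγ) (h'.gwk hγ)
    | .letbox s t, _, _, _, _, _, _, h, hγ => by
        cases h with
        | letbox h hΔ hT hT' h' =>
          have := h'.gwk (hγ.qCode hΔ hT)
          rw [LCtx.gwk_p_q, Ty.gwk_p_q] at this
          exact .letbox (h.gwk hγ) (hΔ.gwk hγ) (hT.gwk hγ) (hT'.gwk hγ) this
    | .lam t, _, _, _, _, _, _, h, hγ => by cases h with | lam h => exact .lam (h.gwk hγ)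
    | .app t s, _, _, _, _, _, _, h, hγ => by
        cases h with | app h h' => exact .app (h.gwk hγ) (h'.gwk hγ)
    | .mlam t, _, _, _, _, _, _, h, hγ => by
        cases h with
        | mlam hΓ h =>
          have := h.gwk hγ.qCtx
          rw [LCtx.gwk_p_q] at this
          exact .mlam (hΓ.gwk hγ) this
    | .mapp t Γ, _, _, _, _, _, _, h, hγ => by
        cases h with
        | mapp h h' =>
          rw [Ty.gsub_ctx_idOf_gwk hγ]
          exact .mapp (h.gwk hγ) (h'.gwk hγ)
  theorem LSubTy.gwk : ∀ {δ : LSub} {i : Layer} {Φ Ψ : GCtx} {Γ Δ : LCtx} {γ : Wk},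
      LSubTy i Ψ Γ δ Δ → GWk γ Φ Ψ → LSubTy i Φ (Γ.gwk γ) (δ.gwk γ) (Δ.gwk γ)
    | .emp g m, _, _, _, Γ, _, γ, h, hγ => by
        cases h with
        | emp h hb =>
          rw [← Γ.len_gwk γ]
          exact .emp (h.gwk hγ) (by simp [hb])
        | empVar h hg hb =>
          rw [← Γ.len_gwk γ]
          exact .empVar (h.gwk hγ) (hg.gwk hγ) (by simp [hb])
    | .wk g m, _, _, _, Γ, _, γ, h, hγ => by
        cases h with
        | wk h hg hb =>
          rw [← Γ.len_gwk γ]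
          exact .wk (h.gwk hγ) (hg.gwk hγ) (by simp [hb])
    | .snoc δ t, _, _, _, _, _, _, h, hγ => by
        cases h with | snoc h h' => exact .snoc (h.gwk hγ) (h'.gwk hγ)
end

mutual
  theorem TmTy.wf : ∀ {t : Tm} {i : Layer} {Ψ : GCtx} {Γ : LCtx} {T : Ty},
      TmTy i Ψ Γ t T → WfL i Ψ Γ ∧ WfT i Ψ T
    | .var x, _, _, _, _, h => by cases h with | var h hx => exact ⟨h, hx.wfT h⟩
    | .gvar u δ, _, _, _, _, h => by
        cases h with | gvar h hu => exact ⟨h.wf.1, (hu.wfT h.wf.1.wfG).lift _⟩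
    | .zero, _, _, _, _, h => by cases h with | zero h => exact ⟨h, .nat h.wfG⟩
    | .succ t, _, _, _, _, h => by cases h with | succ h => exact h.wf
    | .box t, _, _, _, _, h => by cases h with | box h h' => exact ⟨h, .box h'.wf.1 h'.wf.2⟩
    | .letbox s t, _, _, _, _, h => by cases h with | letbox h _ _ hT' _ => exact ⟨h.wf.1, hT'⟩
    | .lam t, _, _, _, _, h => by
        cases h with
        | lam h =>
          cases h.wf.1 with | snoc hΓ hS => exact ⟨hΓ, .arr hS h.wf.2⟩
    | .app t s, _, _, _, _, h => by
        cases h with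
        | app h h' => cases h.wf.2 with | arr _ hT => exact ⟨h.wf.1, hT⟩
    | .mlam t, _, _, _, _, h => by cases h with | mlam hΓ h => exact ⟨hΓ, .pi h.wf.2⟩
    | .mapp t Γ, _, _, _, _, h => by
        cases h with
        | mapp h hΔ =>
          cases h.wf.2 with
          | pi hT => exact ⟨h.wf.1, hT.gsub ((GSub.wfCtx_idOf hΔ.wfG).consCtx hΔ)⟩
  theorem LSubTy.wf : ∀ {δ : LSub} {i : Layer} {Ψ : GCtx} {Γ Δ : LCtx},
      LSubTy i Ψ Γ δ Δ → WfL i Ψ Γ ∧ WfL i Ψ Δ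
    | .emp g m, _, _, _, _, h => by
        cases h with
        | emp h hb => exact ⟨h, .nil h.wfG⟩
        | empVar h hg hb => exact ⟨h, .nil h.wfG⟩
    | .wk g m, _, _, _, _, h => by cases h with | wk h hg hb => exact ⟨h, .var h.wfG hg⟩
    | .snoc δ t, _, _, _, _, h => by
        cases h with | snoc h h' => exact ⟨h.wf.1, .snoc h.wf.2 h'.wf.2⟩
end

theorem LSubTy.emp_base {i : Layer} {Ψ : GCtx} {Γ : LCtx} (h : WfL i Ψ Γ) :
    LSubTy i Ψ Γ (.emp Γ.base Γ.len) .nil := by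
  rcases hb : Γ.base with _ | g
  · exact .emp h hb
  · exact .empVar h (h.hasG_base hb) hb

mutual
  theorem TmTy.lwk : ∀ {t : Tm} {i : Layer} {Ψ : GCtx} {Γ Δ : LCtx} {T : Ty} {τ : Wk},
      TmTy i Ψ Γ t T → LWk i Ψ τ Δ Γ → TmTy i Ψ Δ (t.lwk τ) T
    | .var x, _, _, _, _, _, _, h, hτ => by
        cases h with | var h hx => exact .var hτ.wfL_left (hx.lwk hτ)
    | .gvar u δ, _, _, _, _, _, _, h, hτ => by
        cases h with | gvar h hu => exact .gvar (h.lwk hτ) hu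
    | .zero, _, _, _, _, _, _, h, hτ => by cases h with | zero h => exact .zero hτ.wfL_left
    | .succ t, _, _, _, _, _, _, h, hτ => by cases h with | succ h => exact .succ (h.lwk hτ)
    | .box t, _, _, _, _, _, _, h, hτ => by
        cases h with | box h h' => exact .box hτ.wfL_left h'
    | .letbox s t, _, _, _, _, _, _, h, hτ => by
        cases h with
        | letbox h hΔ hT hT' h' =>
          exact .letbox (h.lwk hτ) hΔ hT hT' (h'.lwk (hτ.gwk (.pId (.code hΔ hT))))
    | .lam t, _, _, _, _, _, _, h, hτ => by
        cases h with
        | lam h =>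
          cases h.wf.1 with | snoc _ hS => exact .lam (h.lwk (.q hτ hS))
    | .app t s, _, _, _, _, _, _, h, hτ => by
        cases h with | app h h' => exact .app (h.lwk hτ) (h'.lwk hτ)
    | .mlam t, _, _, _, _, _, _, h, hτ => by
        cases h with
        | mlam hΓ h => exact .mlam hτ.wfL_left (h.lwk (hτ.gwk (.pId (.ctx hΓ.wfG))))
    | .mapp t Γ, _, _, _, _, _, _, h, hτ => by
        cases h with | mapp h h' => exact .mapp (h.lwk hτ) h'
  theorem LSubTy.lwk : ∀ {δ : LSub} {i : Layer} {Ψ : GCtx} {Γ Δ Γ' : LCtx} {τ : Wk},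
      LSubTy i Ψ Γ δ Δ → LWk i Ψ τ Γ' Γ → LSubTy i Ψ Γ' (δ.lwk τ) Δ
    | .emp g m, _, _, _, _, _, _, h, hτ => by
        cases h with
        | emp h hb =>
          rw [LSub.lwk, ← hτ.len_eq]
          exact .emp hτ.wfL_left (by rw [hτ.base_eq, hb])
        | empVar h hg hb =>
          rw [LSub.lwk, ← hτ.len_eq]
          exact .empVar hτ.wfL_left hg (by rw [hτ.base_eq, hb])
    | .wk g m, _, _, _, _, _, _, h, hτ => by
        cases h with
        | wk h hg hb =>
          rw [LSub.lwk, ← hτ.len_eq]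
          exact .wk hτ.wfL_left hg (by rw [hτ.base_eq, hb])
    | .snoc δ t, _, _, _, _, _, _, h, hτ => by
        cases h with | snoc h h' => exact .snoc (h.lwk hτ) (h'.lwk hτ)
end

/-! ### Typing: local substitution -/

theorem LSubTy.idOf : ∀ {Γ : LCtx} {i : Layer} {Ψ : GCtx}, WfL i Ψ Γ →
    LSubTy i Ψ Γ (LSub.idOf Γ) Γ
  | .nil, _, _, h => .emp (Γ := .nil) h rfl
  | .var g, _, _, h => by cases h with | var h hg => exact .wk (Γ := .var g) (.var h hg) hg rfl
  | .snoc Γ T, _, _, h => by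
      rw [LSub.idOf_snoc]
      cases h with
      | snoc hΓ hT =>
        exact .snoc ((LSubTy.idOf hΓ).lwk (.pId hΓ hT)) (.var (.snoc hΓ hT) .here)

theorem LSubTy.fits : ∀ {δ : LSub} {i : Layer} {Ψ : GCtx} {Γ Δ : LCtx}, LSubTy i Ψ Γ δ Δ →
    δ.Fits Δ
  | .emp _ _, _, _, _, _, h => by cases h <;> exact .nil
  | .wk _ _, _, _, _, _, h => by cases h; exact .var
  | .snoc δ _, _, _, _, _, h => by cases h with | snoc h _ => exact .snoc h.fits

theorem LSubTy.hat_eq : ∀ {δ : LSub} {i : Layer} {Ψ : GCtx} {Γ Δ : LCtx}, LSubTy i Ψ Γ δ Δ →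
    δ.hat = Γ.len
  | .emp _ _, _, _, _, _, h => by cases h <;> rfl
  | .wk _ _, _, _, _, _, h => by cases h; rfl
  | .snoc δ _, _, _, _, _, h => by cases h with | snoc h _ => exact h.hat_eq

theorem LSubTy.chk_eq : ∀ {δ : LSub} {i : Layer} {Ψ : GCtx} {Γ Δ : LCtx}, LSubTy i Ψ Γ δ Δ →
    δ.chk = Γ.base
  | .emp _ _, _, _, _, _, h => by cases h <;> simp [*]
  | .wk _ _, _, _, _, _, h => by cases h; simp [*]
  | .snoc δ _, _, _, _, _, h => by cases h with | snoc h _ => exact h.chk_eq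

theorem LSubTy.base_eq : ∀ {δ : LSub} {i : Layer} {Ψ : GCtx} {Γ Δ : LCtx} {g : ℕ},
    LSubTy i Ψ Γ δ Δ → Δ.base = some g → Γ.base = some g
  | .emp _ _, _, _, _, _, _, h, hb => by cases h <;> simp at hb
  | .wk _ _, _, _, _, _, _, h, hb => by cases h; simp_all
  | .snoc δ _, _, _, _, _, _, h, hb => by cases h with | snoc h _ => exact h.base_eq (by simpa using hb)

theorem LSubTy.lookup {Γ : LCtx} {x : ℕ} {T : Ty} (hx : HasL Γ x T) :
    ∀ {δ : LSub} {i : Layer} {Ψ : GCtx} {Δ : LCtx}, LSubTy i Ψ Δ δ Γ →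
      TmTy i Ψ Δ (δ.lookup x) T := by
  induction hx with
  | here => intro δ i Ψ Δ h; cases h with | snoc h h' => exact h'
  | there _ ih => intro δ i Ψ Δ h; cases h with | snoc h h' => exact ih h

theorem LSubTy.q {i : Layer} {Ψ : GCtx} {Γ Δ : LCtx} {δ : LSub} {S : Ty}
    (h : LSubTy i Ψ Δ δ Γ) (hS : WfT i Ψ S) :
    LSubTy i Ψ (.snoc Δ S) (.snoc (δ.lwk (.p .id)) (.var 0)) (.snoc Γ S) :=
  .snoc (h.lwk (.pId h.wf.1 hS)) (.var (.snoc h.wf.1 hS) .here)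

mutual
  theorem TmTy.lsub : ∀ {t : Tm} {i : Layer} {Ψ : GCtx} {Γ Δ : LCtx} {T : Ty} {δ : LSub},
      TmTy i Ψ Γ t T → LSubTy i Ψ Δ δ Γ → TmTy i Ψ Δ (t.lsub δ) T
    | .var x, _, _, _, _, _, _, h, hδ => by cases h with | var _ hx => exact hδ.lookup hx
    | .gvar u δ, _, _, _, _, _, _, h, hδ => by
        cases h with | gvar h hu => exact .gvar (h.comp hδ) hu
    | .zero, _, _, _, _, _, _, h, hδ => by cases h with | zero h => exact .zero hδ.wf.1
    | .succ t, _, _, _, _, _, _, h, hδ => by cases h with | succ h => exact .succ (h.lsub hδ)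
    | .box t, _, _, _, _, _, _, h, hδ => by
        cases h with | box h h' => exact .box hδ.wf.1 h'
    | .letbox s t, _, _, _, _, _, _, h, hδ => by
        cases h with
        | letbox h hΔ hT hT' h' =>
          exact .letbox (h.lsub hδ) hΔ hT hT' (h'.lsub (hδ.gwk (.pId (.code hΔ hT))))
    | .lam t, _, _, _, _, _, _, h, hδ => by
        cases h with
        | lam h => cases h.wf.1 with | snoc _ hS => exact .lam (h.lsub (hδ.q hS))
    | .app t s, _, _, _, _, _, _, h, hδ => by
        cases h with | app h h' => exact .app (h.lsub hδ) (h'.lsub hδ)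
    | .mlam t, _, _, _, _, _, _, h, hδ => by
        cases h with
        | mlam hΓ h => exact .mlam hδ.wf.1 (h.lsub (hδ.gwk (.pId (.ctx hΓ.wfG))))
    | .mapp t Γ, _, _, _, _, _, _, h, hδ => by
        cases h with | mapp h h' => exact .mapp (h.lsub hδ) h'
  theorem LSubTy.comp : ∀ {δ' : LSub} {i : Layer} {Ψ : GCtx} {Γ Δ Γ' : LCtx} {δ : LSub},
      LSubTy i Ψ Γ δ' Γ' → LSubTy i Ψ Δ δ Γ → LSubTy i Ψ Δ (δ'.comp δ) Γ'
    | .emp none m, _, _, _, _, _, _, h, hδ => by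
        cases h with
        | emp h hb =>
          rw [LSub.comp, hδ.chk_eq, hδ.hat_eq]
          exact .emp_base hδ.wf.1
    | .emp (some g) m, _, _, _, _, _, _, h, hδ => by
        cases h with
        | empVar h hg hb =>
          rw [LSub.comp, hδ.hat_eq]
          exact .empVar hδ.wf.1 hg (hδ.base_eq hb)
    | .wk g m, _, _, _, _, _, _, h, hδ => by
        cases h with
        | wk h hg hb =>
          rw [LSub.comp, hδ.hat_eq]
          exact .wk hδ.wf.1 hg (hδ.base_eq hb)
    | .snoc δ t, _, _, _, _, _, _, h, hδ => by
        cases h with | snoc h h' => exact .snoc (h.comp hδ) (h'.lsub hδ)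
end

theorem TmTy.lsub_one {t s : Tm} {i : Layer} {Ψ : GCtx} {Γ : LCtx} {S T : Ty}
    (h : TmTy i Ψ (.snoc Γ S) t T) (hs : TmTy i Ψ Γ s S) :
    TmTy i Ψ Γ (t.lsub (.snoc (LSub.idOf Γ) s)) T :=
  h.lsub (.snoc (.idOf hs.wf.1) hs)

/-! ### Typing: global substitution -/

/-- Well-typed global substitutions `Φ ⊢ σ : Ψ`. -/
inductive GSubTy (Φ : GCtx) : GSub → GCtx → Prop
  | nil : WfG Φ → GSubTy Φ [] []
  | ctx {σ : GSub} {Ψ : GCtx} {Γ : LCtx} :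
      GSubTy Φ σ Ψ → WfL .zero Φ Γ → GSubTy Φ (.ctx Γ :: σ) (.ctx :: Ψ)
  | tm {σ : GSub} {Ψ : GCtx} {Γ : LCtx} {T : Ty} {t : Tm} :
      GSubTy Φ σ Ψ → TmTy .zero Φ (Γ.gsub σ) t (T.gsub σ) →
      GSubTy Φ (.tm t :: σ) (.code Γ T :: Ψ)
  | bv {σ : GSub} {Ψ : GCtx} {Γ : LCtx} {T : Ty} {v : ℕ} :
      GSubTy Φ σ Ψ → HasG Φ v (.code (Γ.gsub σ) (T.gsub σ)) →
      GSubTy Φ (.bv v :: σ) (.code Γ T :: Ψ)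

theorem GSubTy.wfG {Φ Ψ : GCtx} {σ : GSub} (h : GSubTy Φ σ Ψ) : WfG Φ := by
  induction h with
  | nil h => exact h
  | ctx _ _ ih => exact ih
  | tm _ _ ih => exact ih
  | bv _ _ ih => exact ih

theorem GSubTy.wfCtx {Φ Ψ : GCtx} {σ : GSub} (h : GSubTy Φ σ Ψ) : GSub.WfCtx Φ σ := by
  induction h with
  | nil h => intro n; simpa [GSub.lookupCtx] using .nil h
  | ctx _ hΓ ih => exact ih.consCtx hΓ
  | tm _ h ih =>
    rintro (_ | n)
    · simpa [GSub.lookupCtx] using .nil h.wf.1.wfG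
    · simpa using ih n
  | bv h _ ih =>
    rintro (_ | n)
    · simpa [GSub.lookupCtx] using .nil h.wfG
    · simpa using ih n

theorem GSubTy.gwk {Φ Φ' Ψ : GCtx} {σ : GSub} {γ : Wk} (h : GSubTy Φ σ Ψ) (hγ : GWk γ Φ' Φ) :
    GSubTy Φ' (GSub.gwk σ γ) Ψ := by
  induction h with
  | nil h => exact .nil hγ.wfG_left
  | ctx _ hΓ ih => exact .ctx ih (hΓ.gwk hγ)
  | tm _ h ih =>
    have := h.gwk hγ
    rw [LCtx.gsub_gwk, Ty.gsub_gwk] at this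
    exact .tm ih this
  | bv _ h ih =>
    have := h.gwk hγ
    rw [GBind.gwk_code, LCtx.gsub_gwk, Ty.gsub_gwk] at this
    exact .bv ih this

theorem GSubTy.qCtx {Φ Ψ : GCtx} {σ : GSub} (h : GSubTy Φ σ Ψ) :
    GSubTy (.ctx :: Φ) (GSub.qCtx σ) (.ctx :: Ψ) :=
  .ctx (h.gwk (.pId (.ctx h.wfG))) (.var (.ctx h.wfG) .here)

/-- The entry for the bound variable has to be `v^id/u`: the syntax of `letbox` does not record the
local context over which a term `u^id` would be formed. -/
theorem GSubTy.qTm {Φ Ψ : GCtx} {σ : GSub} {Δ : LCtx} {T : Ty} (h : GSubTy Φ σ Ψ)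
    (hΔ : WfL .zero Ψ Δ) (hT : WfT .zero Ψ T) :
    GSubTy (.code (Δ.gsub σ) (T.gsub σ) :: Φ) (GSub.qTm σ) (.code Δ T :: Ψ) := by
  refine .bv (h.gwk (.pId (.code (hΔ.gsub h.wfCtx) (hT.gsub h.wfCtx)))) ?_
  rw [← LCtx.gsub_gwk, ← Ty.gsub_gwk]
  exact .here

theorem GSubTy.code_cases {Φ Ψ : GCtx} {σ : GSub} (h : GSubTy Φ σ Ψ) :
    ∀ {u : ℕ} {Δ : LCtx} {T : Ty}, HasG Ψ u (.code Δ T) →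
      (∃ t, σ[u]? = some (.tm t) ∧ TmTy .zero Φ (Δ.gsub σ) t (T.gsub σ)) ∨
      (∃ v, σ[u]? = some (.bv v) ∧ HasG Φ v (.code (Δ.gsub σ) (T.gsub σ))) := by
  induction h with
  | nil h => intro u Δ T hu; cases hu
  | ctx _ hΓ ih =>
    rintro (_ | u) Δ T hu
    · cases hu.eq_of_zero
    · obtain ⟨Δ, T, rfl, rfl, hu'⟩ := hu.code_of_succ
      simpa using ih hu'
  | tm _ h ih =>
    rintro (_ | u) Δ T hu
    · cases hu.eq_of_zero
      left; simpa using h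
    · obtain ⟨Δ, T, rfl, rfl, hu'⟩ := hu.code_of_succ
      simpa using ih hu'
  | bv _ h ih =>
    rintro (_ | u) Δ T hu
    · cases hu.eq_of_zero
      right; simpa using h
    · obtain ⟨Δ, T, rfl, rfl, hu'⟩ := hu.code_of_succ
      simpa using ih hu'

theorem GSubTy.composesCtx_idOf_left {Φ Ψ : GCtx} {σ : GSub} (h : GSubTy Φ σ Ψ) :
    GSub.ComposesCtx (GSub.idOf Ψ) σ σ := by
  intro n
  rcases Nat.lt_or_ge n Ψ.length with hn | hn
  · obtain ⟨B, hB⟩ := HasG.exists_of_lt hn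
    cases B with
    | ctx => simp [GSub.isIdCtx_idOf Ψ n hB]
    | code Δ T =>
      rcases h.code_cases hB with ⟨t, ht, _⟩ | ⟨v, hv, _⟩ <;>
        simp [GSub.lookupCtx, hB.getElem?_idOf_code, *]
  · have hl : σ.length = Ψ.length := by
      clear hn; induction h <;> simp_all
    simp [GSub.lookupCtx, GSub.getElem?_idOf_of_le hn, List.getElem?_eq_none (hl ▸ hn)]

theorem GSub.ComposesCtx.consCtx {σ σ' σ'' : GSub} (h : GSub.ComposesCtx σ σ' σ'') (Δ : LCtx) :
    GSub.ComposesCtx (.ctx Δ :: σ) σ' (.ctx (Δ.gsub σ') :: σ'')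
  | 0 => by simp
  | n + 1 => by simpa using h n

/-- The entries of `σ` must be well-formed because `id_Φ` fixes only contexts whose context
variables are bound in `Φ`; unbound ones would collapse to the empty context. -/
theorem GSub.WfCtx.composesCtx_qCtx {Φ : GCtx} {σ : GSub} (h : GSub.WfCtx Φ σ) (Δ : LCtx) :
    GSub.ComposesCtx (GSub.qCtx σ) (.ctx Δ :: GSub.idOf Φ) (.ctx Δ :: σ)
  | 0 => by simp [GSub.qCtx]
  | n + 1 => by simp [GSub.qCtx, GSub.lookupCtx_gwk, (h n).gsub_idOf]

theorem GSubTy.gsub_ctx_idOf {Φ Ψ : GCtx} {σ : GSub} (h : GSubTy Φ σ Ψ) (T : Ty) (Δ : LCtx) :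
    (T.gsub (.ctx Δ :: GSub.idOf Ψ)).gsub σ = T.gsub (.ctx (Δ.gsub σ) :: σ) :=
  T.gsub_gsub (h.composesCtx_idOf_left.consCtx Δ)

theorem GSub.WfCtx.gsub_qCtx {Φ : GCtx} {σ : GSub} (h : GSub.WfCtx Φ σ) (T : Ty) (Δ : LCtx) :
    (T.gsub (GSub.qCtx σ)).gsub (.ctx Δ :: GSub.idOf Φ) = T.gsub (.ctx Δ :: σ) :=
  T.gsub_gsub (h.composesCtx_qCtx Δ)

theorem LCtx.len_gsub_of_base_none : ∀ {Γ : LCtx} (σ : GSub), Γ.base = none →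
    (Γ.gsub σ).len = Γ.len ∧ (Γ.gsub σ).base = none
  | .nil, _, _ => by simp
  | .var _, _, h => by simp at h
  | .snoc Γ _, σ, h => by
      have := LCtx.len_gsub_of_base_none (Γ := Γ) σ (by simpa using h)
      simpa using this

theorem LCtx.len_gsub_of_base_some : ∀ {Γ : LCtx} (σ : GSub) {g : ℕ}, Γ.base = some g →
    (Γ.gsub σ).len = (GSub.lookupCtx σ g).len + Γ.len ∧
      (Γ.gsub σ).base = (GSub.lookupCtx σ g).base
  | .nil, _, _, h => by simp at h
  | .var _, _, _, h => by simp at h; simp [h]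
  | .snoc Γ _, σ, _, h => by
      have := LCtx.len_gsub_of_base_some (Γ := Γ) σ (by simpa using h)
      simp [this, Nat.add_assoc]

/-- Local weakening substitutions onto the context at the base of `Γ`. -/
theorem LSubTy.wkOf_base : ∀ {Γ : LCtx} {i : Layer} {Φ Ψ : GCtx} {σ : GSub} {g : ℕ},
    WfL i Ψ Γ → GSub.WfCtx Φ σ → Γ.base = some g →
    LSubTy i Φ (Γ.gsub σ) (LSub.wkOf Γ.len (GSub.lookupCtx σ g)) (GSub.lookupCtx σ g)
  | .nil, _, _, _, _, _, _, _, hb => by simp at hb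
  | .var _, i, _, _, _, _, _, hσ, hb => by
      simp at hb; subst hb
      exact LSubTy.idOf ((hσ _).lift i)
  | .snoc Γ T, _, _, _, _, _, h, hσ, hb => by
      cases h with
      | snoc hΓ hT =>
        have := (LSubTy.wkOf_base hΓ hσ (by simpa using hb)).lwk
          (.pId (hΓ.gsub hσ) (hT.gsub hσ))
        have e := LSub.wkOf_lwk_pn Γ.len 1
        simp only [Wk.pn] at e
        rw [e] at this
        exact this

mutual
  theorem TmTy.gsub : ∀ {t : Tm} {i : Layer} {Φ Ψ : GCtx} {Γ : LCtx} {T : Ty} {σ : GSub},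
      TmTy i Ψ Γ t T → GSubTy Φ σ Ψ → TmTy i Φ (Γ.gsub σ) (t.gsub σ) (T.gsub σ)
    | .var x, _, _, _, _, _, _, h, hσ => by
        cases h with | var h hx => exact .var (h.gsub hσ.wfCtx) (hx.gsub _)
    | .gvar u δ, i, _, _, _, _, _, h, hσ => by
        cases h with
        | gvar h hu =>
          -- An entry with code is typed at layer `0`; it is lifted to the layer of `δ` and then
          -- instantiated by `δ[σ]`. An entry `v^id` just renames `u`.
          rcases hσ.code_cases hu with ⟨t, ht, h'⟩ | ⟨v, hv, h'⟩
          · simp only [Tm.gsub, GSub.appVar, ht]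
            exact (h'.lift i).lsub (h.gsub hσ)
          · simp only [Tm.gsub, GSub.appVar, hv]
            exact .gvar (h.gsub hσ) h'
    | .zero, _, _, _, _, _, _, h, hσ => by cases h with | zero h => exact .zero (h.gsub hσ.wfCtx)
    | .succ t, _, _, _, _, _, _, h, hσ => by cases h with | succ h => exact .succ (h.gsub hσ)
    | .box t, _, _, _, _, _, _, h, hσ => by
        cases h with | box h h' => exact .box (h.gsub hσ.wfCtx) (h'.gsub hσ)
    | .letbox s t, _, _, _, _, _, _, h, hσ => by
        cases h with
        | letbox h hΔ hT hT' h' =>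
          have := h'.gsub (hσ.qTm hΔ hT)
          rw [LCtx.gwk_p_gsub_qTm, Ty.gwk_p_gsub_qTm] at this
          exact .letbox (h.gsub hσ) (hΔ.gsub hσ.wfCtx) (hT.gsub hσ.wfCtx) (hT'.gsub hσ.wfCtx) this
    | .lam t, _, _, _, _, _, _, h, hσ => by cases h with | lam h => exact .lam (h.gsub hσ)
    | .app t s, _, _, _, _, _, _, h, hσ => by
        cases h with | app h h' => exact .app (h.gsub hσ) (h'.gsub hσ)
    | .mlam t, _, _, _, _, _, _, h, hσ => by
        cases h with
        | mlam hΓ h =>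
          have := h.gsub hσ.qCtx
          rw [LCtx.gwk_p_gsub_qCtx] at this
          exact .mlam (hΓ.gsub hσ.wfCtx) this
    | .mapp t Γ, _, _, _, _, _, _, h, hσ => by
        cases h with
        | mapp h h' =>
          rw [hσ.gsub_ctx_idOf, ← hσ.wfCtx.gsub_qCtx]
          exact .mapp (h.gsub hσ) (h'.gsub hσ.wfCtx)
  theorem LSubTy.gsub : ∀ {δ : LSub} {i : Layer} {Φ Ψ : GCtx} {Γ Δ : LCtx} {σ : GSub},
      LSubTy i Ψ Γ δ Δ → GSubTy Φ σ Ψ → LSubTy i Φ (Γ.gsub σ) (δ.gsub σ) (Δ.gsub σ)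
    | .emp none m, _, _, _, Γ, _, σ, h, hσ => by
        cases h with
        | emp h hb =>
          obtain ⟨h1, h2⟩ := LCtx.len_gsub_of_base_none σ hb
          rw [LSub.gsub, ← h1]
          exact .emp (h.gsub hσ.wfCtx) h2
    | .emp (some g) m, _, _, _, Γ, _, σ, h, hσ => by
        cases h with
        | empVar h hg hb =>
          obtain ⟨h1, h2⟩ := LCtx.len_gsub_of_base_some σ hb
          rw [LSub.gsub, ← h1, ← h2]
          exact .emp_base (h.gsub hσ.wfCtx)
    | .wk g m, _, _, _, Γ, _, _, h, hσ => by
        cases h with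
        | wk h hg hb =>
          rw [LSub.gsub, LSub.idOf_lwk_pn]
          exact .wkOf_base h hσ.wfCtx hb
    | .snoc δ t, _, _, _, _, _, _, h, hσ => by
        cases h with | snoc h h' => exact .snoc (h.gsub hσ) (h'.gsub hσ)
end

/-! ### Interaction of local and global substitution on well-typed terms -/

theorem GSub.appVar_lwk (σ : GSub) (u : ℕ) (δ : LSub) (τ : Wk) :
    (GSub.appVar σ u δ).lwk τ = GSub.appVar σ u (δ.lwk τ) := by
  simp only [GSub.appVar]
  rcases σ[u]? with _ | _ | _ | _ <;> simp [Tm.lsub_lwk]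

theorem GSub.appVar_lsub (σ : GSub) (u : ℕ) (δ ε : LSub) :
    (GSub.appVar σ u δ).lsub ε = GSub.appVar σ u (δ.comp ε) := by
  simp only [GSub.appVar]
  rcases σ[u]? with _ | _ | _ | _ <;> simp [Tm.lsub_lsub]

theorem LSub.wkOf_lwk : ∀ {m : ℕ} (Γ : LCtx) {τ : Wk},
    (∀ x, τ.act (x + m) = x + m + τ.count) → (LSub.wkOf m Γ).lwk τ = LSub.wkOf (m + τ.count) Γ
  | _, .nil, _, _ => by simp
  | _, .var _, _, _ => by simp
  | m, .snoc Γ T, τ, h => by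
      have h0 := h 0
      simp only [Nat.zero_add] at h0
      have := LSub.wkOf_lwk (m := m + 1) Γ (τ := τ) (fun x => by
        have := h (x + 1)
        rw [Nat.add_right_comm, Nat.add_assoc x] at this
        exact this)
      simp [this, h0, Nat.add_right_comm]

mutual
  -- This fails on raw syntax: `wk_g^m[σ]` lists variables from index `m` on, and `τ` shifts them by
  -- its count only past `|Γ|`. Typing gives `m = |Γ|`, where the hypothesis on `τ` applies.
  theorem TmTy.lwk_gsub : ∀ {t : Tm} {i : Layer} {Ψ : GCtx} {Γ : LCtx} {T : Ty} {τ : Wk}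
      {σ : GSub}, TmTy i Ψ Γ t T → (∀ x, τ.act (x + Γ.len) = x + Γ.len + τ.count) →
      (t.lwk τ).gsub σ = (t.gsub σ).lwk τ
    | .var x, _, _, _, _, _, _, _, _ => by simp
    | .gvar u δ, _, _, _, _, _, _, h, hτ => by
        cases h with | gvar h hu => simp [h.lwk_gsub hτ, GSub.appVar_lwk]
    | .zero, _, _, _, _, _, _, _, _ => by simp
    | .succ t, _, _, _, _, _, _, h, hτ => by cases h with | succ h => simp [h.lwk_gsub hτ]
    | .box t, _, _, _, _, _, _, h, hτ => by simp
    | .letbox s t, _, _, _, _, _, _, h, hτ => by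
        cases h with
        | letbox h hΔ hT hT' h' => simp [h.lwk_gsub hτ, h'.lwk_gsub (by simpa using hτ)]
    | .lam t, _, _, _, _, τ, σ, h, hτ => by
        cases h with
        | lam h =>
          have := h.lwk_gsub (τ := .q τ) (σ := σ) (fun x => by
            simp only [LCtx.len, ← Nat.add_assoc, Wk.act, hτ, Wk.count]; omega)
          simp [this]
    | .app t s, _, _, _, _, _, _, h, hτ => by
        cases h with | app h h' => simp [h.lwk_gsub hτ, h'.lwk_gsub hτ]
    | .mlam t, _, _, _, _, _, _, h, hτ => by
        cases h with | mlam hΓ h => simp [h.lwk_gsub (by simpa using hτ)]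
    | .mapp t Γ, _, _, _, _, _, _, h, hτ => by
        cases h with | mapp h h' => simp [h.lwk_gsub hτ]
  theorem LSubTy.lwk_gsub : ∀ {δ : LSub} {i : Layer} {Ψ : GCtx} {Γ Δ : LCtx} {τ : Wk}
      {σ : GSub}, LSubTy i Ψ Γ δ Δ → (∀ x, τ.act (x + Γ.len) = x + Γ.len + τ.count) →
      (δ.lwk τ).gsub σ = (δ.gsub σ).lwk τ
    | .emp none m, _, _, _, _, _, _, h, hτ => by simp
    | .emp (some g) m, _, _, _, _, _, _, h, hτ => by simp [Nat.add_assoc]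
    | .wk g m, _, _, _, _, _, _, h, hτ => by
        cases h with | wk h hg hb => simp [LSub.idOf_lwk_pn, LSub.wkOf_lwk _ hτ]
    | .snoc δ t, _, _, _, _, _, _, h, hτ => by
        cases h with | snoc h h' => simp [h.lwk_gsub hτ, h'.lwk_gsub hτ]
end

theorem LSubTy.lwk_p_gsub {δ : LSub} {i : Layer} {Ψ : GCtx} {Γ Δ : LCtx} (h : LSubTy i Ψ Γ δ Δ)
    (σ : GSub) : (δ.lwk (.p .id)).gsub σ = (δ.gsub σ).lwk (.p .id) :=
  h.lwk_gsub (fun x => by simp)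

theorem TmTy.lwk_p_gsub {t : Tm} {i : Layer} {Ψ : GCtx} {Γ : LCtx} {T : Ty} (h : TmTy i Ψ Γ t T)
    (σ : GSub) : (t.lwk (.p .id)).gsub σ = (t.gsub σ).lwk (.p .id) :=
  h.lwk_gsub (fun x => by simp)

theorem LSub.Fits.lookup_gsub {Γ : LCtx} {x : ℕ} {T : Ty} (hx : HasL Γ x T) :
    ∀ {δ : LSub} {σ : GSub}, δ.Fits Γ → (δ.lookup x).gsub σ = (δ.gsub σ).lookup x := by
  induction hx with
  | here => intro δ σ h; cases h; simp
  | there _ ih => intro δ σ h; cases h with | snoc h => simp [ih h]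

/-- A well-typed substitution into a context ending with `g` has the base `wk_g^{|Γ|}`, and `σ`
unfolds this base into `wk^{|Γ|}` of `σ(g)`. This settles the case of `wk` in `LSubTy.comp_gsub`. -/
theorem LSubTy.drop_gsub : ∀ {δ : LSub} {i : Layer} {Ψ : GCtx} {Γ Δ : LCtx} {g : ℕ}
    (σ : GSub), LSubTy i Ψ Γ δ Δ → Δ.base = some g →
    (δ.gsub σ).drop Δ.len = LSub.wkOf Γ.len (GSub.lookupCtx σ g)
  | .emp _ _, _, _, _, _, _, _, h, hb => by cases h <;> simp at hb
  | .wk _ _, _, _, _, _, _, _, h, hb => by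
      cases h; simp at hb; simp [LSub.drop, LSub.idOf_lwk_pn, hb]
  | .snoc δ t, _, _, _, _, _, σ, h, hb => by
      cases h with
      | snoc h _ => simpa [LSub.drop] using h.drop_gsub σ (by simpa using hb)

theorem LCtx.emp_base_gsub (Γ : LCtx) (σ : GSub) :
    (LSub.emp Γ.base Γ.len).gsub σ = .emp (Γ.gsub σ).base (Γ.gsub σ).len := by
  rcases hb : Γ.base with _ | g
  · simp [LCtx.len_gsub_of_base_none σ hb]
  · simp [LCtx.len_gsub_of_base_some σ hb]

mutual
  -- The difficulty is at the bases of local substitutions: both sides agree there because typing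
  -- makes `δ` carry the length and the end of its context, before and after applying `σ`.
  theorem TmTy.lsub_gsub : ∀ {t : Tm} {i : Layer} {Φ Ψ : GCtx} {Γ Δ : LCtx} {T : Ty} {δ : LSub}
      {σ : GSub}, TmTy i Ψ Γ t T → LSubTy i Ψ Δ δ Γ → GSubTy Φ σ Ψ →
      (t.lsub δ).gsub σ = (t.gsub σ).lsub (δ.gsub σ)
    | .var x, _, _, _, _, _, _, _, _, h, hδ, _ => by
        cases h with | var _ hx => simp [LSub.Fits.lookup_gsub hx hδ.fits]
    | .gvar u δ, _, _, _, _, _, _, _, _, h, hδ, hσ => by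
        cases h with | gvar h hu => simp [GSub.appVar_lsub, h.comp_gsub hδ hσ]
    | .zero, _, _, _, _, _, _, _, _, _, _, _ => by simp
    | .succ t, _, _, _, _, _, _, _, _, h, hδ, hσ => by
        cases h with | succ h => simp [h.lsub_gsub hδ hσ]
    | .box t, _, _, _, _, _, _, _, _, _, _, _ => by simp
    | .letbox s t, _, _, _, _, _, _, _, _, h, hδ, hσ => by
        cases h with
        | letbox h hΔ hT hT' h' =>
          simp [h.lsub_gsub hδ hσ,
            h'.lsub_gsub (hδ.gwk (.pId (.code hΔ hT))) (hσ.qTm hΔ hT), LSub.gwk_p_gsub_qTm]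
    | .lam t, _, _, _, _, _, _, _, _, h, hδ, hσ => by
        cases h with
        | lam h =>
          cases h.wf.1 with
          | snoc _ hS => simp [h.lsub_gsub (hδ.q hS) hσ, hδ.lwk_p_gsub]
    | .app t s, _, _, _, _, _, _, _, _, h, hδ, hσ => by
        cases h with | app h h' => simp [h.lsub_gsub hδ hσ, h'.lsub_gsub hδ hσ]
    | .mlam t, _, _, _, _, _, _, _, _, h, hδ, hσ => by
        cases h with
        | mlam hΓ h =>
          simp [h.lsub_gsub (hδ.gwk (.pId (.ctx hΓ.wfG))) hσ.qCtx, LSub.gwk_p_gsub_qCtx]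
    | .mapp t Γ, _, _, _, _, _, _, _, _, h, hδ, hσ => by
        cases h with | mapp h h' => simp [h.lsub_gsub hδ hσ]
  theorem LSubTy.comp_gsub : ∀ {δ' : LSub} {i : Layer} {Φ Ψ : GCtx} {Γ Δ Γ' : LCtx} {δ : LSub}
      {σ : GSub}, LSubTy i Ψ Γ δ' Γ' → LSubTy i Ψ Δ δ Γ → GSubTy Φ σ Ψ →
      (δ'.comp δ).gsub σ = (δ'.gsub σ).comp (δ.gsub σ)
    | .emp none m, _, _, _, _, _, _, _, _, h, hδ, hσ => by
        have hδ' := hδ.gsub hσ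
        simp only [LSub.comp, LSub.gsub, hδ'.chk_eq, hδ'.hat_eq, hδ.chk_eq, hδ.hat_eq,
          LCtx.emp_base_gsub]
    | .emp (some g) m, _, _, _, _, Δ, _, _, σ, h, hδ, hσ => by
        cases h with
        | empVar h hg hb =>
          have hδ' := hδ.gsub hσ
          have hl := LCtx.len_gsub_of_base_some σ (hδ.base_eq hb)
          rcases hb' : (GSub.lookupCtx σ g).base with _ | g'
          · simp [hδ'.chk_eq, hδ'.hat_eq, hδ.hat_eq, hl, hb']
          · simp [hδ'.hat_eq, hδ.hat_eq, hl, hb']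
    | .wk g m, _, _, _, _, _, _, _, σ, h, hδ, hσ => by
        cases h with
        | wk h hg hb =>
          have hd := hδ.drop_gsub σ hb
          simp only [LSub.comp, LSub.gsub, LSub.idOf_lwk_pn]
          rw [LSub.wkOf_comp, hd, hδ.hat_eq]
          rw [hd]; exact LSub.fits_wkOf _ _
    | .snoc δ t, _, _, _, _, _, _, _, _, h, hδ, hσ => by
        cases h with | snoc h h' => simp [h.comp_gsub hδ hσ, h'.lsub_gsub hδ hσ]
end

/-! ### Composition of global substitutions -/

/-- The fallback for `bv` keeps the entry when `σ` does not cover `u`; it is never reached when the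
substitutions are well typed and composable. -/
def GEntry.gsub (σ : GSub) : GEntry → GEntry
  | .tm t => .tm (t.gsub σ)
  | .ctx Γ => .ctx (Γ.gsub σ)
  | .bv u => σ[u]?.getD (.bv u)

/-- `σ` followed by `σ'`. -/
def GSub.comp (σ σ' : GSub) : GSub := σ.map (GEntry.gsub σ')

theorem GEntry.gwk_p_gsub (e e' : GEntry) (σ : GSub) :
    (e.gwk (.p .id)).gsub (e' :: GSub.gwk σ (.p .id)) = (e.gsub σ).gwk (.p .id) := by
  cases e with
  | tm t => simp [GEntry.gsub, Tm.gsub_gwk]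
  | ctx Γ => simp [GEntry.gsub, LCtx.gsub_gwk]
  | bv u =>
    simp only [GEntry.gsub, GEntry.gwk_bv, Wk.act, List.getElem?_cons_succ, GSub.getElem?_gwk]
    rcases σ[u]? with _ | _ <;> simp

theorem GSub.comp_gwk_p (σ σ' : GSub) (e' : GEntry) :
    GSub.comp (GSub.gwk σ (.p .id)) (e' :: GSub.gwk σ' (.p .id)) =
      GSub.gwk (GSub.comp σ σ') (.p .id) := by
  simp [GSub.comp, GSub.gwk, ← GEntry.gwk_p_gsub _ e']

theorem GSub.comp_qTm (σ σ' : GSub) :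
    GSub.comp (GSub.qTm σ) (GSub.qTm σ') = GSub.qTm (GSub.comp σ σ') := by
  rw [GSub.qTm, GSub.qTm, GSub.qTm, ← GSub.comp_gwk_p σ σ' (.bv 0)]
  rfl

theorem GSub.comp_qCtx (σ σ' : GSub) :
    GSub.comp (GSub.qCtx σ) (GSub.qCtx σ') = GSub.qCtx (GSub.comp σ σ') := by
  rw [GSub.qCtx, GSub.qCtx, GSub.qCtx, ← GSub.comp_gwk_p σ σ' (.ctx (.var 0))]
  simp [GSub.comp, GEntry.gsub]

theorem GSub.getElem?_comp (σ σ' : GSub) (n : ℕ) :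
    (GSub.comp σ σ')[n]? = σ[n]?.map (GEntry.gsub σ') := by
  simp [GSub.comp]

theorem GSubTy.ctx_cases {Φ Ψ : GCtx} {σ : GSub} (h : GSubTy Φ σ Ψ) :
    ∀ {g : ℕ}, HasG Ψ g .ctx → ∃ Γ, σ[g]? = some (.ctx Γ) ∧ WfL .zero Φ Γ := by
  induction h with
  | nil h => intro u hu; cases hu
  | ctx _ hΓ ih =>
    rintro (_ | u) hu
    · exact ⟨_, by simp, hΓ⟩
    · simpa using ih hu.ctx_of_succ
  | tm _ h ih =>
    rintro (_ | u) hu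
    · cases hu.eq_of_zero
    · simpa using ih hu.ctx_of_succ
  | bv _ h ih =>
    rintro (_ | u) hu
    · cases hu.eq_of_zero
    · simpa using ih hu.ctx_of_succ

theorem GSubTy.length_eq {Φ Ψ : GCtx} {σ : GSub} (h : GSubTy Φ σ Ψ) :
    σ.length = Ψ.length := by
  induction h <;> simp_all

theorem GSubTy.composesCtx {Φ Φ' Ψ : GCtx} {σ σ' : GSub} (h : GSubTy Φ σ Ψ)
    (h' : GSubTy Φ' σ' Φ) : GSub.ComposesCtx σ σ' (GSub.comp σ σ') := by
  intro n
  simp only [GSub.lookupCtx, GSub.getElem?_comp]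
  rcases Nat.lt_or_ge n Ψ.length with hn | hn
  · obtain ⟨B, hB⟩ := HasG.exists_of_lt hn
    cases B with
    | ctx =>
      obtain ⟨Γ, hΓ, _⟩ := h.ctx_cases hB
      simp [hΓ, GEntry.gsub]
    | code Δ T =>
      rcases h.code_cases hB with ⟨t, ht, _⟩ | ⟨v, hv, hv'⟩
      · simp [ht, GEntry.gsub]
      · rcases h'.code_cases hv' with ⟨t, ht, _⟩ | ⟨w, hw, _⟩ <;> simp [GEntry.gsub, *]
  · simp [List.getElem?_eq_none (h.length_eq ▸ hn)]

mutual
  -- Typing enters at `u^δ`: the first substitution produces code instantiated by `δ`, and the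
  -- second has to pass through that instance by `TmTy.lsub_gsub`.
  theorem TmTy.gsub_gsub : ∀ {t : Tm} {i : Layer} {Φ Φ' Ψ : GCtx} {Γ : LCtx} {T : Ty}
      {σ σ' : GSub}, TmTy i Ψ Γ t T → GSubTy Φ σ Ψ → GSubTy Φ' σ' Φ →
      (t.gsub σ).gsub σ' = t.gsub (GSub.comp σ σ')
    | .var x, _, _, _, _, _, _, _, _, _, _, _ => by simp
    | .gvar u δ, i, _, _, _, _, _, _, _, h, hσ, hσ' => by
        cases h with
        | gvar h hu =>
          have ih := h.gsub_gsub hσ hσ'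
          rcases hσ.code_cases hu with ⟨t, ht, h'⟩ | ⟨v, hv, h'⟩
          · simp [GSub.appVar, GSub.getElem?_comp, ht, GEntry.gsub,
              (h'.lift i).lsub_gsub (h.gsub hσ) hσ', ih]
          · rcases hσ'.code_cases h' with ⟨t, ht, _⟩ | ⟨w, hw, _⟩ <;>
              simp [GSub.appVar, GSub.getElem?_comp, GEntry.gsub, *]
    | .zero, _, _, _, _, _, _, _, _, _, _, _ => by simp
    | .succ t, _, _, _, _, _, _, _, _, h, hσ, hσ' => by
        cases h with | succ h => simp [h.gsub_gsub hσ hσ']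
    | .box t, _, _, _, _, _, _, _, _, h, hσ, hσ' => by
        cases h with | box _ h => simp [h.gsub_gsub hσ hσ']
    | .letbox s t, _, _, _, _, _, _, _, _, h, hσ, hσ' => by
        cases h with
        | letbox h hΔ hT hT' h' =>
          have := h'.gsub_gsub (hσ.qTm hΔ hT)
            (hσ'.qTm (hΔ.gsub hσ.wfCtx) (hT.gsub hσ.wfCtx))
          simp [h.gsub_gsub hσ hσ', this, GSub.comp_qTm]
    | .lam t, _, _, _, _, _, _, _, _, h, hσ, hσ' => by
        cases h with | lam h => simp [h.gsub_gsub hσ hσ']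
    | .app t s, _, _, _, _, _, _, _, _, h, hσ, hσ' => by
        cases h with | app h h' => simp [h.gsub_gsub hσ hσ', h'.gsub_gsub hσ hσ']
    | .mlam t, _, _, _, _, _, _, _, _, h, hσ, hσ' => by
        cases h with
        | mlam hΓ h => simp [h.gsub_gsub hσ.qCtx hσ'.qCtx, GSub.comp_qCtx]
    | .mapp t Γ, _, _, _, _, _, _, _, _, h, hσ, hσ' => by
        cases h with
        | mapp h h' => simp [h.gsub_gsub hσ hσ', Γ.gsub_gsub (hσ.composesCtx hσ')]
  theorem LSubTy.gsub_gsub : ∀ {δ : LSub} {i : Layer} {Φ Φ' Ψ : GCtx} {Γ Δ : LCtx}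
      {σ σ' : GSub}, LSubTy i Ψ Γ δ Δ → GSubTy Φ σ Ψ → GSubTy Φ' σ' Φ →
      (δ.gsub σ).gsub σ' = δ.gsub (GSub.comp σ σ')
    | .emp none m, _, _, _, _, _, _, _, _, _, _, _ => by simp
    | .emp (some g) m, _, _, _, _, _, _, σ, σ', h, hσ, hσ' => by
        have hc := hσ.composesCtx hσ' g
        simp only [LSub.gsub, ← hc]
        rcases hb : (GSub.lookupCtx σ g).base with _ | g'
        · simp [LCtx.len_gsub_of_base_none σ' hb]
        · simp [LCtx.len_gsub_of_base_some σ' hb, Nat.add_assoc]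
    | .wk g m, _, _, _, _, _, _, σ, σ', h, hσ, hσ' => by
        have hc := hσ.composesCtx hσ' g
        simp only [LSub.gsub, ← hc, LSub.idOf_lwk_pn, LSub.wkOf_gsub]
    | .snoc δ t, _, _, _, _, _, _, _, _, h, hσ, hσ' => by
        cases h with | snoc h h' => simp [h.gsub_gsub hσ hσ', h'.gsub_gsub hσ hσ']
end

/-! ### Identity substitutions -/

theorem HasL.lookup_wkOf {Γ : LCtx} {x : ℕ} {T : Ty} (hx : HasL Γ x T) :
    ∀ m, (LSub.wkOf m Γ).lookup x = .var (m + x) := by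
  induction hx with
  | here => intro m; simp
  | there _ ih => intro m; simp [ih]; omega

mutual
  theorem TmTy.lsub_idOf : ∀ {t : Tm} {i : Layer} {Ψ : GCtx} {Γ : LCtx} {T : Ty},
      TmTy i Ψ Γ t T → t.lsub (LSub.idOf Γ) = t
    | .var x, _, _, _, _, h => by
        cases h with | var _ hx => simpa [LSub.idOf] using hx.lookup_wkOf 0
    | .gvar u δ, _, _, _, _, h => by cases h with | gvar h hu => simp [h.comp_idOf]
    | .zero, _, _, _, _, _ => by simp
    | .succ t, _, _, _, _, h => by cases h with | succ h => simp [h.lsub_idOf]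
    | .box t, _, _, _, _, h => by simp
    | .letbox s t, _, _, _, _, h => by
        cases h with
        | letbox h _ _ _ h' => simp [h.lsub_idOf, LSub.idOf_gwk, h'.lsub_idOf]
    | .lam t, _, _, _, _, h => by
        cases h with
        | lam h =>
          have := h.lsub_idOf
          rw [LSub.idOf_snoc] at this
          simp [this]
    | .app t s, _, _, _, _, h => by
        cases h with | app h h' => simp [h.lsub_idOf, h'.lsub_idOf]
    | .mlam t, _, _, _, _, h => by
        cases h with | mlam hΓ h => simp [LSub.idOf_gwk, h.lsub_idOf]
    | .mapp t Γ, _, _, _, _, h => by cases h with | mapp h h' => simp [h.lsub_idOf]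
  theorem LSubTy.comp_idOf : ∀ {δ : LSub} {i : Layer} {Ψ : GCtx} {Γ Δ : LCtx},
      LSubTy i Ψ Γ δ Δ → δ.comp (LSub.idOf Γ) = δ
    | .emp none m, _, _, _, _, h => by cases h with | emp h hb => simp [LSub.idOf, hb]
    | .emp (some g) m, _, _, _, _, h => by cases h with | empVar h hg hb => simp [LSub.idOf]
    | .wk g m, _, _, _, _, h => by cases h with | wk h hg hb => simp [LSub.idOf]
    | .snoc δ t, _, _, _, _, h => by
        cases h with | snoc h h' => simp [h.comp_idOf, h'.lsub_idOf]
end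

/-- `σ` acts as the identity on everything over `Ψ`. -/
structure GSub.IsId (Ψ : GCtx) (σ : GSub) : Prop where
  ctx : GSub.IsIdCtx Ψ σ
  code : ∀ u Δ T, HasG Ψ u (.code Δ T) →
    σ[u]? = some (.bv u) ∨ σ[u]? = some (.tm (.gvar u (LSub.idOf Δ)))

theorem GSub.IsId.gwk_cons {Ψ : GCtx} {σ : GSub} (h : GSub.IsId Ψ σ) (B : GBind) {e : GEntry}
    (hctx : B = .ctx → e = .ctx (.var 0)) (hcode : ∀ Δ T, B = .code Δ T → e = .bv 0) :
    GSub.IsId (B :: Ψ) (e :: GSub.gwk σ (.p .id)) where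
  ctx := by
    rintro (_ | g) hg
    · have : B = .ctx := by
        have := hg.eq_of_zero
        cases B with
        | ctx => rfl
        | code => simp at this
      simp [hctx this]
    · simp [GSub.lookupCtx_gwk, h.ctx g hg.ctx_of_succ]
  code := by
    rintro (_ | u) Δ T hu
    · have : ∃ Δ T, B = .code Δ T := by
        have := hu.eq_of_zero
        cases B with
        | ctx => simp at this
        | code => exact ⟨_, _, rfl⟩
      obtain ⟨Δ, T, hB⟩ := this
      simp [hcode Δ T hB]
    · obtain ⟨Δ, T, rfl, rfl, hu'⟩ := hu.code_of_succ
      simp only [List.getElem?_cons_succ, GSub.getElem?_gwk]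
      rcases h.code u Δ T hu' with h | h <;> simp [h, LSub.idOf_gwk]

theorem GSub.IsId.qCtx {Ψ : GCtx} {σ : GSub} (h : GSub.IsId Ψ σ) :
    GSub.IsId (.ctx :: Ψ) (GSub.qCtx σ) :=
  h.gwk_cons _ (fun _ => rfl) (by simp)

theorem GSub.IsId.qTm {Ψ : GCtx} {σ : GSub} (h : GSub.IsId Ψ σ) (Δ : LCtx) (T : Ty) :
    GSub.IsId (.code Δ T :: Ψ) (GSub.qTm σ) :=
  h.gwk_cons _ (by simp) (fun _ _ _ => rfl)

theorem GSub.isId_idOf (Ψ : GCtx) : GSub.IsId Ψ (GSub.idOf Ψ) :=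
  ⟨GSub.isIdCtx_idOf Ψ, fun _ _ _ hu => .inr hu.getElem?_idOf_code⟩

mutual
  -- The two forms of entry that `IsId` admits have the same effect on `u^δ`, because `id ∘ δ = δ`
  -- for `δ` of the right shape.
  theorem TmTy.gsub_id : ∀ {t : Tm} {i : Layer} {Ψ : GCtx} {Γ : LCtx} {T : Ty} {σ : GSub},
      TmTy i Ψ Γ t T → GSub.IsId Ψ σ → t.gsub σ = t
    | .var x, _, _, _, _, _, _, _ => by simp
    | .gvar u δ, _, _, _, _, _, h, hσ => by
        cases h with
        | gvar h hu =>
          rcases hσ.code _ _ _ hu with h' | h' <;>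
            simp [GSub.appVar, h', h.gsub_id hσ, h.fits.idOf_comp]
    | .zero, _, _, _, _, _, _, _ => by simp
    | .succ t, _, _, _, _, _, h, hσ => by cases h with | succ h => simp [h.gsub_id hσ]
    | .box t, _, _, _, _, _, h, hσ => by cases h with | box _ h => simp [h.gsub_id hσ]
    | .letbox s t, _, _, _, _, _, h, hσ => by
        cases h with
        | letbox h _ _ _ h' => simp [h.gsub_id hσ, h'.gsub_id (hσ.qTm _ _)]
    | .lam t, _, _, _, _, _, h, hσ => by cases h with | lam h => simp [h.gsub_id hσ]
    | .app t s, _, _, _, _, _, h, hσ => by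
        cases h with | app h h' => simp [h.gsub_id hσ, h'.gsub_id hσ]
    | .mlam t, _, _, _, _, _, h, hσ => by
        cases h with | mlam hΓ h => simp [h.gsub_id hσ.qCtx]
    | .mapp t Γ, _, _, _, _, _, h, hσ => by
        cases h with | mapp h h' => simp [h.gsub_id hσ, h'.gsub_id hσ.ctx]
  theorem LSubTy.gsub_id : ∀ {δ : LSub} {i : Layer} {Ψ : GCtx} {Γ Δ : LCtx} {σ : GSub},
      LSubTy i Ψ Γ δ Δ → GSub.IsId Ψ σ → δ.gsub σ = δ
    | .emp none m, _, _, _, _, _, h, hσ => by simp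
    | .emp (some g) m, _, _, _, _, _, h, hσ => by
        cases h with | empVar h hg hb => simp [hσ.ctx g hg]
    | .wk g m, _, _, _, _, _, h, hσ => by
        cases h with | wk h hg hb => simp [hσ.ctx g hg, LSub.idOf_lwk_pn]
    | .snoc δ t, _, _, _, _, _, h, hσ => by
        cases h with | snoc h h' => simp [h.gsub_id hσ, h'.gsub_id hσ]
end

theorem TmTy.gsub_idOf {t : Tm} {i : Layer} {Ψ : GCtx} {Γ : LCtx} {T : Ty}
    (h : TmTy i Ψ Γ t T) : t.gsub (GSub.idOf Ψ) = t := h.gsub_id (GSub.isId_idOf Ψ)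

theorem LSubTy.gsub_idOf {δ : LSub} {i : Layer} {Ψ : GCtx} {Γ Δ : LCtx}
    (h : LSubTy i Ψ Γ δ Δ) : δ.gsub (GSub.idOf Ψ) = δ := h.gsub_id (GSub.isId_idOf Ψ)

theorem GSub.wkOf_succ : ∀ (m : ℕ) (Ψ : GCtx),
    GSub.wkOf (m + 1) Ψ = GSub.gwk (GSub.wkOf m Ψ) (.p .id)
  | _, [] => rfl
  | m, .ctx :: Ψ => by
      rw [GSub.wkOf, GSub.wkOf, GSub.wkOf_succ (m + 1) Ψ]; rfl
  | m, .code Γ T :: Ψ => by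
      rw [GSub.wkOf, GSub.wkOf, GSub.wkOf_succ (m + 1) Ψ]
      simp only [GSub.gwk, List.map_cons, GEntry.gwk_tm, Tm.gwk, Wk.act, LSub.gwk_comp]
      congr 3

/-- `GSub.idOf` is defined by counting positions; this equation and the next one give the recursive
form that induction on `Ψ` requires. -/
theorem GSub.idOf_ctx (Ψ : GCtx) : GSub.idOf (.ctx :: Ψ) = GSub.qCtx (GSub.idOf Ψ) := by
  rw [GSub.idOf, GSub.wkOf, GSub.wkOf_succ]; rfl

theorem GSub.idOf_code (Γ : LCtx) (T : Ty) (Ψ : GCtx) :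
    GSub.idOf (.code Γ T :: Ψ) =
      .tm (.gvar 0 (LSub.idOf (Γ.gwk (.p .id)))) :: GSub.gwk (GSub.idOf Ψ) (.p .id) := by
  rw [GSub.idOf, GSub.wkOf, GSub.wkOf_succ, LSub.idOf_gwk]; rfl

theorem GSubTy.idOf : ∀ {Ψ : GCtx}, WfG Ψ → GSubTy Ψ (GSub.idOf Ψ) Ψ
  | [], h => .nil h
  | .ctx :: Ψ, h => by
      cases h with | ctx h => rw [GSub.idOf_ctx]; exact (GSubTy.idOf h).qCtx
  | .code Γ T :: Ψ, h => by
      cases h with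
      | code hΓ hT =>
        have hp : GWk (.p .id) (.code Γ T :: Ψ) Ψ := .pId (.code hΓ hT)
        rw [GSub.idOf_code]
        refine .tm ((GSubTy.idOf hΓ.wfG).gwk hp) ?_
        rw [← LCtx.gsub_gwk, ← Ty.gsub_gwk, hΓ.gsub_idOf, hT.gsub_idOf]
        exact .gvar (.idOf (hΓ.gwk hp)) .here

/-- The identity substitution without term entries. -/
def GSub.bvId : GCtx → GSub
  | [] => []
  | .ctx :: Ψ => GSub.qCtx (GSub.bvId Ψ)
  | .code _ _ :: Ψ => GSub.qTm (GSub.bvId Ψ)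

theorem GSub.isId_bvId : ∀ Ψ : GCtx, GSub.IsId Ψ (GSub.bvId Ψ)
  | [] => ⟨fun _ h => (nomatch h), fun _ _ _ h => (nomatch h)⟩
  | .ctx :: Ψ => (GSub.isId_bvId Ψ).qCtx
  | .code Δ T :: Ψ => (GSub.isId_bvId Ψ).qTm Δ T

theorem GSubTy.bvId : ∀ {Ψ : GCtx}, WfG Ψ → GSubTy Ψ (GSub.bvId Ψ) Ψ
  | [], h => .nil h
  | .ctx :: Ψ, h => by cases h with | ctx h => exact (GSubTy.bvId h).qCtx
  | .code Γ T :: Ψ, h => by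
      cases h with
      | code hΓ hT =>
        have := (GSubTy.bvId hΓ.wfG).qTm hΓ hT
        rw [hΓ.gsub_id (GSub.isId_bvId Ψ).ctx, hT.gsub_id (GSub.isId_bvId Ψ).ctx] at this
        exact this

/-- This makes the condition of `GoodGSub` on term entries vacuous, so that `RedMono.codeRed` can be
proved before anything is known about code. -/
theorem GSub.bvId_no_tm : ∀ (Ψ : GCtx) (t : Tm), GEntry.tm t ∉ GSub.bvId Ψ
  | [], t => by simp [GSub.bvId]
  | .ctx :: Ψ, t => by
      simp only [GSub.bvId, GSub.qCtx, GSub.gwk, List.mem_cons, reduceCtorEq, List.mem_map,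
        false_or, not_exists, not_and]
      intro e he
      cases e with
      | tm s => exact fun _ => GSub.bvId_no_tm Ψ s he
      | _ => simp
  | .code _ _ :: Ψ, t => by
      simp only [GSub.bvId, GSub.qTm, GSub.gwk, List.mem_cons, reduceCtorEq, List.mem_map,
        false_or, not_exists, not_and]
      intro e he
      cases e with
      | tm s => exact fun _ => GSub.bvId_no_tm Ψ s he
      | _ => simp

/-! ### Well-typedness of both sides of equivalences and reductions -/

theorem GSubTy.consTm {Ψ : GCtx} {Δ : LCtx} {s : Tm} {T : Ty} (h : TmTy .zero Ψ Δ s T) :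
    GSubTy Ψ (.tm s :: GSub.idOf Ψ) (.code Δ T :: Ψ) := by
  refine .tm (.idOf h.wf.1.wfG) ?_
  rw [h.wf.1.gsub_idOf, h.wf.2.gsub_idOf]
  exact h

theorem GSubTy.consCtx {Ψ : GCtx} {Δ : LCtx} (h : WfL .zero Ψ Δ) :
    GSubTy Ψ (.ctx Δ :: GSub.idOf Ψ) (.ctx :: Ψ) := .ctx (.idOf h.wfG) h

theorem TmTy.gsub_tm {Ψ : GCtx} {Γ Δ : LCtx} {s t : Tm} {T T' : Ty} (hs : TmTy .zero Ψ Δ s T)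
    (hΓ : WfL .one Ψ Γ) (hT' : WfT .one Ψ T')
    (ht : TmTy .one (.code Δ T :: Ψ) (Γ.gwk (.p .id)) t (T'.gwk (.p .id))) :
    TmTy .one Ψ Γ (t.gsub (.tm s :: GSub.idOf Ψ)) T' := by
  simpa [hΓ.gsub_idOf, hT'.gsub_idOf] using ht.gsub (.consTm hs)

theorem TmTy.gsub_ctx {Ψ : GCtx} {Γ Δ : LCtx} {t : Tm} {T : Ty} (hΓ : WfL .one Ψ Γ)
    (ht : TmTy .one (.ctx :: Ψ) (Γ.gwk (.p .id)) t T) (hΔ : WfL .zero Ψ Δ) :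
    TmTy .one Ψ Γ (t.gsub (.ctx Δ :: GSub.idOf Ψ)) (T.gsub (.ctx Δ :: GSub.idOf Ψ)) := by
  simpa [hΓ.gsub_idOf] using ht.gsub (.consCtx hΔ)

/-- Weakening under the binder followed by instantiation at the fresh context variable cancels. This
types the body of the η-expansion of a meta-function. -/
theorem WfT.gwk_q_p_gsub {Ψ : GCtx} {T : Ty} (h : WfT .one (.ctx :: Ψ) T) :
    (T.gwk (.q (.p .id))).gsub (.ctx (.var 0) :: GSub.idOf (.ctx :: Ψ)) = T := by
  have e := T.gwk_gsub (γ := .q (.p .id)) (σ := .ctx (.var 0) :: GSub.idOf (.ctx :: Ψ))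
    (σ' := GSub.idOf (.ctx :: Ψ)) ?_
  · rw [e, h.gsub_idOf]
  · rw [GSub.idOf_ctx]
    exact ((GSub.restricts_p _ _).cons _).ctx

theorem TmTy.etaLam {i : Layer} {Ψ : GCtx} {Γ : LCtx} {t : Tm} {S T : Ty}
    (h : TmTy i Ψ Γ t (.arr S T)) :
    TmTy i Ψ (.snoc Γ S) (.app (t.lwk (.p .id)) (.var 0)) T := by
  cases h.wf.2 with
  | arr hS hT => exact .app (h.lwk (.pId h.wf.1 hS)) (.var (.snoc h.wf.1 hS) .here)

theorem TmTy.etaMlam {Ψ : GCtx} {Γ : LCtx} {t : Tm} {T : Ty} (h : TmTy .one Ψ Γ t (.pi T)) :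
    TmTy .one (.ctx :: Ψ) (Γ.gwk (.p .id)) (.mapp (t.gwk (.p .id)) (.var 0)) T := by
  cases h.wf.2 with
  | pi hT =>
    have hΨ := h.wf.1.wfG
    have := TmTy.mapp (h.gwk (.pId (.ctx hΨ))) (.var (g := 0) (.ctx hΨ) .here)
    rwa [hT.gwk_q_p_gsub] at this

mutual
  theorem TmEq.typed : ∀ {i : Layer} {Ψ : GCtx} {Γ : LCtx} {t t' : Tm} {T : Ty},
      TmEq i Ψ Γ t t' T → TmTy i Ψ Γ t T ∧ TmTy i Ψ Γ t' T
    | _, _, _, _, _, _, .symm h => h.typed.symm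
    | _, _, _, _, _, _, .trans h h' => ⟨h.typed.1, h'.typed.2⟩
    | _, _, _, _, _, _, .var h hx => ⟨.var h hx, .var h hx⟩
    | _, _, _, _, _, _, .gvar h hu => ⟨.gvar h.typed.1 hu, .gvar h.typed.2 hu⟩
    | _, _, _, _, _, _, .zero h => ⟨.zero h, .zero h⟩
    | _, _, _, _, _, _, .succ h => ⟨.succ h.typed.1, .succ h.typed.2⟩
    | _, _, _, _, _, _, .lam h => ⟨.lam h.typed.1, .lam h.typed.2⟩
    | _, _, _, _, _, _, .app h h' => ⟨.app h.typed.1 h'.typed.1, .app h.typed.2 h'.typed.2⟩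
    | _, _, _, _, _, _, .box hΓ h => ⟨.box hΓ h.typed.1, .box hΓ h.typed.2⟩
    | _, _, _, _, _, _, .letbox h hΔ hT hT' h' =>
        ⟨.letbox h.typed.1 hΔ hT hT' h'.typed.1, .letbox h.typed.2 hΔ hT hT' h'.typed.2⟩
    | _, _, _, _, _, _, .mlam hΓ h => ⟨.mlam hΓ h.typed.1, .mlam hΓ h.typed.2⟩
    | _, _, _, _, _, _, .mapp h hΔ => ⟨.mapp h.typed.1 hΔ, .mapp h.typed.2 hΔ⟩
    | _, _, _, _, _, _, .betaLam h h' => ⟨.app (.lam h) h', h.lsub_one h'⟩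
    | _, _, _, _, _, _, .etaLam h => ⟨h, .lam h.etaLam⟩
    | _, _, _, _, _, _, .betaBox hs hΓ hT' ht =>
        ⟨.letbox (.box hΓ hs) hs.wf.1 hs.wf.2 hT' ht, TmTy.gsub_tm hs hΓ hT' ht⟩
    | _, _, _, _, _, _, .betaMlam hΓ ht hΔ =>
        ⟨.mapp (.mlam hΓ ht) hΔ, TmTy.gsub_ctx hΓ ht hΔ⟩
    | _, _, _, _, _, _, .etaMlam h => ⟨h, .mlam h.wf.1 h.etaMlam⟩
  theorem LSubEq.typed : ∀ {i : Layer} {Ψ : GCtx} {Γ Δ : LCtx} {δ δ' : LSub},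
      LSubEq i Ψ Γ δ δ' Δ → LSubTy i Ψ Γ δ Δ ∧ LSubTy i Ψ Γ δ' Δ
    | _, _, _, _, _, _, .emp h hb => ⟨.emp h hb, .emp h hb⟩
    | _, _, _, _, _, _, .empVar h hg hb => ⟨.empVar h hg hb, .empVar h hg hb⟩
    | _, _, _, _, _, _, .wk h hg hb => ⟨.wk h hg hb, .wk h hg hb⟩
    | _, _, _, _, _, _, .snoc h h' =>
        ⟨.snoc h.typed.1 h'.typed.1, .snoc h.typed.2 h'.typed.2⟩
end

mutual
  -- The β and η rules are confined to layer `1`, and what remains at layer `0` relates equal terms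
  -- only. Consequently the congruence rule for `box` relates a term only to itself, as the
  -- reducibility clause for `□` demands.
  theorem TmEq.eq_of_zero : ∀ {i : Layer} {Ψ : GCtx} {Γ : LCtx} {t t' : Tm} {T : Ty},
      TmEq i Ψ Γ t t' T → i = .zero → t = t'
    | _, _, _, _, _, _, .symm h, hi => (h.eq_of_zero hi).symm
    | _, _, _, _, _, _, .trans h h', hi => (h.eq_of_zero hi).trans (h'.eq_of_zero hi)
    | _, _, _, _, _, _, .var _ _, _ => rfl
    | _, _, _, _, _, _, .gvar h _, hi => by rw [h.eq_of_zero hi]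
    | _, _, _, _, _, _, .zero _, _ => rfl
    | _, _, _, _, _, _, .succ h, hi => by rw [h.eq_of_zero hi]
    | _, _, _, _, _, _, .lam h, hi => by rw [h.eq_of_zero hi]
    | _, _, _, _, _, _, .app h h', hi => by rw [h.eq_of_zero hi, h'.eq_of_zero hi]
    | _, _, _, _, _, _, .box _ _, hi => by cases hi
    | _, _, _, _, _, _, .letbox _ _ _ _ _, hi => by cases hi
    | _, _, _, _, _, _, .mlam _ _, hi => by cases hi
    | _, _, _, _, _, _, .mapp _ _, hi => by cases hi
    | _, _, _, _, _, _, .betaLam _ _, hi => by cases hi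
    | _, _, _, _, _, _, .etaLam _, hi => by cases hi
    | _, _, _, _, _, _, .betaBox _ _ _ _, hi => by cases hi
    | _, _, _, _, _, _, .betaMlam _ _ _, hi => by cases hi
    | _, _, _, _, _, _, .etaMlam _, hi => by cases hi
  theorem LSubEq.eq_of_zero : ∀ {i : Layer} {Ψ : GCtx} {Γ Δ : LCtx} {δ δ' : LSub},
      LSubEq i Ψ Γ δ δ' Δ → i = .zero → δ = δ'
    | _, _, _, _, _, _, .emp _ _, _ => rfl
    | _, _, _, _, _, _, .empVar _ _ _, _ => rfl
    | _, _, _, _, _, _, .wk _ _ _, _ => rfl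
    | _, _, _, _, _, _, .snoc h h', hi => by rw [h.eq_of_zero hi, h'.eq_of_zero hi]
end

/-! ### Weak head reduction -/

theorem Step.typed {Ψ : GCtx} {Γ : LCtx} {t t' : Tm} {T : Ty} (h : Step Ψ Γ t t' T) :
    TmTy .one Ψ Γ t T := by
  induction h with
  | app _ hs ih => exact .app ih hs
  | letbox _ hT' ht ih =>
    cases ih.wf.2 with | box hΔ hT => exact .letbox ih hΔ hT hT' ht
  | mapp _ hΔ ih => exact .mapp ih hΔ
  | betaLam h h' => exact .app (.lam h) h'
  | betaMlam hΓ h hΔ => exact .mapp (.mlam hΓ h) hΔ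
  | betaBox hs hΓ hT' ht => exact .letbox (.box hΓ hs) hs.wf.1 hs.wf.2 hT' ht

theorem Steps.typed_left {Ψ : GCtx} {Γ : LCtx} {t t' : Tm} {T : Ty} (h : Steps Ψ Γ t t' T) :
    TmTy .one Ψ Γ t T := by
  cases h with
  | refl h => exact h
  | head h _ => exact h.typed

theorem Steps.typed_right {Ψ : GCtx} {Γ : LCtx} {t t' : Tm} {T : Ty} (h : Steps Ψ Γ t t' T) :
    TmTy .one Ψ Γ t' T := by
  induction h with
  | refl h => exact h
  | head _ _ ih => exact ih

theorem Steps.trans {Ψ : GCtx} {Γ : LCtx} {t t' t'' : Tm} {T : Ty} (h : Steps Ψ Γ t t' T)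
    (h' : Steps Ψ Γ t' t'' T) : Steps Ψ Γ t t'' T := by
  induction h with
  | refl _ => exact h'
  | head h _ ih => exact .head h (ih h')

theorem Steps.app {Ψ : GCtx} {Γ : LCtx} {t t' s : Tm} {S T : Ty} (h : Steps Ψ Γ t t' (.arr S T))
    (hs : TmTy .one Ψ Γ s S) : Steps Ψ Γ (.app t s) (.app t' s) T := by
  generalize hA : Ty.arr S T = A at h
  induction h with
  | refl h => subst hA; exact .refl (.app h hs)
  | head h _ ih => subst hA; exact .head (.app h hs) (ih rfl)

theorem Steps.mapp {Ψ : GCtx} {Γ Δ : LCtx} {t t' : Tm} {T : Ty} (h : Steps Ψ Γ t t' (.pi T))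
    (hΔ : WfL .zero Ψ Δ) :
    Steps Ψ Γ (.mapp t Δ) (.mapp t' Δ) (T.gsub (.ctx Δ :: GSub.idOf Ψ)) := by
  generalize hA : Ty.pi T = A at h
  induction h with
  | refl h => subst hA; exact .refl (.mapp h hΔ)
  | head h _ ih => subst hA; exact .head (.mapp h hΔ) (ih rfl)

theorem Steps.letbox {Ψ : GCtx} {Γ Δ : LCtx} {s s' t : Tm} {T T' : Ty}
    (h : Steps Ψ Γ s s' (.box Δ T)) (hT' : WfT .one Ψ T')
    (ht : TmTy .one (.code Δ T :: Ψ) (Γ.gwk (.p .id)) t (T'.gwk (.p .id))) :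
    Steps Ψ Γ (.letbox s t) (.letbox s' t) T' := by
  generalize hA : Ty.box Δ T = A at h
  induction h with
  | refl h =>
    subst hA
    cases h.wf.2 with | box hΔ hT => exact .refl (.letbox h hΔ hT hT' ht)
  | head h _ ih => subst hA; exact .head (.letbox h hT' ht) (ih rfl)

theorem IsNe.not_step {Ψ : GCtx} {Γ : LCtx} {t t' : Tm} {T : Ty} (h : Step Ψ Γ t t' T) :
    ¬ IsNe t := by
  induction h with
  | app _ _ ih => intro hn; cases hn with | app hn => exact ih hn
  | letbox _ _ _ ih => intro hn; cases hn with | letbox hn => exact ih hn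
  | mapp _ _ ih => intro hn; cases hn with | mapp hn => exact ih hn
  | betaLam => intro hn; cases hn with | app hn => cases hn
  | betaMlam => intro hn; cases hn with | mapp hn => cases hn
  | betaBox => intro hn; cases hn with | letbox hn => cases hn

theorem IsNf.not_step {Ψ : GCtx} {Γ : LCtx} {t t' : Tm} {T : Ty} (hn : IsNf t) :
    ¬ Step Ψ Γ t t' T := by
  intro h
  cases hn with
  | ne hn => exact IsNe.not_step h hn
  | _ => cases h

theorem Step.det {Ψ : GCtx} {Γ : LCtx} {t t₁ : Tm} {T : Ty} (h : Step Ψ Γ t t₁ T) :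
    ∀ {t₂ : Tm} {T' : Ty}, Step Ψ Γ t t₂ T' → t₁ = t₂ := by
  induction h with
  | app h _ ih =>
    intro t₂ T' h'
    cases h' with
    | app h' _ => rw [ih h']
    | betaLam => cases h
  | letbox h _ _ ih =>
    intro t₂ T' h'
    cases h' with
    | letbox h' _ => rw [ih h']
    | betaBox => cases h
  | mapp h _ ih =>
    intro t₂ T' h'
    cases h' with
    | mapp h' _ => rw [ih h']
    | betaMlam => cases h
  | betaLam =>
    intro t₂ T' h'
    cases h' with
    | app h' _ => cases h'
    | betaLam => rfl
  | betaMlam =>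
    intro t₂ T' h'
    cases h' with
    | mapp h' _ => cases h'
    | betaMlam => rfl
  | betaBox =>
    intro t₂ T' h'
    cases h' with
    | letbox h' _ => cases h'
    | betaBox => rfl

/-- Normal forms are unique even across types, since `Step.det` is. Transitivity of reducibility
uses this to identify the two normal forms found for the middle term. -/
theorem Whnf.det {Ψ : GCtx} {Γ : LCtx} {t w w' : Tm} {T T' : Ty} (h : Whnf Ψ Γ t w T)
    (h' : Whnf Ψ Γ t w' T') : w = w' := by
  obtain ⟨h, hn⟩ := h
  induction h with
  | refl _ =>
    cases h'.1 with
    | refl => rfl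
    | head hs _ => exact absurd hs hn.not_step
  | head hs _ ih =>
    obtain ⟨h', hn'⟩ := h'
    cases h' with
    | refl => exact absurd hs hn'.not_step
    | head hs' h' =>
      rw [← hs.det hs'] at h'
      exact ih ⟨h', hn'⟩ hn

theorem Whnf.of_steps {Ψ : GCtx} {Γ : LCtx} {s t w : Tm} {T : Ty} (h : Whnf Ψ Γ t w T)
    (hs : Steps Ψ Γ s t T) : Whnf Ψ Γ s w T := ⟨hs.trans h.1, h.2⟩

/-! ### Weak head reduction and weakenings -/

theorem IsNe.gwk {v : Tm} (h : IsNe v) (γ : Wk) : IsNe (v.gwk γ) := by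
  induction h with
  | var => exact .var
  | gvar => exact .gvar
  | app _ ih => exact .app ih
  | letbox _ ih => exact .letbox ih
  | mapp _ ih => exact .mapp ih

theorem IsNe.lwk {v : Tm} (h : IsNe v) (τ : Wk) : IsNe (v.lwk τ) := by
  induction h with
  | var => exact .var
  | gvar => exact .gvar
  | app _ ih => exact .app ih
  | letbox _ ih => exact .letbox ih
  | mapp _ ih => exact .mapp ih

theorem IsNf.dwk {w : Tm} (h : IsNf w) (γ τ : Wk) : IsNf (w.dwk γ τ) := by
  cases h with
  | ne h => exact .ne ((h.gwk γ).lwk τ)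
  | zero => exact .zero
  | succ => exact .succ
  | box => exact .box
  | lam => exact .lam
  | mlam => exact .mlam

theorem TmTy.dwk {t : Tm} {Φ Ψ : GCtx} {Γ Δ : LCtx} {T : Ty} {γ τ : Wk}
    (h : TmTy .one Ψ Γ t T) (hd : DWk γ τ Φ Δ Ψ Γ) : TmTy .one Φ Δ (t.dwk γ τ) (T.gwk γ) :=
  (h.gwk hd.1).lwk hd.2

theorem LSubTy.lwk_comp_idOf {i : Layer} {Ψ : GCtx} {τ : Wk} {Γ Δ : LCtx} (h : LWk i Ψ τ Δ Γ) :
    ((LSub.idOf Γ).lwk τ).comp (LSub.idOf Δ) = (LSub.idOf Γ).lwk τ := by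
  have hΓ : WfL i Ψ Γ := by
    induction h with
    | id h => exact h
    | p _ _ ih => exact ih
    | q _ hT ih => exact .snoc ih hT
  exact ((LSubTy.idOf hΓ).lwk h).comp_idOf

theorem TmTy.lwk_q_lsub {t s : Tm} {i : Layer} {Ψ : GCtx} {Γ Δ : LCtx} {S T : Ty} {τ : Wk}
    (h : TmTy i Ψ (.snoc Γ S) t T) (hτ : LWk i Ψ τ Δ Γ) :
    (t.lwk (.q τ)).lsub (.snoc (LSub.idOf Δ) s) = t.lsub (.snoc ((LSub.idOf Γ).lwk τ) s) := by
  -- Writing `t` as `t[id]` turns the weakening of `t` into a weakening of a substitution, where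
  -- composition can be computed.
  conv_lhs => rw [← h.lsub_idOf]
  rw [Tm.lsub_lwk, Tm.lsub_lsub, LSub.idOf_snoc]
  simp only [LSub.lwk, LSub.lwk_p_q, LSub.comp, LSub.lwk_p_comp, LSubTy.lwk_comp_idOf hτ]
  simp

/-- Each β case says that weakening commutes with instantiating the bound variable. For global
bindings the global part is `GWk.restricts_idOf`, and the local part is an exchange that rests on
`LWk.act_add_len`. -/
theorem Step.dwk {Ψ : GCtx} {Γ : LCtx} {t t' : Tm} {T : Ty} (h : Step Ψ Γ t t' T) :
    ∀ {Φ : GCtx} {Δ : LCtx} {γ τ : Wk}, DWk γ τ Φ Δ Ψ Γ →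
      Step Φ Δ (t.dwk γ τ) (t'.dwk γ τ) (T.gwk γ) := by
  induction h with
  | app _ hs ih => intro Φ Δ γ τ hd; exact .app (ih hd) (hs.dwk hd)
  | letbox h hT' ht ih =>
    intro Φ Δ γ τ hd
    cases h.typed.wf.2 with
    | box hΔ hT =>
      have hΔ' := hΔ.gwk hd.1
      have hT'' := hT.gwk hd.1
      have := (ht.gwk (hd.1.qCode hΔ hT))
      rw [LCtx.gwk_p_q, Ty.gwk_p_q] at this
      exact .letbox (ih hd) (hT'.gwk hd.1) (this.lwk (hd.2.gwk (.pId (.code hΔ' hT''))))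
  | mapp _ hΔ ih =>
    intro Φ Δ γ τ hd
    rw [Ty.gsub_ctx_idOf_gwk hd.1]
    exact .mapp (ih hd) (hΔ.gwk hd.1)
  | @betaLam t s S T h hs =>
    intro Φ Δ γ τ hd
    cases h.wf.1 with
    | snoc hΓ hS =>
      have h' := h.gwk hd.1
      have e : (t.lsub (.snoc (LSub.idOf Γ) s)).dwk γ τ =
          ((t.gwk γ).lwk (.q τ)).lsub (.snoc (LSub.idOf Δ) (s.dwk γ τ)) := by
        rw [Tm.dwk, Tm.lsub_gwk, Tm.lsub_lwk, h'.lwk_q_lsub hd.2]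
        simp [LSub.idOf_gwk, Tm.dwk]
      rw [e]
      exact .betaLam (h'.lwk (.q hd.2 (hS.gwk hd.1))) (hs.dwk hd)
  | @betaMlam Δ' t T hΓ h hΔ =>
    intro Φ Δ γ τ hd
    have hp : GWk (.p .id) (.ctx :: Φ) Φ := .pId (.ctx hd.1.wfG_left)
    have h' := h.gwk hd.1.qCtx
    rw [LCtx.gwk_p_q] at h'
    have e : (t.gsub (.ctx Δ' :: GSub.idOf Ψ)).dwk γ τ =
        ((t.gwk (.q γ)).lwk τ).gsub (.ctx (Δ'.gwk γ) :: GSub.idOf Φ) := by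
      rw [Tm.dwk, Tm.gsub_gwk, h'.lwk_gsub (by simpa using hd.2.act_add_len),
        t.gwk_gsub (hd.1.restricts_idOf.cons _)]
      rfl
    rw [e, Ty.gsub_ctx_idOf_gwk hd.1]
    exact .betaMlam hd.2.wfL_left (h'.lwk (hd.2.gwk hp)) (hΔ.gwk hd.1)
  | @betaBox Δ' s t T T' hs hΓ hT' ht =>
    intro Φ Δ γ τ hd
    have hs' := hs.gwk hd.1
    have hp : GWk (.p .id) (.code (Δ'.gwk γ) (T.gwk γ) :: Φ) Φ := .pId (.code hs'.wf.1 hs'.wf.2)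
    have h' := ht.gwk (hd.1.qCode hs.wf.1 hs.wf.2)
    rw [LCtx.gwk_p_q, Ty.gwk_p_q] at h'
    have e : (t.gsub (.tm s :: GSub.idOf Ψ)).dwk γ τ =
        ((t.gwk (.q γ)).lwk τ).gsub (.tm (s.gwk γ) :: GSub.idOf Φ) := by
      rw [Tm.dwk, Tm.gsub_gwk, h'.lwk_gsub (by simpa using hd.2.act_add_len),
        t.gwk_gsub (hd.1.restricts_idOf.cons _)]
      rfl
    rw [e]
    exact .betaBox hs' hd.2.wfL_left (hT'.gwk hd.1) (h'.lwk (hd.2.gwk hp))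

theorem Steps.dwk {Φ Ψ : GCtx} {Γ Δ : LCtx} {t t' : Tm} {T : Ty} {γ τ : Wk}
    (h : Steps Ψ Γ t t' T) (hd : DWk γ τ Φ Δ Ψ Γ) :
    Steps Φ Δ (t.dwk γ τ) (t'.dwk γ τ) (T.gwk γ) := by
  induction h with
  | refl h => exact .refl (h.dwk hd)
  | head h _ ih => exact .head (h.dwk hd) ih

theorem Whnf.dwk {Φ Ψ : GCtx} {Γ Δ : LCtx} {t w : Tm} {T : Ty} {γ τ : Wk}
    (h : Whnf Ψ Γ t w T) (hd : DWk γ τ Φ Δ Ψ Γ) :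
    Whnf Φ Δ (t.dwk γ τ) (w.dwk γ τ) (T.gwk γ) :=
  ⟨h.1.dwk hd, h.2.dwk γ τ⟩

theorem DWk.comp {γ τ γ' τ' : Wk} {Φ Φ' Ψ : GCtx} {Γ Δ Δ' : LCtx} (h : DWk γ τ Φ Δ Ψ Γ)
    (h' : DWk γ' τ' Φ' Δ' Φ Δ) : DWk (γ.comp γ') (τ.comp τ') Φ' Δ' Ψ Γ := by
  refine ⟨h'.1.comp h.1, ?_⟩
  rw [← LCtx.gwk_comp]
  exact h'.2.comp (h.2.gwk h'.1)

theorem DWk.id {Ψ : GCtx} {Γ : LCtx} (h : WfL .one Ψ Γ) : DWk .id .id Ψ Γ Ψ Γ :=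
  ⟨.id h.wfG, by simpa using LWk.id h⟩

theorem DWk.pLocal {Ψ : GCtx} {Γ : LCtx} {T : Ty} (h : WfL .one Ψ Γ) (hT : WfT .one Ψ T) :
    DWk .id (.p .id) Ψ (.snoc Γ T) Ψ Γ :=
  ⟨.id h.wfG, by simpa using LWk.pId h hT⟩

theorem DWk.ofGWk {γ : Wk} {Φ Ψ : GCtx} {Γ : LCtx} (h : WfL .one Ψ Γ) (hγ : GWk γ Φ Ψ) :
    DWk γ .id Φ (Γ.gwk γ) Ψ Γ :=
  ⟨hγ, .id (h.gwk hγ)⟩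

/-! ### Global substitutions that agree up to `u^id/u` -/

/-- `σ'` arises from `σ` by writing out some of its entries `v^id/u`. -/
structure GSub.Expands (Ψ : GCtx) (σ σ' : GSub) : Prop where
  ctx : ∀ g, GSub.lookupCtx σ g = GSub.lookupCtx σ' g
  code : ∀ u Δ T, HasG Ψ u (.code Δ T) → σ[u]? = σ'[u]? ∨
    ∃ v, σ[u]? = some (.bv v) ∧ σ'[u]? = some (.tm (.gvar v (LSub.idOf (Δ.gsub σ))))

theorem GSub.Expands.cons {Ψ : GCtx} {σ σ' : GSub} (h : GSub.Expands Ψ σ σ') (B : GBind)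
    (e : GEntry) : GSub.Expands (B :: Ψ) (e :: σ) (e :: σ') where
  ctx
    | 0 => by simp [GSub.lookupCtx]
    | g + 1 => by simpa using h.ctx g
  code := by
    rintro (_ | u) Δ T hu
    · simp
    · obtain ⟨Δ, T, rfl, rfl, hu'⟩ := hu.code_of_succ
      simpa using h.code u Δ T hu'

theorem GSub.Expands.gwk {Ψ : GCtx} {σ σ' : GSub} (h : GSub.Expands Ψ σ σ') (γ : Wk) :
    GSub.Expands Ψ (GSub.gwk σ γ) (GSub.gwk σ' γ) where
  ctx g := by rw [GSub.lookupCtx_gwk, GSub.lookupCtx_gwk, h.ctx]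
  code u Δ T hu := by
    rw [GSub.getElem?_gwk, GSub.getElem?_gwk]
    rcases h.code u Δ T hu with h | ⟨v, h, h'⟩
    · simp [h]
    · simp [h, h', LSub.idOf_gwk, LCtx.gsub_gwk]

theorem GSub.Expands.restrictsCtx {Ψ : GCtx} {σ σ' : GSub} (h : GSub.Expands Ψ σ σ') :
    GSub.RestrictsCtx .id σ σ' := h.ctx

mutual
  -- An entry `v^id` and its written-out form differ on `u^δ` only by composing `δ` with an
  -- identity, which is harmless when `δ` fits the local context of `u`; typing ensures this.
  theorem TmTy.gsub_expands : ∀ {t : Tm} {i : Layer} {Ψ : GCtx} {Γ : LCtx} {T : Ty}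
      {σ σ' : GSub}, TmTy i Ψ Γ t T → GSub.Expands Ψ σ σ' → t.gsub σ = t.gsub σ'
    | .var x, _, _, _, _, _, _, _, _ => by simp
    | .gvar u δ, _, _, _, _, σ, _, h, hσ => by
        cases h with
        | gvar h hu =>
          rcases hσ.code _ _ _ hu with h' | ⟨v, h', h''⟩
          · simp [GSub.appVar, h', h.gsub_expands hσ]
          · simp [GSub.appVar, h', h'', ← h.gsub_expands hσ, (h.fits.gsub σ).idOf_comp]
    | .zero, _, _, _, _, _, _, _, _ => by simp
    | .succ t, _, _, _, _, _, _, h, hσ => by cases h with | succ h => simp [h.gsub_expands hσ]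
    | .box t, _, _, _, _, _, _, h, hσ => by cases h with | box _ h => simp [h.gsub_expands hσ]
    | .letbox s t, _, _, _, _, _, _, h, hσ => by
        cases h with
        | letbox h _ _ _ h' =>
          simp [h.gsub_expands hσ, GSub.qTm, h'.gsub_expands ((hσ.gwk _).cons _ _)]
    | .lam t, _, _, _, _, _, _, h, hσ => by cases h with | lam h => simp [h.gsub_expands hσ]
    | .app t s, _, _, _, _, _, _, h, hσ => by
        cases h with | app h h' => simp [h.gsub_expands hσ, h'.gsub_expands hσ]
    | .mlam t, _, _, _, _, _, _, h, hσ => by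
        cases h with
        | mlam hΓ h => simp [GSub.qCtx, h.gsub_expands ((hσ.gwk _).cons _ _)]
    | .mapp t Γ, _, _, _, _, _, _, h, hσ => by
        cases h with
        | mapp h h' =>
          have := Γ.gwk_gsub hσ.restrictsCtx
          rw [LCtx.gwk_id] at this
          simp [h.gsub_expands hσ, this]
  theorem LSubTy.gsub_expands : ∀ {δ : LSub} {i : Layer} {Ψ : GCtx} {Γ Δ : LCtx}
      {σ σ' : GSub}, LSubTy i Ψ Γ δ Δ → GSub.Expands Ψ σ σ' → δ.gsub σ = δ.gsub σ'
    | .emp none m, _, _, _, _, _, _, h, hσ => by simp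
    | .emp (some g) m, _, _, _, _, _, _, h, hσ => by simp [hσ.ctx]
    | .wk g m, _, _, _, _, _, _, h, hσ => by simp [hσ.ctx]
    | .snoc δ t, _, _, _, _, _, _, h, hσ => by
        cases h with | snoc h h' => simp [h.gsub_expands hσ, h'.gsub_expands hσ]
end

/-- The entry `e` is skipped because `σ` is weakened past it. What is left is composition with the
identity, which turns each `v^id/u` into a genuine term, so the outcome is an expansion of `σ` and
not `σ` itself. -/
theorem GSubTy.expands_comp_idOf {Φ Ψ : GCtx} {σ : GSub} (h : GSubTy Φ σ Ψ) (e : GEntry) :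
    GSub.Expands Ψ σ (GSub.comp (GSub.gwk σ (.p .id)) (e :: GSub.idOf Φ)) where
  ctx n := by
    simp only [GSub.lookupCtx, GSub.getElem?_comp, GSub.getElem?_gwk]
    rcases Nat.lt_or_ge n Ψ.length with hn | hn
    · obtain ⟨B, hB⟩ := HasG.exists_of_lt hn
      cases B with
      | ctx =>
        obtain ⟨Γ, hΓ, hw⟩ := h.ctx_cases hB
        simp [hΓ, GEntry.gsub, hw.gsub_idOf]
      | code Δ T =>
        rcases h.code_cases hB with ⟨t, ht, _⟩ | ⟨v, hv, hv'⟩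
        · simp [ht, GEntry.gsub]
        · simp [hv, GEntry.gsub, hv'.getElem?_idOf_code]
    · simp [List.getElem?_eq_none (h.length_eq ▸ hn)]
  code u Δ T hu := by
    simp only [GSub.getElem?_comp, GSub.getElem?_gwk]
    rcases h.code_cases hu with ⟨t, ht, ht'⟩ | ⟨v, hv, hv'⟩
    · left; simp [ht, GEntry.gsub, ht'.gsub_idOf]
    · right; simp [hv, GEntry.gsub, hv'.getElem?_idOf_code]

/-- This computes the contractum of a substituted redex `(Λ g. t) $ D`: pushing `σ` and `δ` under
the binder and then instantiating amounts to extending `σ` by `D`. `TmTy.qTm_inst` does the same for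
`letbox`. -/
theorem TmTy.qCtx_inst {t : Tm} {Φ Ψ : GCtx} {Γ Δ D : LCtx} {T : Ty} {σ : GSub} {δ : LSub}
    (h : TmTy .one (.ctx :: Ψ) (Γ.gwk (.p .id)) t T) (hσ : GSubTy Φ σ Ψ)
    (hδ : LSubTy .one Φ Δ δ (Γ.gsub σ)) (hD : WfL .zero Φ D) :
    ((t.gsub (GSub.qCtx σ)).lsub (δ.gwk (.p .id))).gsub (.ctx D :: GSub.idOf Φ) =
      (t.gsub (.ctx D :: σ)).lsub δ := by
  have h' := h.gsub hσ.qCtx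
  rw [LCtx.gwk_p_gsub_qCtx] at h'
  have hδ' := hδ.gwk (γ := .p .id) (.pId (.ctx hσ.wfG))
  have e := h.gsub_expands ((hσ.expands_comp_idOf (.ctx D)).cons .ctx (.ctx D))
  rw [h'.lsub_gsub hδ' (.consCtx hD), h.gsub_gsub hσ.qCtx (.consCtx hD), LSub.gwk_p_gsub,
    hδ.gsub_idOf, e]
  simp [GSub.qCtx, GSub.comp, GEntry.gsub]

theorem TmTy.qTm_inst {t s : Tm} {Φ Ψ : GCtx} {Γ Δ D : LCtx} {S T : Ty} {σ : GSub} {δ : LSub}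
    (h : TmTy .one (.code D S :: Ψ) (Γ.gwk (.p .id)) t T) (hσ : GSubTy Φ σ Ψ)
    (hD : WfL .zero Ψ D) (hS : WfT .zero Ψ S)
    (hδ : LSubTy .one Φ Δ δ (Γ.gsub σ)) (hs : TmTy .zero Φ (D.gsub σ) s (S.gsub σ)) :
    ((t.gsub (GSub.qTm σ)).lsub (δ.gwk (.p .id))).gsub (.tm s :: GSub.idOf Φ) =
      (t.gsub (.tm s :: σ)).lsub δ := by
  have h' := h.gsub (hσ.qTm hD hS)
  rw [LCtx.gwk_p_gsub_qTm] at h'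
  have hδ' := hδ.gwk (γ := .p .id) (.pId (.code hs.wf.1 hs.wf.2))
  have e := h.gsub_expands ((hσ.expands_comp_idOf (.tm s)).cons (.code D S) (.tm s))
  rw [h'.lsub_gsub hδ' (.consTm hs), h.gsub_gsub (hσ.qTm hD hS) (.consTm hs), LSub.gwk_p_gsub,
    hδ.gsub_idOf, e]
  simp [GSub.qTm, GSub.comp, GEntry.gsub]

/-! ### Semantic types -/

/-- The clauses quantify over weakened and instantiated types, so the induction is on size and not
on the derivation. Instances `T[Γ/g]` do not grow, as context variables occur only inside local
contexts, which the size ignores. -/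
theorem WfT.semTy : ∀ {T : Ty} {i : Layer} {Ψ : GCtx}, WfT i Ψ T → SemTy i Ψ T
  | .nat, _, _, h => .nat h.wfG
  | .arr S T, _, _, h => by
      cases h with
      | arr hS hT => exact .arr (fun _ _ hγ => (hS.gwk hγ).semTy) (fun _ _ hγ => (hT.gwk hγ).semTy)
  | .box Δ T, _, _, h => by
      cases h with
      | box hΔ hT => exact .box hΔ (fun _ _ hγ => (hT.gwk hγ).semTy)
  | .pi T, _, _, h => by
      cases h with
      | pi hT =>
        exact .pi hT (fun _ _ _ hγ hΓ => ((hT.gwk hγ.qCtx).gsub (GSubTy.consCtx hΓ).wfCtx).semTy)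
termination_by T => T.size
decreasing_by all_goals simp only [Ty.size_gwk, Ty.size_gsub, Ty.size]; omega

theorem WfL.semLCtx : ∀ {Γ : LCtx} {i : Layer} {Ψ : GCtx}, WfL i Ψ Γ → SemLCtx i Ψ Γ
  | .nil, _, _, h => .nil h.wfG
  | .var g, _, _, h => by cases h with | var h hg => exact .var h hg
  | .snoc Γ T, _, _, h => by cases h with | snoc hΓ hT => exact .snoc hΓ.semLCtx hT.semTy

/-! ### Reducibility -/

/-- Reducibility as a typed relation. -/
abbrev RedRel (E : (i : Layer) → GenericEq i) (i : Layer) : TmRel :=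
  fun Ψ Γ t t' T => RedTm E i T Ψ Γ t t'

theorem redTm_nat {E : (i : Layer) → GenericEq i} {i : Layer} {Ψ : GCtx} {Γ : LCtx} {t t' : Tm} :
    RedTm E i .nat Ψ Γ t t' ↔ RedNat (E i).tm (E i).ne Ψ Γ t t' := by
  rw [RedTm]

theorem redTm_arr {E : (i : Layer) → GenericEq i} {i : Layer} {Ψ : GCtx} {Γ : LCtx} {t t' : Tm}
    {S T : Ty} : RedTm E i (.arr S T) Ψ Γ t t' ↔
      ∃ w w', Whnf Ψ Γ t w (.arr S T) ∧ Whnf Ψ Γ t' w' (.arr S T) ∧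
        (E i).tm Ψ Γ w w' (.arr S T) ∧
        ∀ γ τ Φ Δ, DWk γ τ Φ Δ Ψ Γ → ∀ s s', RedTm E i (S.gwk γ) Φ Δ s s' →
          RedTm E i (T.gwk γ) Φ Δ (.app (w.dwk γ τ) s) (.app (w'.dwk γ τ) s') := by
  rw [RedTm]

theorem redTm_box {E : (i : Layer) → GenericEq i} {Ψ : GCtx} {Γ Δ : LCtx} {t t' : Tm}
    {T : Ty} : RedTm E .one (.box Δ T) Ψ Γ t t' ↔
      ∃ w w', Whnf Ψ Γ t w (.box Δ T) ∧ Whnf Ψ Γ t' w' (.box Δ T) ∧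
        (E .one).tm Ψ Γ w w' (.box Δ T) ∧
        RedBoxNf (RedRel E .zero) (E .one).ne Ψ Γ Δ T w w' := by
  rw [RedTm]

theorem redTm_pi {E : (i : Layer) → GenericEq i} {Ψ : GCtx} {Γ : LCtx} {t t' : Tm}
    {T : Ty} : RedTm E .one (.pi T) Ψ Γ t t' ↔
      ∃ w w', Whnf Ψ Γ t w (.pi T) ∧ Whnf Ψ Γ t' w' (.pi T) ∧
        (E .one).tm Ψ Γ w w' (.pi T) ∧
        ∀ γ τ Φ Δ, DWk γ τ Φ Δ Ψ Γ → ∀ Δ', WfL .zero Φ Δ' →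
          RedTm E .one ((T.gwk (.q γ)).gsub (.ctx Δ' :: GSub.idOf Φ)) Φ Δ
            (.mapp (w.dwk γ τ) Δ') (.mapp (w'.dwk γ τ) Δ') := by
  rw [RedTm]

theorem not_redTm_zero_box {E : (i : Layer) → GenericEq i} {Ψ : GCtx} {Γ Δ : LCtx} {t t' : Tm}
    {T : Ty} : ¬ RedTm E .zero (.box Δ T) Ψ Γ t t' := by
  rw [RedTm]; exact id

theorem not_redTm_zero_pi {E : (i : Layer) → GenericEq i} {Ψ : GCtx} {Γ : LCtx} {t t' : Tm}
    {T : Ty} : ¬ RedTm E .zero (.pi T) Ψ Γ t t' := by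
  rw [RedTm]; exact id

section

variable {E : (i : Layer) → GenericEq i} {i : Layer} {Ψ : GCtx} {Γ : LCtx}

theorem RedTm.whnf {t t' : Tm} {T : Ty} (h : RedTm E i T Ψ Γ t t') :
    ∃ w w', Whnf Ψ Γ t w T ∧ Whnf Ψ Γ t' w' T ∧ (E i).tm Ψ Γ w w' T := by
  cases T with
  | nat =>
    rw [redTm_nat] at h
    cases h with | mk h1 h2 h3 _ => exact ⟨_, _, h1, h2, h3⟩
  | arr S T =>
    obtain ⟨w, w', h1, h2, h3, _⟩ := redTm_arr.1 h
    exact ⟨w, w', h1, h2, h3⟩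
  | box Δ T =>
    cases i with
    | zero => exact absurd h not_redTm_zero_box
    | one =>
      obtain ⟨w, w', h1, h2, h3, _⟩ := redTm_box.1 h
      exact ⟨w, w', h1, h2, h3⟩
  | pi T =>
    cases i with
    | zero => exact absurd h not_redTm_zero_pi
    | one =>
      obtain ⟨w, w', h1, h2, h3, _⟩ := redTm_pi.1 h
      exact ⟨w, w', h1, h2, h3⟩

/-- Reduction is typed at layer `1`, so layer-`1` typing is all that can be read off, also from
reducibility at layer `0`. -/
theorem RedTm.typed {t t' : Tm} {T : Ty} (h : RedTm E i T Ψ Γ t t') :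
    TmTy .one Ψ Γ t T ∧ TmTy .one Ψ Γ t' T := by
  obtain ⟨w, w', h1, h2, _⟩ := h.whnf
  exact ⟨h1.1.typed_left, h2.1.typed_left⟩

theorem RedTm.tm {t t' : Tm} {T : Ty} (h : RedTm E i T Ψ Γ t t') : (E i).tm Ψ Γ t t' T := by
  obtain ⟨w, w', h1, h2, h3⟩ := h.whnf
  exact (E i).whead h1 h2 h3

/-- Every clause speaks of the two terms only through their weak head normal forms. This closure
under expansion is what makes the β rules valid. -/
theorem RedTm.of_steps {s s' t t' : Tm} {T : Ty} (h : RedTm E i T Ψ Γ t t')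
    (hs : Steps Ψ Γ s t T) (hs' : Steps Ψ Γ s' t' T) : RedTm E i T Ψ Γ s s' := by
  cases T with
  | nat =>
    rw [redTm_nat] at h ⊢
    cases h with | mk h1 h2 h3 h4 => exact .mk (h1.of_steps hs) (h2.of_steps hs') h3 h4
  | arr S T =>
    obtain ⟨w, w', h1, h2, h3⟩ := redTm_arr.1 h
    exact redTm_arr.2 ⟨w, w', h1.of_steps hs, h2.of_steps hs', h3⟩
  | box Δ T =>
    cases i with
    | zero => exact absurd h not_redTm_zero_box
    | one =>
      obtain ⟨w, w', h1, h2, h3⟩ := redTm_box.1 h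
      exact redTm_box.2 ⟨w, w', h1.of_steps hs, h2.of_steps hs', h3⟩
  | pi T =>
    cases i with
    | zero => exact absurd h not_redTm_zero_pi
    | one =>
      obtain ⟨w, w', h1, h2, h3⟩ := redTm_pi.1 h
      exact redTm_pi.2 ⟨w, w', h1.of_steps hs, h2.of_steps hs', h3⟩

theorem GenericEq.tm_typed (G : GenericEq i) {t t' : Tm} {T : Ty} (h : G.tm Ψ Γ t t' T) :
    TmTy .one Ψ Γ t T ∧ TmTy .one Ψ Γ t' T := (G.tm_eq h).typed

theorem GenericEq.ne_whnf (G : GenericEq i) {v v' : Tm} {T : Ty} (h : G.ne Ψ Γ v v' T) :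
    Whnf Ψ Γ v v T ∧ Whnf Ψ Γ v' v' T :=
  ⟨⟨.refl (G.tm_typed (G.ne_tm h)).1, .ne (G.ne_isNe h).1⟩,
    ⟨.refl (G.tm_typed (G.ne_tm h)).2, .ne (G.ne_isNe h).2⟩⟩

/-- Related neutral terms are reducible. -/
theorem SemTy.redTm_of_ne {T : Ty} (hT : SemTy i Ψ T) : ∀ {Γ : LCtx} {v v' : Tm},
    (E i).ne Ψ Γ v v' T → RedTm E i T Ψ Γ v v' := by
  induction hT with
  | nat _ =>
    intro Γ v v' h
    have hw := (E _).ne_whnf h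
    exact redTm_nat.2 (.mk hw.1 hw.2 ((E _).ne_tm h) (.ne h))
  | arr _ _ _ ihT =>
    intro Γ v v' h
    have hw := (E _).ne_whnf h
    refine redTm_arr.2 ⟨v, v', hw.1, hw.2, (E _).ne_tm h, fun γ τ Φ Δ hd s s' hs => ?_⟩
    -- Reducible arguments are related by `≃`, which is what `ne_app` asks of them; hence no
    -- induction hypothesis for the domain is needed.
    exact ihT γ Φ hd.1 ((E _).ne_app ((E _).ne_mono hd h) hs.tm)
  | box _ _ _ =>
    intro Γ v v' h
    have hw := (E _).ne_whnf h
    exact redTm_box.2 ⟨v, v', hw.1, hw.2, (E _).ne_tm h, .ne h⟩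
  | pi _ _ ih =>
    intro Γ v v' h
    have hw := (E _).ne_whnf h
    refine redTm_pi.2 ⟨v, v', hw.1, hw.2, (E _).ne_tm h, fun γ τ Φ Δ hd Δ' hΔ' => ?_⟩
    exact ih γ Φ Δ' hd.1 hΔ' ((E _).ne_mapp rfl ((E _).ne_mono hd h) hΔ')

/-! ### Symmetry and transitivity -/

mutual
  theorem RedNat.symm : ∀ {t t' : Tm}, RedNat (E i).tm (E i).ne Ψ Γ t t' →
      RedNat (E i).tm (E i).ne Ψ Γ t' t
    | _, _, .mk h1 h2 h3 h4 => .mk h2 h1 ((E i).tm_symm h3) h4.symm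
  theorem RedNatNf.symm : ∀ {t t' : Tm}, RedNatNf (E i).tm (E i).ne Ψ Γ t t' →
      RedNatNf (E i).tm (E i).ne Ψ Γ t' t
    | _, _, .zero => .zero
    | _, _, .succ h => .succ h.symm
    | _, _, .ne h => .ne ((E i).ne_symm h)
end

mutual
  theorem RedNat.trans : ∀ {t t' t'' : Tm}, RedNat (E i).tm (E i).ne Ψ Γ t t' →
      RedNat (E i).tm (E i).ne Ψ Γ t' t'' → RedNat (E i).tm (E i).ne Ψ Γ t t''
    | _, _, _, .mk h1 h2 h3 h4, .mk h1' h2' h3' h4' => by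
        cases h2.det h1'
        exact .mk h1 h2' ((E i).tm_trans h3 h3') (h4.trans h4')
  theorem RedNatNf.trans : ∀ {t t' t'' : Tm}, RedNatNf (E i).tm (E i).ne Ψ Γ t t' →
      RedNatNf (E i).tm (E i).ne Ψ Γ t' t'' → RedNatNf (E i).tm (E i).ne Ψ Γ t t''
    | _, _, _, .zero, h => h
    | _, _, _, .succ h, h' => by
        cases h' with
        | succ h' => exact .succ (h.trans h')
        | ne h' => cases ((E i).ne_isNe h').1
    | _, _, _, .ne h, h' => by
        cases h' with
        | zero => cases ((E i).ne_isNe h).2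
        | succ h' => cases ((E i).ne_isNe h).2
        | ne h' => exact .ne ((E i).ne_trans h h')
end

theorem RedTm.symm {i : Layer} {T : Ty} {Ψ : GCtx} {Γ : LCtx} {t t' : Tm} (h : RedTm E i T Ψ Γ t t') :
    RedTm E i T Ψ Γ t' t := by
  match T with
  | .nat => exact redTm_nat.2 (redTm_nat.1 h).symm
  | .arr S T =>
    obtain ⟨w, w', h1, h2, h3, h4⟩ := redTm_arr.1 h
    exact redTm_arr.2 ⟨w', w, h2, h1, (E i).tm_symm h3, fun γ τ Φ Δ hd s s' hs =>
      (h4 γ τ Φ Δ hd s' s hs.symm).symm⟩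
  | .box Δ T =>
    cases i with
    | zero => exact absurd h not_redTm_zero_box
    | one =>
      obtain ⟨w, w', h1, h2, h3, h4⟩ := redTm_box.1 h
      refine redTm_box.2 ⟨w', w, h2, h1, (E _).tm_symm h3, ?_⟩
      cases h4 with
      | box h h' => exact .box h h'
      | ne h => exact .ne ((E _).ne_symm h)
  | .pi T =>
    cases i with
    | zero => exact absurd h not_redTm_zero_pi
    | one =>
      obtain ⟨w, w', h1, h2, h3, h4⟩ := redTm_pi.1 h
      exact redTm_pi.2 ⟨w', w, h2, h1, (E _).tm_symm h3, fun γ τ Φ Δ hd Δ' hΔ' =>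
        (h4 γ τ Φ Δ hd Δ' hΔ').symm⟩
termination_by T.size
decreasing_by all_goals simp only [Ty.size_gwk, Ty.size_gsub, Ty.size]; omega

theorem RedTm.trans {i : Layer} {T : Ty} {Ψ : GCtx} {Γ : LCtx} {t t' t'' : Tm} (h : RedTm E i T Ψ Γ t t')
    (h' : RedTm E i T Ψ Γ t' t'') : RedTm E i T Ψ Γ t t'' := by
  match T with
  | .nat => exact redTm_nat.2 ((redTm_nat.1 h).trans (redTm_nat.1 h'))
  | .arr S T =>
    obtain ⟨w₁, w₂, h1, h2, h3, h4⟩ := redTm_arr.1 h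
    obtain ⟨w₂', w₃, h1', h2', h3', h4'⟩ := redTm_arr.1 h'
    cases h2.det h1'
    exact redTm_arr.2 ⟨w₁, w₃, h1, h2', (E i).tm_trans h3 h3', fun γ τ Φ Δ hd s s' hs =>
      -- Symmetry and transitivity at the smaller type make `s` related to itself, so the functions
      -- can be changed one after the other.
      (h4 γ τ Φ Δ hd s s (hs.trans hs.symm)).trans (h4' γ τ Φ Δ hd s s' hs)⟩
  | .box Δ T =>
    cases i with
    | zero => exact absurd h not_redTm_zero_box
    | one =>
      obtain ⟨w₁, w₂, h1, h2, h3, h4⟩ := redTm_box.1 h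
      obtain ⟨w₂', w₃, h1', h2', h3', h4'⟩ := redTm_box.1 h'
      cases h2.det h1'
      refine redTm_box.2 ⟨w₁, w₃, h1, h2', (E _).tm_trans h3 h3', ?_⟩
      cases h4 with
      | box _ _ => exact h4'
      | ne h =>
        cases h4' with
        | box _ _ => cases ((E _).ne_isNe h).2
        | ne h' => exact .ne ((E _).ne_trans h h')
  | .pi T =>
    cases i with
    | zero => exact absurd h not_redTm_zero_pi
    | one =>
      obtain ⟨w₁, w₂, h1, h2, h3, h4⟩ := redTm_pi.1 h
      obtain ⟨w₂', w₃, h1', h2', h3', h4'⟩ := redTm_pi.1 h'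
      cases h2.det h1'
      exact redTm_pi.2 ⟨w₁, w₃, h1, h2', (E _).tm_trans h3 h3', fun γ τ Φ Δ hd Δ' hΔ' =>
        (h4 γ τ Φ Δ hd Δ' hΔ').trans (h4' γ τ Φ Δ hd Δ' hΔ')⟩
termination_by T.size
decreasing_by all_goals simp only [Ty.size_gwk, Ty.size_gsub, Ty.size]; omega

/-! ### Reducible local substitutions -/

theorem RedLSub.symm : ∀ {Δ : LCtx} {δ δ' : LSub}, RedLSub (RedRel E i) Ψ Γ δ δ' Δ →
    RedLSub (RedRel E i) Ψ Γ δ' δ Δ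
  | .nil, _, _, ⟨h1, h2, h3⟩ => ⟨h1, h3, h2⟩
  | .var _, _, _, ⟨h1, h2, h3, h4⟩ => ⟨h1, h2, h4, h3⟩
  | .snoc _ _, _, _, ⟨_, _, _, _, h1, h2, h3, h4⟩ => ⟨_, _, _, _, h2, h1, h3.symm, h4.symm⟩

theorem RedLSub.trans : ∀ {Δ : LCtx} {δ δ' δ'' : LSub}, RedLSub (RedRel E i) Ψ Γ δ δ' Δ →
    RedLSub (RedRel E i) Ψ Γ δ' δ'' Δ → RedLSub (RedRel E i) Ψ Γ δ δ'' Δ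
  | .nil, _, _, _, ⟨h1, h2, _⟩, ⟨_, _, h3⟩ => ⟨h1, h2, h3⟩
  | .var _, _, _, _, ⟨h1, h2, h3, _⟩, ⟨_, _, _, h4⟩ => ⟨h1, h2, h3, h4⟩
  | .snoc _ _, _, _, _, ⟨_, _, _, _, h1, h2, h3, h4⟩, ⟨_, _, _, _, h1', h2', h3', h4'⟩ => by
      subst h2
      simp only [LSub.snoc.injEq] at h1'
      obtain ⟨rfl, rfl⟩ := h1'
      exact ⟨_, _, _, _, h1, h2', h3.trans h3', RedTm.trans h4 h4'⟩

theorem RedLSub.wfL : ∀ {Δ : LCtx} {δ δ' : LSub}, RedLSub (RedRel E i) Ψ Γ δ δ' Δ →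
    WfL .one Ψ Γ
  | .nil, _, _, ⟨h1, _⟩ => h1
  | .var _, _, _, ⟨h1, _⟩ => h1
  | .snoc _ _, _, _, ⟨_, _, _, _, _, _, h3, _⟩ => h3.wfL

theorem RedLSub.typed : ∀ {Δ : LCtx} {δ δ' : LSub}, RedLSub (RedRel E i) Ψ Γ δ δ' Δ →
    LSubTy .one Ψ Γ δ Δ ∧ LSubTy .one Ψ Γ δ' Δ
  | .nil, _, _, ⟨h1, h2, h3⟩ => by subst h2 h3; exact ⟨.emp_base h1, .emp_base h1⟩
  | .var _, _, _, ⟨h1, h2, h3, h4⟩ => by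
      subst h3 h4
      exact ⟨.wk h1 (h1.hasG_base h2) h2, .wk h1 (h1.hasG_base h2) h2⟩
  | .snoc _ _, _, _, ⟨_, _, _, _, h1, h2, h3, h4⟩ => by
      subst h1 h2
      exact ⟨.snoc h3.typed.1 (RedTm.typed h4).1, .snoc h3.typed.2 (RedTm.typed h4).2⟩

theorem RedLSub.genLSub : ∀ {Δ : LCtx} {δ δ' : LSub}, RedLSub (RedRel E i) Ψ Γ δ δ' Δ →
    GenLSub (E i).tm Ψ Γ δ δ' Δ
  | .nil, _, _, ⟨h1, h2, h3⟩ => by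
      subst h2 h3
      rcases hb : Γ.base with _ | g
      · exact .emp h1 hb
      · exact .empVar h1 (h1.hasG_base hb) hb
  | .var _, _, _, ⟨h1, h2, h3, h4⟩ => by
      subst h3 h4
      exact .wk h1 (h1.hasG_base h2) h2
  | .snoc _ _, _, _, ⟨_, _, _, _, h1, h2, h3, h4⟩ => by
      subst h1 h2
      exact .snoc h3.genLSub (RedTm.tm h4)

theorem RedLSub.lookup {Δ : LCtx} {x : ℕ} {T : Ty} (hx : HasL Δ x T) : ∀ {δ δ' : LSub},
    RedLSub (RedRel E i) Ψ Γ δ δ' Δ → RedTm E i T Ψ Γ (δ.lookup x) (δ'.lookup x) := by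
  induction hx with
  | here =>
    rintro δ δ' ⟨_, _, _, _, h1, h2, h3, h4⟩
    subst h1 h2; simpa using h4
  | there _ ih =>
    rintro δ δ' ⟨_, _, _, _, h1, h2, h3, h4⟩
    subst h1 h2; simpa using ih h3

/-! ### Monotonicity -/

mutual
  theorem RedNat.dwk {Φ : GCtx} {Δ : LCtx} {γ τ : Wk} (hd : DWk γ τ Φ Δ Ψ Γ) :
      ∀ {t t' : Tm}, RedNat (E i).tm (E i).ne Ψ Γ t t' →
      RedNat (E i).tm (E i).ne Φ Δ (t.dwk γ τ) (t'.dwk γ τ)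
    | _, _, .mk h1 h2 h3 h4 =>
        .mk (h1.dwk hd) (h2.dwk hd) ((E i).tm_mono hd h3) (h4.dwk hd)
  theorem RedNatNf.dwk {Φ : GCtx} {Δ : LCtx} {γ τ : Wk} (hd : DWk γ τ Φ Δ Ψ Γ) :
      ∀ {t t' : Tm}, RedNatNf (E i).tm (E i).ne Ψ Γ t t' →
      RedNatNf (E i).tm (E i).ne Φ Δ (t.dwk γ τ) (t'.dwk γ τ)
    | _, _, .zero => .zero
    | _, _, .succ h => .succ (h.dwk hd)
    | _, _, .ne h => .ne ((E i).ne_mono hd h)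
end

end

/-- Reducibility at layer `i` is preserved by weakenings. -/
def RedMono (E : (i : Layer) → GenericEq i) (i : Layer) : Prop :=
  ∀ {T : Ty} {Φ Ψ : GCtx} {Γ Δ : LCtx} {γ τ : Wk} {t t' : Tm}, DWk γ τ Φ Δ Ψ Γ →
    RedTm E i T Ψ Γ t t' → RedTm E i (T.gwk γ) Φ Δ (t.dwk γ τ) (t'.dwk γ τ)

/-- Code of layer `0` maps related local substitutions to related terms at layer `i`. -/
def CodeRed (E : (i : Layer) → GenericEq i) (i : Layer) : Prop :=
  ∀ {Ψ : GCtx} {Γ Δ : LCtx} {t : Tm} {T : Ty} {δ δ' : LSub}, TmTy .zero Ψ Γ t T →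
    RedLSub (RedRel E i) Ψ Δ δ δ' Γ → RedTm E i T Ψ Δ (t.lsub δ) (t.lsub δ')

section

variable {E : (i : Layer) → GenericEq i} {i : Layer} {Ψ : GCtx} {Γ : LCtx}

/-- The function clauses quantify over all weakenings, which compose, and at `Nat` the monotonicity
of `≃`, `∼` and reduction suffices. The clause for `box s` speaks only of substitutions over the
present `Ψ`, so after weakening its condition is proved afresh from the typing of `s`; this is the
purpose of `hc`. -/
theorem redMono_of_codeRed (hc : i = .one → CodeRed E .zero) : RedMono E i := by
  intro T Φ Ψ Γ Δ γ τ t t' hd h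
  cases T with
  | nat => exact redTm_nat.2 ((redTm_nat.1 h).dwk hd)
  | arr S T =>
    obtain ⟨w, w', h1, h2, h3, h4⟩ := redTm_arr.1 h
    refine redTm_arr.2 ⟨_, _, h1.dwk hd, h2.dwk hd, (E i).tm_mono hd h3,
      fun γ' τ' Φ' Δ' hd' s s' hs => ?_⟩
    rw [Ty.gwk_comp] at hs ⊢
    rw [Tm.dwk_dwk, Tm.dwk_dwk]
    exact h4 _ _ _ _ (hd.comp hd') s s' hs
  | box Δ' T =>
    cases i with
    | zero => exact absurd h not_redTm_zero_box
    | one =>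
      obtain ⟨w, w', h1, h2, h3, h4⟩ := redTm_box.1 h
      refine redTm_box.2 ⟨_, _, h1.dwk hd, h2.dwk hd, (E _).tm_mono hd h3, ?_⟩
      cases h4 with
      | box ht _ => exact .box (ht.gwk hd.1) fun _ _ _ hδ => hc rfl (ht.gwk hd.1) hδ
      | ne h => exact .ne ((E _).ne_mono hd h)
  | pi T =>
    cases i with
    | zero => exact absurd h not_redTm_zero_pi
    | one =>
      obtain ⟨w, w', h1, h2, h3, h4⟩ := redTm_pi.1 h
      refine redTm_pi.2 ⟨_, _, h1.dwk hd, h2.dwk hd, (E _).tm_mono hd h3,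
        fun γ' τ' Φ' Δ' hd' D hD => ?_⟩
      rw [Ty.gwk_comp, Tm.dwk_dwk, Tm.dwk_dwk]
      exact h4 _ _ _ _ (hd.comp hd') D hD

/-- `δ[γ; τ]`. -/
def LSub.dwk (δ : LSub) (γ τ : Wk) : LSub := (δ.gwk γ).lwk τ

theorem RedLSub.dwk (hm : RedMono E i) {Φ : GCtx} {Δ : LCtx} {γ τ : Wk}
    (hd : DWk γ τ Φ Δ Ψ Γ) : ∀ {Δ' : LCtx} {δ δ' : LSub}, RedLSub (RedRel E i) Ψ Γ δ δ' Δ' →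
    RedLSub (RedRel E i) Φ Δ (δ.dwk γ τ) (δ'.dwk γ τ) (Δ'.gwk γ)
  | .nil, _, _, ⟨h1, h2, h3⟩ => by
      have hl := hd.2.len_eq
      have hb := hd.2.base_eq
      simp only [LCtx.len_gwk, LCtx.base_gwk] at hl hb
      subst h2 h3
      exact ⟨hd.2.wfL_left, by simp [LSub.dwk, hl, hb], by simp [LSub.dwk, hl, hb]⟩
  | .var _, _, _, ⟨h1, h2, h3, h4⟩ => by
      have hl := hd.2.len_eq
      have hb := hd.2.base_eq
      simp only [LCtx.len_gwk, LCtx.base_gwk] at hl hb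
      subst h3 h4
      exact ⟨hd.2.wfL_left, by simp [hb, h2], by simp [LSub.dwk, hl], by simp [LSub.dwk, hl]⟩
  | .snoc _ _, _, _, ⟨_, _, _, _, h1, h2, h3, h4⟩ => by
      subst h1 h2
      exact ⟨_, _, _, _, rfl, rfl, RedLSub.dwk hm hd h3, hm hd h4⟩

/-! ### Introduction and elimination -/

theorem Ty.gwk_q_id (T : Ty) : T.gwk (.q .id) = T := by
  rw [T.gwk_congr (γ' := .id) (fun n => by simp [Wk.act_q_id]), T.gwk_id]

theorem RedTm.app {t t' s s' : Tm} {S T : Ty} (h : RedTm E i (.arr S T) Ψ Γ t t')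
    (hs : RedTm E i S Ψ Γ s s') : RedTm E i T Ψ Γ (.app t s) (.app t' s') := by
  obtain ⟨w, w', h1, h2, h3, h4⟩ := redTm_arr.1 h
  have := h4 _ _ _ _ (DWk.id hs.typed.1.wf.1) s s' (by simpa using hs)
  simp only [Tm.dwk_id_id, Ty.gwk_id] at this
  exact this.of_steps (h1.1.app hs.typed.1) (h2.1.app hs.typed.2)

theorem RedTm.mapp {t t' : Tm} {T : Ty} {Δ : LCtx} (h : RedTm E .one (.pi T) Ψ Γ t t')
    (hΔ : WfL .zero Ψ Δ) :
    RedTm E .one (T.gsub (.ctx Δ :: GSub.idOf Ψ)) Ψ Γ (.mapp t Δ) (.mapp t' Δ) := by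
  obtain ⟨w, w', h1, h2, h3, h4⟩ := redTm_pi.1 h
  have := h4 _ _ _ _ (DWk.id h.typed.1.wf.1) Δ hΔ
  simp only [Tm.dwk_id_id, Ty.gwk_q_id] at this
  exact this.of_steps (h1.1.mapp hΔ) (h2.1.mapp hΔ)

theorem redTm_var {x : ℕ} {T : Ty} (hT : WfT i Ψ T) (h : TmTy .one Ψ Γ (.var x) T) :
    RedTm E i T Ψ Γ (.var x) (.var x) :=
  hT.semTy.redTm_of_ne ((E i).ne_var h)

/-- The relation `w ≃ w'` in the clause for arrows comes for free: by the extensionality law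
`tm_fun` it is enough to apply both sides to a fresh variable, which is reducible because it is
neutral. -/
theorem redTm_arr_intro {t t' w w' : Tm} {S T : Ty} (hS : WfT i Ψ S)
    (ht : Whnf Ψ Γ t w (.arr S T)) (ht' : Whnf Ψ Γ t' w' (.arr S T))
    (h : ∀ γ τ Φ Δ, DWk γ τ Φ Δ Ψ Γ → ∀ s s', RedTm E i (S.gwk γ) Φ Δ s s' →
      RedTm E i (T.gwk γ) Φ Δ (.app (w.dwk γ τ) s) (.app (w'.dwk γ τ) s')) :
    RedTm E i (.arr S T) Ψ Γ t t' := by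
  refine redTm_arr.2 ⟨w, w', ht, ht', ?_, h⟩
  have hΓ := ht.1.typed_left.wf.1
  refine (E i).tm_fun ht.1.typed_right ht'.1.typed_right ?_
  have := h _ _ _ _ (DWk.pLocal hΓ hS.toOne) (.var 0) (.var 0)
    (redTm_var (by simpa using hS) (by simpa using .var (.snoc hΓ hS.toOne) .here))
  simp only [Tm.dwk, Tm.gwk_id, Ty.gwk_id] at this
  exact this.tm

/-- Here `tm_mfun` plays the role of extensionality, with the fresh context variable as argument. -/
theorem redTm_pi_intro {t t' w w' : Tm} {T : Ty} (ht : Whnf Ψ Γ t w (.pi T))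
    (ht' : Whnf Ψ Γ t' w' (.pi T))
    (h : ∀ γ τ Φ Δ, DWk γ τ Φ Δ Ψ Γ → ∀ Δ', WfL .zero Φ Δ' →
      RedTm E .one ((T.gwk (.q γ)).gsub (.ctx Δ' :: GSub.idOf Φ)) Φ Δ
        (.mapp (w.dwk γ τ) Δ') (.mapp (w'.dwk γ τ) Δ')) :
    RedTm E .one (.pi T) Ψ Γ t t' := by
  refine redTm_pi.2 ⟨w, w', ht, ht', ?_, h⟩
  have hw := ht.1.typed_left.wf
  cases hw.2 with
  | pi hT =>
    have hΨ := hw.1.wfG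
    refine (E .one).tm_mfun rfl ht.1.typed_right ht'.1.typed_right ?_
    have := h _ _ _ _ (DWk.ofGWk hw.1 (.pId (.ctx hΨ))) (.var 0) (.var (.ctx hΨ) .here)
    rw [hT.gwk_q_p_gsub] at this
    simp only [Tm.dwk, Tm.lwk_id] at this
    exact this.tm

end

/-! ### Validity at a semantic layer -/

/-- Well-typed global substitutions whose term entries, if any, act on reducible local
substitutions at layer `j`. -/
structure GoodGSub (E : (i : Layer) → GenericEq i) (j : Layer) (Φ : GCtx) (σ : GSub)
    (Ψ : GCtx) : Prop where
  typed : GSubTy Φ σ Ψ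
  codeRed : ∀ t, GEntry.tm t ∈ σ → CodeRed E j

/-- Valid equivalence of terms with respect to reducibility at layer `j`. -/
def ValidAt (E : (i : Layer) → GenericEq i) (j : Layer) (Ψ : GCtx) (Γ : LCtx) (t t' : Tm)
    (T : Ty) : Prop :=
  ∀ {Φ σ}, GoodGSub E j Φ σ Ψ → ∀ {Δ δ δ'}, RedLSub (RedRel E j) Φ Δ δ δ' (Γ.gsub σ) →
    RedTm E j (T.gsub σ) Φ Δ ((t.gsub σ).lsub δ) ((t'.gsub σ).lsub δ')

/-- Valid equivalence of local substitutions with respect to reducibility at layer `j`. -/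
def ValidSubAt (E : (i : Layer) → GenericEq i) (j : Layer) (Ψ : GCtx) (Γ : LCtx)
    (δ δ' : LSub) (Δ : LCtx) : Prop :=
  ∀ {Φ σ}, GoodGSub E j Φ σ Ψ → ∀ {Δ' ε ε'}, RedLSub (RedRel E j) Φ Δ' ε ε' (Γ.gsub σ) →
    RedLSub (RedRel E j) Φ Δ' ((δ.gsub σ).comp ε) ((δ'.gsub σ).comp ε') (Δ.gsub σ)

section

variable {E : (i : Layer) → GenericEq i} {j : Layer} {Φ Ψ : GCtx} {Γ : LCtx}

/-- Once `CodeRed` is available, typing alone qualifies a global substitution for use in `ValidAt`.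
-/
theorem GSubTy.good {σ : GSub} (h : GSubTy Φ σ Ψ) (hc : CodeRed E j) : GoodGSub E j Φ σ Ψ :=
  ⟨h, fun _ _ => hc⟩

theorem GoodGSub.gwk {Φ' : GCtx} {σ : GSub} {γ : Wk} (h : GoodGSub E j Φ σ Ψ)
    (hγ : GWk γ Φ' Φ) : GoodGSub E j Φ' (GSub.gwk σ γ) Ψ := by
  refine ⟨h.typed.gwk hγ, fun t ht => ?_⟩
  simp only [GSub.gwk, List.mem_map] at ht
  obtain ⟨e, he, he'⟩ := ht
  cases e with
  | tm s => exact h.codeRed s he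
  | _ => simp at he'

theorem GoodGSub.bvId (hΨ : WfG Ψ) : GoodGSub E j Ψ (GSub.bvId Ψ) Ψ :=
  ⟨.bvId hΨ, fun t ht => absurd ht (GSub.bvId_no_tm Ψ t)⟩

theorem LSubTy.dwk {Φ' : GCtx} {Δ Δ' : LCtx} {δ : LSub} {γ τ : Wk} (h : LSubTy .one Φ Δ δ Γ)
    (hd : DWk γ τ Φ' Δ' Φ Δ) : LSubTy .one Φ' Δ' (δ.dwk γ τ) (Γ.gwk γ) :=
  (h.gwk hd.1).lwk hd.2

theorem Tm.lsub_dwk (t : Tm) (δ : LSub) (γ τ : Wk) :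
    (t.lsub δ).dwk γ τ = (t.gwk γ).lsub (δ.dwk γ τ) := by
  rw [Tm.dwk, Tm.lsub_gwk, Tm.lsub_lwk]; rfl

/-! ### Reductions of substituted redexes -/

/-- There is a single β step; the work is the equation `e`, which merges the lifted `δ`, the
weakening and the argument into the one substitution `δ[γ; τ], s`, the form in which validity of the
body can be applied. -/
theorem Steps.betaLam_sub {Φ' : GCtx} {Δ Δ' : LCtx} {σ : GSub} {δ : LSub} {γ τ : Wk} {t s : Tm}
    {S T : Ty} (ht : TmTy .one Ψ (.snoc Γ S) t T) (hσ : GSubTy Φ σ Ψ)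
    (hδ : LSubTy .one Φ Δ δ (Γ.gsub σ)) (hd : DWk γ τ Φ' Δ' Φ Δ)
    (hs : TmTy .one Φ' Δ' s ((S.gsub σ).gwk γ)) :
    Steps Φ' Δ' (.app ((((Tm.lam t).gsub σ).lsub δ).dwk γ τ) s)
      ((t.gsub (GSub.gwk σ γ)).lsub (.snoc (δ.dwk γ τ) s)) ((T.gsub σ).gwk γ) := by
  have htσ := ht.gsub hσ
  cases htσ.wf.1 with
  | snoc hΓ hS =>
    have hδ' := hδ.dwk hd
    have htγ := htσ.gwk hd.1
    have hb := (htσ.lsub (hδ.q hS)).gwk hd.1 |>.lwk (.q hd.2 (hS.gwk hd.1))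
    have e : ((((t.gsub σ).lsub (.snoc (δ.lwk (.p .id)) (.var 0))).gwk γ).lwk (.q τ)).lsub
        (.snoc (LSub.idOf Δ') s) = (t.gsub (GSub.gwk σ γ)).lsub (.snoc (δ.dwk γ τ) s) := by
      rw [Tm.lsub_gwk, Tm.gsub_gwk, Tm.lsub_lwk, Tm.lsub_lsub]
      simp only [LSub.gwk, LSub.lwk, Tm.gwk, Tm.lwk, Wk.act, LSub.comp, Tm.lsub, LSub.lookup]
      rw [← LSub.gwk_lwk, LSub.lwk_p_q, LSub.lwk_p_comp]
      have := hδ'.comp_idOf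
      rw [LSub.dwk] at this
      rw [this, LSub.dwk]
    refine .head (.betaLam hb hs) ?_
    rw [e, ← Tm.gsub_gwk]
    exact .refl (htγ.lsub (.snoc hδ' hs))

theorem Ty.qCtx_gwk_inst {Φ' : GCtx} {σ : GSub} {γ : Wk} (hσ : GSubTy Φ σ Ψ) (hγ : GWk γ Φ' Φ)
    (T : Ty) (D : LCtx) :
    ((T.gsub (GSub.qCtx σ)).gwk (.q γ)).gsub (.ctx D :: GSub.idOf Φ') =
      T.gsub (.ctx D :: GSub.gwk σ γ) := by
  rw [Ty.gsub_gwk, GSub.qCtx_gwk, (hσ.gwk hγ).wfCtx.gsub_qCtx]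

theorem Steps.betaMlam_sub {Φ' : GCtx} {Δ Δ' D : LCtx} {σ : GSub} {δ : LSub} {γ τ : Wk} {t : Tm}
    {T : Ty} (ht : TmTy .one (.ctx :: Ψ) (Γ.gwk (.p .id)) t T) (hσ : GSubTy Φ σ Ψ)
    (hδ : LSubTy .one Φ Δ δ (Γ.gsub σ)) (hd : DWk γ τ Φ' Δ' Φ Δ) (hD : WfL .zero Φ' D) :
    Steps Φ' Δ' (.mapp ((((Tm.mlam t).gsub σ).lsub δ).dwk γ τ) D)
      ((t.gsub (.ctx D :: GSub.gwk σ γ)).lsub (δ.dwk γ τ)) (T.gsub (.ctx D :: GSub.gwk σ γ)) := by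
  have hσγ := hσ.gwk hd.1
  have hδ' := hδ.dwk hd
  rw [LCtx.gsub_gwk] at hδ'
  have htσ := ht.gsub hσγ.qCtx
  rw [LCtx.gwk_p_gsub_qCtx] at htσ
  have hb := htσ.lsub (hδ'.gwk (.pId (.ctx hσγ.wfG)))
  have e : ((((Tm.mlam t).gsub σ).lsub δ).dwk γ τ) =
      .mlam ((t.gsub (GSub.qCtx (GSub.gwk σ γ))).lsub ((δ.dwk γ τ).gwk (.p .id))) := by
    rw [Tm.lsub_dwk, Tm.gsub_gwk]; simp
  have hr := TmTy.qCtx_inst ht hσγ hδ' hD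
  rw [e, ← hr, ← hσγ.wfCtx.gsub_qCtx]
  exact .head (.betaMlam hδ'.wf.1 hb hD) (.refl (TmTy.gsub_ctx hδ'.wf.1 hb hD))

/-! ### Validity of the term and substitution formers -/

theorem ValidAt.symm {t t' : Tm} {T : Ty} (h : ValidAt E j Ψ Γ t t' T) :
    ValidAt E j Ψ Γ t' t T :=
  fun hσ _ _ _ hδ => (h hσ hδ.symm).symm

theorem ValidAt.trans {t t' t'' : Tm} {T : Ty} (h : ValidAt E j Ψ Γ t t' T)
    (h' : ValidAt E j Ψ Γ t' t'' T) : ValidAt E j Ψ Γ t t'' T :=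
  -- The middle term is instantiated by the left substitution in the first half and so that both
  -- halves meet, `δ` is first related to itself.
  fun hσ _ _ _ hδ => (h hσ (hδ.trans hδ.symm)).trans (h' hσ hδ)

theorem ValidAt.var {x : ℕ} {T : Ty} (hx : HasL Γ x T) :
    ValidAt E j Ψ Γ (.var x) (.var x) T :=
  fun {_ σ} _ _ _ _ hδ => hδ.lookup (hx.gsub σ)

theorem ValidAt.gvar {u : ℕ} {Δ : LCtx} {δ δ' : LSub} {T : Ty}
    (hδ : ValidSubAt E j Ψ Γ δ δ' Δ) (hu : HasG Ψ u (.code Δ T)) :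
    ValidAt E j Ψ Γ (.gvar u δ) (.gvar u δ') T := by
  intro Φ σ hσ Δ' ε ε' hε
  have h := hδ hσ hε
  simp only [Tm.gsub, GSub.appVar_lsub]
  -- If `σ` supplies code for `u`, then `CodeRed` lets it act on the related substitutions; if it
  -- supplies `v^id`, both sides are neutral and related by `ne_gvar`.
  rcases hσ.typed.code_cases hu with ⟨t, ht, h'⟩ | ⟨v, hv, h'⟩
  · simp only [GSub.appVar, ht]
    exact hσ.codeRed t (List.mem_of_getElem? ht) h' h
  · simp only [GSub.appVar, hv]
    exact ((h'.wfT hσ.typed.wfG).lift j).semTy.redTm_of_ne ((E j).ne_gvar h' h.genLSub)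

theorem ValidAt.zero : ValidAt E j Ψ Γ .zero .zero .nat := by
  intro Φ σ hσ Δ δ δ' hδ
  have hw : Whnf Φ Δ .zero .zero .nat := ⟨.refl (.zero hδ.wfL), .zero⟩
  exact redTm_nat.2 (.mk hw hw ((E j).tm_zero hδ.wfL) .zero)

theorem ValidAt.succ {t t' : Tm} (h : ValidAt E j Ψ Γ t t' .nat) :
    ValidAt E j Ψ Γ (.succ t) (.succ t') .nat := by
  intro Φ σ hσ Δ δ δ' hδ
  have h := h hσ hδ
  exact redTm_nat.2 (.mk ⟨.refl (.succ h.typed.1), .succ⟩ ⟨.refl (.succ h.typed.2), .succ⟩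
    ((E j).tm_succ h.tm) (.succ (redTm_nat.1 h)))

theorem ValidAt.app {t t' s s' : Tm} {S T : Ty} (h : ValidAt E j Ψ Γ t t' (.arr S T))
    (hs : ValidAt E j Ψ Γ s s' S) : ValidAt E j Ψ Γ (.app t s) (.app t' s') T :=
  fun hσ _ _ _ hδ => RedTm.app (h hσ hδ) (hs hσ hδ)

theorem ValidAt.lam (hm : RedMono E j) {t t' : Tm} {S T : Ty}
    (ht : TmTy j Ψ (.snoc Γ S) t T) (ht' : TmTy j Ψ (.snoc Γ S) t' T)
    (h : ValidAt E j Ψ (.snoc Γ S) t t' T) :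
    ValidAt E j Ψ Γ (.lam t) (.lam t') (.arr S T) := by
  intro Φ σ hσ Δ δ δ' hδ
  cases ht.wf.1 with
  | snoc hΓ hS =>
    have htσ := ((TmTy.lam ht).gsub hσ.typed).toOne.lsub hδ.typed.1
    have htσ' := ((TmTy.lam ht').gsub hσ.typed).toOne.lsub hδ.typed.2
    refine redTm_arr_intro (hS.gsub hσ.typed.wfCtx) ⟨.refl htσ, .lam⟩ ⟨.refl htσ', .lam⟩
      fun γ τ Φ' Δ' hd s s' hs => ?_
    have h1 := Steps.betaLam_sub ht.toOne hσ.typed hδ.typed.1 hd hs.typed.1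
    have h2 := Steps.betaLam_sub ht'.toOne hσ.typed hδ.typed.2 hd hs.typed.2
    refine RedTm.of_steps ?_ h1 h2
    rw [Ty.gsub_gwk] at hs ⊢
    -- The argument lives over a weakened context, so `δ` and `δ'` have to be carried there; this is
    -- where monotonicity is used.
    have hδ' := RedLSub.dwk hm hd hδ
    rw [LCtx.gsub_gwk] at hδ'
    exact h (hσ.gwk hd.1) ⟨_, _, _, _, rfl, rfl, hδ', hs⟩

theorem ValidSubAt.emp_none {m : ℕ} : ValidSubAt E j Ψ Γ (.emp none m) (.emp none m) .nil := by
  intro Φ σ hσ Δ' ε ε' hε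
  refine ⟨hε.wfL, ?_, ?_⟩
  · simp [hε.typed.1.chk_eq, hε.typed.1.hat_eq]
  · simp [hε.typed.2.chk_eq, hε.typed.2.hat_eq]

theorem ValidSubAt.emp_some {m g : ℕ} (hb : Γ.base = some g) :
    ValidSubAt E j Ψ Γ (.emp (some g) m) (.emp (some g) m) .nil := by
  intro Φ σ hσ Δ' ε ε' hε
  have hb' := (LCtx.len_gsub_of_base_some σ hb).2
  -- If `σ(g)` ends with `·`, the substituted base inherits its context variable from `ε`. Otherwise
  -- it keeps its own variable, and the typing of `ε` shows that `Δ'` ends with the same one.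
  rcases hg : (GSub.lookupCtx σ g).base with _ | g'
  · refine ⟨hε.wfL, ?_, ?_⟩
    · simp [hε.typed.1.chk_eq, hε.typed.1.hat_eq, hg]
    · simp [hε.typed.2.chk_eq, hε.typed.2.hat_eq, hg]
  · have := hε.typed.1.base_eq (hb'.trans hg)
    refine ⟨hε.wfL, ?_, ?_⟩
    · simp [hε.typed.1.hat_eq, hg, this]
    · simp [hε.typed.2.hat_eq, hg, this]

/-- `Γ[σ]` is `σ(g)` extended by `|Γ|` types, so removing `|Γ|` entries leaves the component at
`σ(g)`. -/
theorem RedLSub.drop_base {σ : GSub} {g : ℕ} {Δ : LCtx} : ∀ {Γ : LCtx} {ε ε' : LSub},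
    Γ.base = some g → RedLSub (RedRel E j) Φ Δ ε ε' (Γ.gsub σ) →
    RedLSub (RedRel E j) Φ Δ (ε.drop Γ.len) (ε'.drop Γ.len) (GSub.lookupCtx σ g)
  | .nil, _, _, hb, _ => by simp at hb
  | .var _, _, _, hb, h => by simp at hb; subst hb; simpa [LSub.drop] using h
  | .snoc Γ _, _, _, hb, ⟨_, _, _, _, h1, h2, h3, h4⟩ => by
      subst h1 h2
      simpa [LSub.drop] using RedLSub.drop_base (by simpa using hb) h3

theorem ValidSubAt.wk {g : ℕ} (hb : Γ.base = some g) :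
    ValidSubAt E j Ψ Γ (.wk g Γ.len) (.wk g Γ.len) (.var g) := by
  intro Φ σ hσ Δ' ε ε' hε
  have h := hε.drop_base hb
  simp only [LSub.gsub, LSub.idOf_lwk_pn, LCtx.gsub]
  rw [LSub.wkOf_comp _ _ _ h.typed.1.fits, LSub.wkOf_comp _ _ _ h.typed.2.fits]
  exact h

theorem ValidSubAt.snoc {Δ : LCtx} {δ δ' : LSub} {t t' : Tm} {T : Ty}
    (hδ : ValidSubAt E j Ψ Γ δ δ' Δ) (ht : ValidAt E j Ψ Γ t t' T) :
    ValidSubAt E j Ψ Γ (.snoc δ t) (.snoc δ' t') (.snoc Δ T) :=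
  fun hσ _ _ _ hε => ⟨_, _, _, _, rfl, rfl, hδ hσ hε, ht hσ hε⟩

end

/-! ### The fundamental theorem for layer `0` at both semantic layers -/

section

variable {E : (i : Layer) → GenericEq i} {j : Layer}

mutual
  -- Syntactic and semantic layer are decoupled: with `j = .one` this says that code may be run on
  -- substitutions reducible at layer `1`. Since `box` and `letbox` do not occur at layer `0`,
  -- monotonicity is the only input.
  theorem TmTy.validAt_of_zero (hm : RedMono E j) : ∀ {t : Tm} {Ψ : GCtx} {Γ : LCtx} {T : Ty},
      TmTy .zero Ψ Γ t T → ValidAt E j Ψ Γ t t T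
    | .var x, _, _, _, h => by cases h with | var _ hx => exact ValidAt.var hx
    | .gvar u δ, _, _, _, h => by cases h with | gvar h hu => exact ValidAt.gvar (h.validAt_of_zero hm) hu
    | .zero, _, _, _, h => by cases h; exact ValidAt.zero
    | .succ t, _, _, _, h => by cases h with | succ h => exact ValidAt.succ (h.validAt_of_zero hm)
    | .box t, _, _, _, h => by cases h
    | .letbox s t, _, _, _, h => by cases h
    | .lam t, _, _, _, h => by
        cases h with
        | lam h => exact ValidAt.lam hm (h.lift j) (h.lift j) (h.validAt_of_zero hm)
    | .app t s, _, _, _, h => by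
        cases h with | app h h' => exact ValidAt.app (h.validAt_of_zero hm) (h'.validAt_of_zero hm)
    | .mlam t, _, _, _, h => by cases h
    | .mapp t Γ, _, _, _, h => by cases h
  theorem LSubTy.validAt_of_zero (hm : RedMono E j) : ∀ {δ : LSub} {Ψ : GCtx} {Γ Δ : LCtx},
      LSubTy .zero Ψ Γ δ Δ → ValidSubAt E j Ψ Γ δ δ Δ
    | .emp g m, _, _, _, h => by
        cases h with
        | emp _ hb => exact ValidSubAt.emp_none
        | empVar _ _ hb => exact ValidSubAt.emp_some hb
    | .wk g m, _, _, _, h => by cases h with | wk _ _ hb => exact ValidSubAt.wk hb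
    | .snoc δ t, _, _, _, h => by
        cases h with | snoc h h' => exact ValidSubAt.snoc (h.validAt_of_zero hm) (h'.validAt_of_zero hm)
end

/-- Validity is instantiated at `GSub.bvId`. The entries of `GSub.idOf` for global variables are
terms, so with that identity the claim would be presupposed. -/
theorem RedMono.codeRed (hm : RedMono E j) : CodeRed E j := by
  intro Ψ Γ Δ t T δ δ' ht hδ
  have hid := GSub.isId_bvId Ψ
  have := ht.validAt_of_zero hm (.bvId ht.wf.1.wfG) (δ := δ) (δ' := δ')
    (by rwa [ht.wf.1.gsub_id hid.ctx])
  rwa [ht.gsub_id hid, ht.wf.2.gsub_id hid.ctx] at this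

/-- At layer `0` monotonicity needs no knowledge of code. It yields `CodeRed` at layer `0`, which is
the input for the boxes at layer `1`. -/
theorem redMono (E : (i : Layer) → GenericEq i) (j : Layer) : RedMono E j :=
  redMono_of_codeRed fun _ => RedMono.codeRed (redMono_of_codeRed (i := .zero) (by simp))

theorem codeRed (E : (i : Layer) → GenericEq i) (j : Layer) : CodeRed E j :=
  RedMono.codeRed (redMono E j)

end

/-! ### Validity of the formers of layer `1` and of the `β` and `η` rules -/

section

variable {E : (i : Layer) → GenericEq i} {Ψ : GCtx} {Γ : LCtx}

/-- Local substitution does not enter `box`, and after applying `σ` the condition on the code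
follows from its typing by `codeRed`. -/
theorem ValidAt.box {Δ : LCtx} {t : Tm} {T : Ty} (ht : TmTy .zero Ψ Δ t T) :
    ValidAt E .one Ψ Γ (.box t) (.box t) (.box Δ T) := by
  intro Φ σ hσ Δ' δ δ' hδ
  have htσ := ht.gsub hσ.typed
  have hw : Whnf Φ Δ' (.box (t.gsub σ)) (.box (t.gsub σ)) (.box (Δ.gsub σ) (T.gsub σ)) :=
    ⟨.refl (.box hδ.wfL htσ), .box⟩
  exact redTm_box.2 ⟨_, _, hw, hw, (E .one).tm_box rfl hδ.wfL htσ,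
    .box htσ fun _ _ _ h => codeRed E .zero htσ h⟩

theorem Steps.betaBox_sub {Φ : GCtx} {Δ D : LCtx} {σ : GSub} {δ : LSub} {s t : Tm} {T T' : Ty}
    (hD : WfL .zero Ψ D) (hT : WfT .zero Ψ T) (hT' : WfT .one Ψ T')
    (ht : TmTy .one (.code D T :: Ψ) (Γ.gwk (.p .id)) t (T'.gwk (.p .id)))
    (hσ : GSubTy Φ σ Ψ) (hδ : LSubTy .one Φ Δ δ (Γ.gsub σ))
    (hs : TmTy .zero Φ (D.gsub σ) s (T.gsub σ)) :
    Steps Φ Δ (.letbox (.box s) ((t.gsub (GSub.qTm σ)).lsub (δ.gwk (.p .id))))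
      ((t.gsub (.tm s :: σ)).lsub δ) (T'.gsub σ) := by
  have hb := ht.gsub (hσ.qTm hD hT)
  rw [LCtx.gwk_p_gsub_qTm, Ty.gwk_p_gsub_qTm] at hb
  have hb := hb.lsub (hδ.gwk (.pId (.code hs.wf.1 hs.wf.2)))
  have hT'σ := hT'.gsub hσ.wfCtx
  have hr := TmTy.qTm_inst ht hσ hD hT hδ hs
  rw [← hr]
  exact .head (.betaBox hs hδ.wf.1 hT'σ hb) (.refl (TmTy.gsub_tm hs hδ.wf.1 hT'σ hb))

theorem ValidAt.letbox {D : LCtx} {s s' t t' : Tm} {T T' : Ty}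
    (hs : ValidAt E .one Ψ Γ s s' (.box D T))
    (hD : WfL .zero Ψ D) (hT : WfT .zero Ψ T) (hT' : WfT .one Ψ T')
    (ht : TmTy .one (.code D T :: Ψ) (Γ.gwk (.p .id)) t (T'.gwk (.p .id)))
    (ht' : TmTy .one (.code D T :: Ψ) (Γ.gwk (.p .id)) t' (T'.gwk (.p .id)))
    (h : ValidAt E .one (.code D T :: Ψ) (Γ.gwk (.p .id)) t t' (T'.gwk (.p .id))) :
    ValidAt E .one Ψ Γ (.letbox s t) (.letbox s' t') T' := by
  intro Φ σ hσ Δ δ δ' hδ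
  have hs := hs hσ hδ
  have hq := hσ.typed.qTm hD hT
  have hp : GWk (.p .id) (.code (D.gsub σ) (T.gsub σ) :: Φ) Φ :=
    .pId (.code (hD.gsub hσ.typed.wfCtx) (hT.gsub hσ.typed.wfCtx))
  have hT'σ := hT'.gsub hσ.typed.wfCtx
  have hb := ht.gsub hq
  have hb' := ht'.gsub hq
  rw [LCtx.gwk_p_gsub_qTm, Ty.gwk_p_gsub_qTm] at hb hb'
  have hb := hb.lsub (hδ.typed.1.gwk hp)
  have hb' := hb'.lsub (hδ.typed.2.gwk hp)
  obtain ⟨w, w', h1, h2, h3, h4⟩ := redTm_box.1 hs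
  refine RedTm.of_steps ?_ (h1.1.letbox hT'σ hb) (h2.1.letbox hT'σ hb')
  -- Either the scrutinees reach the same code `c`, and both sides continue with the body under `σ`
  -- extended by `c`; or they reach neutral terms, and both sides are stuck.
  cases h4 with
  | @box c hc _ =>
    -- The clause for `□` describes the action of `c` at layer `0`, whereas the body may use it at
    -- layer `1`. Therefore `codeRed` at layer `1` is invoked with the typing of `c`.
    have hg : GoodGSub E .one Φ (.tm c :: σ) (.code D T :: Ψ) :=
      (GSubTy.tm hσ.typed hc).good (codeRed E .one)
    have := h hg (δ := δ) (δ' := δ') (by simpa using hδ)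
    rw [Ty.gwk_p_gsub] at this
    exact this.of_steps (.betaBox_sub hD hT hT' ht hσ.typed hδ.typed.1 hc)
      (.betaBox_sub hD hT hT' ht' hσ.typed hδ.typed.2 hc)
  | ne hne =>
    -- The bodies are compared under the binder, where `q(σ)` leaves `u^δ` neutral; reducibility
    -- there gives the relation `≃` required by `ne_letbox`.
    have hδp := RedLSub.dwk (redMono E .one) (DWk.ofGWk hδ.wfL hp) hδ
    simp only [LSub.dwk, LSub.lwk_id] at hδp
    rw [← LCtx.gwk_p_gsub_qTm] at hδp
    have := h (hq.good (codeRed E .one)) hδp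
    rw [Ty.gwk_p_gsub_qTm] at this
    exact hT'σ.semTy.redTm_of_ne ((E .one).ne_letbox rfl hT'σ hne this.tm)

theorem ValidAt.mlam {t t' : Tm} {T : Ty} (hΓ : WfL .one Ψ Γ)
    (ht : TmTy .one (.ctx :: Ψ) (Γ.gwk (.p .id)) t T)
    (ht' : TmTy .one (.ctx :: Ψ) (Γ.gwk (.p .id)) t' T)
    (h : ValidAt E .one (.ctx :: Ψ) (Γ.gwk (.p .id)) t t' T) :
    ValidAt E .one Ψ Γ (.mlam t) (.mlam t') (.pi T) := by
  intro Φ σ hσ Δ δ δ' hδ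
  have htσ := ((TmTy.mlam hΓ ht).gsub hσ.typed).lsub hδ.typed.1
  have htσ' := ((TmTy.mlam hΓ ht').gsub hσ.typed).lsub hδ.typed.2
  refine redTm_pi_intro ⟨.refl htσ, .mlam⟩ ⟨.refl htσ', .mlam⟩ fun γ τ Φ' Δ' hd D hD => ?_
  rw [Ty.qCtx_gwk_inst hσ.typed hd.1]
  have hg : GoodGSub E .one Φ' (.ctx D :: GSub.gwk σ γ) (.ctx :: Ψ) :=
    (GSubTy.ctx (hσ.typed.gwk hd.1) hD).good (codeRed E .one)
  have hδ' := RedLSub.dwk (redMono E .one) hd hδ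
  rw [LCtx.gsub_gwk] at hδ'
  exact (h hg (by simpa using hδ')).of_steps (.betaMlam_sub ht hσ.typed hδ.typed.1 hd hD)
    (.betaMlam_sub ht' hσ.typed hδ.typed.2 hd hD)

theorem ValidAt.mapp {Δ : LCtx} {t t' : Tm} {T : Ty} (h : ValidAt E .one Ψ Γ t t' (.pi T))
    (hΔ : WfL .zero Ψ Δ) :
    ValidAt E .one Ψ Γ (.mapp t Δ) (.mapp t' Δ) (T.gsub (.ctx Δ :: GSub.idOf Ψ)) := by
  intro Φ σ hσ Δ' δ δ' hδ
  rw [hσ.typed.gsub_ctx_idOf, ← hσ.typed.wfCtx.gsub_qCtx]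
  exact RedTm.mapp (h hσ hδ) (hΔ.gsub hσ.typed.wfCtx)

theorem ValidAt.betaLam {t s : Tm} {S T : Ty} (ht : TmTy .one Ψ (.snoc Γ S) t T)
    (hs : TmTy .one Ψ Γ s S) (h : ValidAt E .one Ψ (.snoc Γ S) t t T)
    (h' : ValidAt E .one Ψ Γ s s S) :
    ValidAt E .one Ψ Γ (.app (.lam t) s) (t.lsub (.snoc (LSub.idOf Γ) s)) T := by
  intro Φ σ hσ Δ δ δ' hδ
  have hsσ := h' hσ hδ
  have e : ((t.lsub (.snoc (LSub.idOf Γ) s)).gsub σ).lsub δ' =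
      (t.gsub σ).lsub (.snoc δ' ((s.gsub σ).lsub δ')) := by
    rw [ht.lsub_gsub (.snoc (.idOf hs.wf.1) hs) hσ.typed, Tm.lsub_lsub]
    simp [LSub.idOf_gsub, hδ.typed.2.fits.idOf_comp]
  rw [e]
  have hr : RedTm E .one (T.gsub σ) Φ Δ ((t.gsub σ).lsub (.snoc δ ((s.gsub σ).lsub δ)))
      ((t.gsub σ).lsub (.snoc δ' ((s.gsub σ).lsub δ'))) :=
    h hσ ⟨_, _, _, _, rfl, rfl, hδ, hsσ⟩
  have h1 := Steps.betaLam_sub ht hσ.typed hδ.typed.1 (DWk.id hδ.wfL)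
    (s := (s.gsub σ).lsub δ) (by simpa using hsσ.typed.1)
  simp only [Tm.dwk_id_id, Ty.gwk_id, GSub.gwk_id, LSub.dwk, LSub.gwk_id, LSub.lwk_id] at h1
  -- Only the left side is a redex; the right side is already the contractum.
  exact hr.of_steps h1 (.refl hr.typed.2)

theorem ValidAt.etaLam {t : Tm} {S T : Ty} (ht : TmTy .one Ψ Γ t (.arr S T))
    (h : ValidAt E .one Ψ Γ t t (.arr S T)) :
    ValidAt E .one Ψ Γ t (.lam (.app (t.lwk (.p .id)) (.var 0))) (.arr S T) := by
  intro Φ σ hσ Δ δ δ' hδ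
  obtain ⟨w, w', h1, h2, h3, h4⟩ := redTm_arr.1 (h hσ hδ)
  cases ht.wf.2 with
  | arr hS hT =>
    have hη := ((TmTy.lam ht.etaLam).gsub hσ.typed).lsub hδ.typed.2
    refine redTm_arr_intro (hS.gsub hσ.typed.wfCtx) h1 ⟨.refl hη, .lam⟩
      fun γ τ Φ' Δ' hd s s' hs => ?_
    have hr := h4 γ τ Φ' Δ' hd s s' hs
    -- Applied to `s'`, the η-expansion takes one β step back to `t` applied to `s'`, after which it
    -- follows the reduction of `t` to its normal form `w'`.
    have hst := Steps.betaLam_sub ht.etaLam hσ.typed hδ.typed.2 hd hs.typed.2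
    have e : ((Tm.app (t.lwk (.p .id)) (.var 0)).gsub (GSub.gwk σ γ)).lsub
        (.snoc (δ'.dwk γ τ) s') = .app (((t.gsub σ).lsub δ').dwk γ τ) s' := by
      rw [Tm.lsub_dwk, Tm.gsub_gwk]
      simp [ht.lwk_p_gsub, Tm.lwk_p_lsub]
    rw [e] at hst
    exact hr.of_steps (.refl hr.typed.1) (hst.trans ((h2.1.dwk hd).app hs.typed.2))

end

-- Validity of the β rules for code and meta-functions, and of η for meta-functions

section

variable {E : (i : Layer) → GenericEq i} {Ψ : GCtx} {Γ : LCtx}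

/-- The entries of `idOf` are the terms `u^id`. Where `σ` has a term `t` they give `t[id] = t`;
where `σ` has `v^id` they give it written out as a term, a difference that well-typed terms do not
see. -/
theorem GSubTy.expands_idOf_comp {Φ : GCtx} {σ : GSub} (h : GSubTy Φ σ Ψ) :
    GSub.Expands Ψ σ (GSub.comp (GSub.idOf Ψ) σ) where
  ctx n := by
    rcases Nat.lt_or_ge n Ψ.length with hn | hn
    · obtain ⟨B, hB⟩ := HasG.exists_of_lt hn
      cases B with
      | ctx =>
        simp [GSub.lookupCtx, GSub.getElem?_comp, hB.getElem?_idOf_ctx, GEntry.gsub]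
      | code Δ T =>
        rcases h.code_cases hB with ⟨t, ht, _⟩ | ⟨v, hv, _⟩ <;>
          simp [GSub.lookupCtx, GSub.getElem?_comp, hB.getElem?_idOf_code, GEntry.gsub, *]
    · have h1 := List.getElem?_eq_none (h.length_eq ▸ hn)
      simp [GSub.lookupCtx, GSub.getElem?_comp, h1, GSub.getElem?_idOf_of_le hn]
  code u Δ T hu := by
    rw [GSub.getElem?_comp, hu.getElem?_idOf_code]
    rcases h.code_cases hu with ⟨t, ht, ht'⟩ | ⟨v, hv, _⟩
    · left; simp [ht, GEntry.gsub, GSub.appVar, LSub.idOf_gsub, ht'.lsub_idOf]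
    · right; simp [hv, GEntry.gsub, GSub.appVar, LSub.idOf_gsub]

theorem TmTy.gsub_ctx_gsub {Φ : GCtx} {Δ D : LCtx} {σ : GSub} {t : Tm} {T : Ty}
    (h : TmTy .one (.ctx :: Ψ) Δ t T) (hD : WfL .zero Ψ D) (hσ : GSubTy Φ σ Ψ) :
    (t.gsub (.ctx D :: GSub.idOf Ψ)).gsub σ = t.gsub (.ctx (D.gsub σ) :: σ) := by
  rw [h.gsub_gsub (.consCtx hD) hσ, h.gsub_expands (hσ.expands_idOf_comp.cons _ _)]
  rfl

theorem TmTy.gsub_tm_gsub {Φ : GCtx} {Δ D : LCtx} {σ : GSub} {s t : Tm} {S T : Ty}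
    (h : TmTy .one (.code D S :: Ψ) Δ t T) (hs : TmTy .zero Ψ D s S) (hσ : GSubTy Φ σ Ψ) :
    (t.gsub (.tm s :: GSub.idOf Ψ)).gsub σ = t.gsub (.tm (s.gsub σ) :: σ) := by
  rw [h.gsub_gsub (.consTm hs) hσ, h.gsub_expands (hσ.expands_idOf_comp.cons _ _)]
  rfl

theorem ValidAt.betaBox {D : LCtx} {s t : Tm} {T T' : Ty} (hs : TmTy .zero Ψ D s T)
    (hT' : WfT .one Ψ T')
    (ht : TmTy .one (.code D T :: Ψ) (Γ.gwk (.p .id)) t (T'.gwk (.p .id)))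
    (h : ValidAt E .one (.code D T :: Ψ) (Γ.gwk (.p .id)) t t (T'.gwk (.p .id))) :
    ValidAt E .one Ψ Γ (.letbox (.box s) t) (t.gsub (.tm s :: GSub.idOf Ψ)) T' := by
  intro Φ σ hσ Δ δ δ' hδ
  have hsσ := hs.gsub hσ.typed
  have hg : GoodGSub E .one Φ (.tm (s.gsub σ) :: σ) (.code D T :: Ψ) :=
    (GSubTy.tm hσ.typed hsσ).good (codeRed E .one)
  have hr := h hg (δ := δ) (δ' := δ') (by simpa using hδ)
  rw [Ty.gwk_p_gsub] at hr
  rw [ht.gsub_tm_gsub hs hσ.typed]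
  exact hr.of_steps (.betaBox_sub hs.wf.1 hs.wf.2 hT' ht hσ.typed hδ.typed.1 hsσ)
    (.refl hr.typed.2)

theorem ValidAt.betaMlam {D : LCtx} {t : Tm} {T : Ty}
    (ht : TmTy .one (.ctx :: Ψ) (Γ.gwk (.p .id)) t T) (hD : WfL .zero Ψ D)
    (h : ValidAt E .one (.ctx :: Ψ) (Γ.gwk (.p .id)) t t T) :
    ValidAt E .one Ψ Γ (.mapp (.mlam t) D) (t.gsub (.ctx D :: GSub.idOf Ψ))
      (T.gsub (.ctx D :: GSub.idOf Ψ)) := by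
  intro Φ σ hσ Δ δ δ' hδ
  have hDσ := hD.gsub hσ.typed.wfCtx
  have hg : GoodGSub E .one Φ (.ctx (D.gsub σ) :: σ) (.ctx :: Ψ) :=
    (GSubTy.ctx hσ.typed hDσ).good (codeRed E .one)
  have hr := h hg (δ := δ) (δ' := δ') (by simpa using hδ)
  have hst := Steps.betaMlam_sub ht hσ.typed hδ.typed.1 (DWk.id hδ.wfL) hDσ
  simp only [Tm.dwk_id_id, GSub.gwk_id, LSub.dwk, LSub.gwk_id, LSub.lwk_id] at hst
  rw [ht.gsub_ctx_gsub hD hσ.typed, hσ.typed.gsub_ctx_idOf]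
  exact hr.of_steps hst (.refl hr.typed.2)

theorem ValidAt.etaMlam {t : Tm} {T : Ty} (ht : TmTy .one Ψ Γ t (.pi T))
    (h : ValidAt E .one Ψ Γ t t (.pi T)) :
    ValidAt E .one Ψ Γ t (.mlam (.mapp (t.gwk (.p .id)) (.var 0))) (.pi T) := by
  intro Φ σ hσ Δ δ δ' hδ
  obtain ⟨w, w', h1, h2, h3, h4⟩ := redTm_pi.1 (h hσ hδ)
  have hη := ((TmTy.mlam ht.wf.1 ht.etaMlam).gsub hσ.typed).lsub hδ.typed.2
  refine redTm_pi_intro h1 ⟨.refl hη, .mlam⟩ fun γ τ Φ' Δ' hd D hD => ?_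
  have hr := h4 γ τ Φ' Δ' hd D hD
  have hst := Steps.betaMlam_sub ht.etaMlam hσ.typed hδ.typed.2 hd hD
  have e : ((Tm.mapp (t.gwk (.p .id)) (.var 0)).gsub (.ctx D :: GSub.gwk σ γ)).lsub
      (δ'.dwk γ τ) = .mapp (((t.gsub σ).lsub δ').dwk γ τ) D := by
    rw [Tm.lsub_dwk, Tm.gsub_gwk]
    simp [GSub.lookupCtx]
  rw [e, ← Ty.qCtx_gwk_inst hσ.typed hd.1] at hst
  exact hr.of_steps (.refl hr.typed.1) (hst.trans ((h2.1.dwk hd).mapp hD))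

end

/-! ### The fundamental theorem -/

section

variable {E : (i : Layer) → GenericEq i}

mutual
  theorem TmTy.validAt : ∀ {t : Tm} {i : Layer} {Ψ : GCtx} {Γ : LCtx} {T : Ty},
      TmTy i Ψ Γ t T → ValidAt E i Ψ Γ t t T
    | .var x, _, _, _, _, h => by cases h with | var _ hx => exact ValidAt.var hx
    | .gvar u δ, _, _, _, _, h => by cases h with | gvar h hu => exact ValidAt.gvar h.validAt hu
    | .zero, _, _, _, _, h => by cases h; exact ValidAt.zero
    | .succ t, _, _, _, _, h => by cases h with | succ h => exact ValidAt.succ h.validAt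
    | .box t, _, _, _, _, h => by cases h with | box _ h => exact ValidAt.box h
    | .letbox s t, _, _, _, _, h => by
        cases h with
        | letbox h hD hT hT' h' => exact ValidAt.letbox h.validAt hD hT hT' h' h' h'.validAt
    | .lam t, _, _, _, _, h => by
        cases h with | lam h => exact ValidAt.lam (redMono E _) h h h.validAt
    | .app t s, _, _, _, _, h => by
        cases h with | app h h' => exact ValidAt.app h.validAt h'.validAt
    | .mlam t, _, _, _, _, h => by
        cases h with | mlam hΓ h => exact ValidAt.mlam hΓ h h h.validAt
    | .mapp t Γ, _, _, _, _, h => by cases h with | mapp h h' => exact ValidAt.mapp h.validAt h'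
  theorem LSubTy.validAt : ∀ {δ : LSub} {i : Layer} {Ψ : GCtx} {Γ Δ : LCtx},
      LSubTy i Ψ Γ δ Δ → ValidSubAt E i Ψ Γ δ δ Δ
    | .emp g m, _, _, _, _, h => by
        cases h with
        | emp _ hb => exact ValidSubAt.emp_none
        | empVar _ _ hb => exact ValidSubAt.emp_some hb
    | .wk g m, _, _, _, _, h => by cases h with | wk _ _ hb => exact ValidSubAt.wk hb
    | .snoc δ t, _, _, _, _, h => by
        cases h with | snoc h h' => exact ValidSubAt.snoc h.validAt h'.validAt
end

mutual
  theorem TmEq.validAt : ∀ {i : Layer} {Ψ : GCtx} {Γ : LCtx} {t t' : Tm} {T : Ty},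
      TmEq i Ψ Γ t t' T → ValidAt E i Ψ Γ t t' T
    | _, _, _, _, _, _, .symm h => ValidAt.symm h.validAt
    | _, _, _, _, _, _, .trans h h' => ValidAt.trans h.validAt h'.validAt
    | _, _, _, _, _, _, .var _ hx => ValidAt.var hx
    | _, _, _, _, _, _, .gvar h hu => ValidAt.gvar h.validAt hu
    | _, _, _, _, _, _, .zero _ => ValidAt.zero
    | _, _, _, _, _, _, .succ h => ValidAt.succ h.validAt
    | _, _, _, _, _, _, .lam h =>
        ValidAt.lam (redMono E _) h.typed.1 h.typed.2 h.validAt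
    | _, _, _, _, _, _, .app h h' => ValidAt.app h.validAt h'.validAt
    | _, _, _, _, _, _, .box _ h => by
        -- The two codes are identical at layer `0`, so the congruence reduces to the reflexive
        -- case.
        cases h.eq_of_zero rfl
        exact ValidAt.box h.typed.1
    | _, _, _, _, _, _, .letbox h hD hT hT' h' =>
        ValidAt.letbox h.validAt hD hT hT' h'.typed.1 h'.typed.2 h'.validAt
    | _, _, _, _, _, _, .mlam hΓ h => ValidAt.mlam hΓ h.typed.1 h.typed.2 h.validAt
    | _, _, _, _, _, _, .mapp h hD => ValidAt.mapp h.validAt hD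
    | _, _, _, _, _, _, .betaLam h h' => ValidAt.betaLam h h' h.validAt h'.validAt
    | _, _, _, _, _, _, .etaLam h => ValidAt.etaLam h h.validAt
    | _, _, _, _, _, _, .betaBox hs _ hT' ht => ValidAt.betaBox hs hT' ht ht.validAt
    | _, _, _, _, _, _, .betaMlam _ ht hD => ValidAt.betaMlam ht hD ht.validAt
    | _, _, _, _, _, _, .etaMlam h => ValidAt.etaMlam h h.validAt
  theorem LSubEq.validAt : ∀ {i : Layer} {Ψ : GCtx} {Γ Δ : LCtx} {δ δ' : LSub},
      LSubEq i Ψ Γ δ δ' Δ → ValidSubAt E i Ψ Γ δ δ' Δ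
    | _, _, _, _, _, _, .emp _ _ => ValidSubAt.emp_none
    | _, _, _, _, _, _, .empVar _ _ hb => ValidSubAt.emp_some hb
    | _, _, _, _, _, _, .wk _ _ hb => ValidSubAt.wk hb
    | _, _, _, _, _, _, .snoc h h' => ValidSubAt.snoc h.validAt h'.validAt
end

-- Passage from `ValidAt` to the notions of validity in the theorem

theorem ValidGSub.typed {Φ : GCtx} : ∀ {Ψ : GCtx} {σ : GSub}, ValidGSub E Φ σ Ψ → GSubTy Φ σ Ψ
  | [], _, ⟨h, hσ⟩ => hσ ▸ .nil h
  | .ctx :: _, _, ⟨_, _, hσ, hΓ, h⟩ => hσ ▸ .ctx h.typed hΓ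
  | .code _ _ :: _, _, ⟨_, _, hσ, h, ht, _⟩ => hσ ▸ .tm h.typed ht

/-- A valid global substitution is in particular well typed; its semantic condition on code can be
forgotten, since `codeRed` already qualifies every well-typed substitution. -/
theorem ValidAt.validTmEq {i : Layer} {Ψ : GCtx} {Γ : LCtx} {t t' : Tm} {T : Ty}
    (h : ValidAt E i Ψ Γ t t' T) (hT : WfT i Ψ T) : ValidTmEq E i Ψ Γ t t' T :=
  fun _ _ hσ _ _ _ hδ =>
    ⟨(hT.gsub hσ.typed.wfCtx).semTy, h (hσ.typed.good (codeRed E i)) hδ.2⟩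

theorem ValidSubAt.validLSubEq {i : Layer} {Ψ : GCtx} {Γ Δ : LCtx} {δ δ' : LSub}
    (h : ValidSubAt E i Ψ Γ δ δ' Δ) (hΔ : WfL i Ψ Δ) : ValidLSubEq E i Ψ Γ δ δ' Δ :=
  fun _ _ hσ _ _ _ hε =>
    ⟨(hΔ.gsub hσ.typed.wfCtx).semLCtx, h (hσ.typed.good (codeRed E i)) hε.2⟩

theorem WfT.validTy {i : Layer} {Ψ : GCtx} {T : Ty} (h : WfT i Ψ T) : ValidTy E i Ψ T :=
  ⟨h.semTy, fun _ _ hσ => (h.gsub hσ.typed.wfCtx).semTy⟩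

theorem WfL.validLCtx : ∀ {Γ : LCtx} {i : Layer} {Ψ : GCtx}, WfL i Ψ Γ → ValidLCtx E i Ψ Γ
  | .nil, _, _, h => .nil h.wfG
  | .var _, _, _, h => by cases h with | var h hg => exact .var h hg
  | .snoc _ _, _, _, h => by cases h with | snoc hΓ hT => exact .snoc hΓ.validLCtx hT.validTy

theorem WfG.validGCtx : ∀ {Ψ : GCtx}, WfG Ψ → ValidGCtx E Ψ
  | [], _ => .nil
  | .ctx :: _, h => by cases h with | ctx h => exact .ctx h.validGCtx
  | .code _ _ :: _, h => by
      cases h with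
      | code hΓ hT => exact .code hΓ.wfG.validGCtx hΓ.validLCtx hT.validTy

-- Completeness, as validity at the identity substitutions

theorem redLSub_idOf : ∀ {Γ : LCtx} {i : Layer} {Ψ : GCtx}, WfL i Ψ Γ →
    RedLSub (RedRel E i) Ψ Γ (LSub.idOf Γ) (LSub.idOf Γ) Γ
  | .nil, _, _, h => ⟨h.toOne, rfl, rfl⟩
  | .var _, _, _, h => ⟨h.toOne, rfl, rfl, rfl⟩
  | .snoc Γ T, i, Ψ, h => by
      cases h with
      | snoc hΓ hT =>
        -- The earlier entries are weakened past the new variable, which itself is reducible because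
        -- it is neutral.
        have := RedLSub.dwk (redMono E i) (DWk.pLocal hΓ.toOne hT.toOne) (redLSub_idOf hΓ)
        simp only [LSub.dwk, LSub.gwk_id, LCtx.gwk_id] at this
        rw [LSub.idOf_snoc]
        exact ⟨_, _, _, _, rfl, rfl, this,
          redTm_var hT (.var (.snoc hΓ.toOne hT.toOne) .here)⟩

/-- Validity is applied to `id_Ψ` and `id_Γ`, which act trivially on well-typed terms and
well-formed types. At this stage the ordinary identity `GSub.idOf` may be used, since `codeRed`
covers its term entries. -/
theorem TmEq.semTmEq {i : Layer} {Ψ : GCtx} {Γ : LCtx} {t t' : Tm} {T : Ty}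
    (h : TmEq i Ψ Γ t t' T) : SemTmEq E i Ψ Γ t t' T := by
  obtain ⟨ht, ht'⟩ := h.typed
  refine ⟨ht.wf.2.semTy, ?_⟩
  have := h.validAt ((GSubTy.idOf ht.wf.1.wfG).good (codeRed E i))
    (by rw [ht.wf.1.gsub_idOf]; exact redLSub_idOf ht.wf.1)
  rwa [ht.gsub_idOf, ht'.gsub_idOf, ht.lsub_idOf, ht'.lsub_idOf, ht.wf.2.gsub_idOf] at this

theorem LSubEq.semLSubEq {i : Layer} {Ψ : GCtx} {Γ Δ : LCtx} {δ δ' : LSub}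
    (h : LSubEq i Ψ Γ δ δ' Δ) : SemLSubEq E i Ψ Γ δ δ' Δ := by
  obtain ⟨hδ, hδ'⟩ := h.typed
  refine ⟨hδ.wf.2.semLCtx, ?_⟩
  have := h.validAt ((GSubTy.idOf hδ.wf.1.wfG).good (codeRed E i))
    (by rw [hδ.wf.1.gsub_idOf]; exact redLSub_idOf hδ.wf.1)
  rwa [hδ.gsub_idOf, hδ'.gsub_idOf, hδ.comp_idOf, hδ'.comp_idOf, hδ.wf.2.gsub_idOf] at this

end

end CtxModal

theorem mainTheorem7 (E : (i : CtxModal.Layer) → CtxModal.GenericEq i) :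
    -- Completeness
    ((∀ i Ψ T, CtxModal.WfT i Ψ T → CtxModal.SemTy i Ψ T) ∧
      (∀ i Ψ Γ t t' T, CtxModal.TmEq i Ψ Γ t t' T → CtxModal.SemTmEq E i Ψ Γ t t' T) ∧
      (∀ i Ψ Γ δ δ' Δ, CtxModal.LSubEq i Ψ Γ δ δ' Δ → CtxModal.SemLSubEq E i Ψ Γ δ δ' Δ)) ∧
    -- Fundamental theorem for contexts and types
    ((∀ Ψ, CtxModal.WfG Ψ → CtxModal.ValidGCtx E Ψ) ∧
      (∀ i Ψ T, CtxModal.WfT i Ψ T → CtxModal.ValidTy E i Ψ T) ∧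
      (∀ i Ψ Γ, CtxModal.WfL i Ψ Γ → CtxModal.ValidLCtx E i Ψ Γ)) ∧
    -- Fundamental theorem for terms and local substitutions
    ((∀ i Ψ Γ t T, CtxModal.TmTy i Ψ Γ t T → CtxModal.ValidTmEq E i Ψ Γ t t T) ∧
      (∀ i Ψ Γ δ Δ, CtxModal.LSubTy i Ψ Γ δ Δ → CtxModal.ValidLSubEq E i Ψ Γ δ δ Δ) ∧
      (∀ i Ψ Γ t t' T, CtxModal.TmEq i Ψ Γ t t' T → CtxModal.ValidTmEq E i Ψ Γ t t' T) ∧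
      (∀ i Ψ Γ δ δ' Δ, CtxModal.LSubEq i Ψ Γ δ δ' Δ →
        CtxModal.ValidLSubEq E i Ψ Γ δ δ' Δ)) := by
  exact ⟨⟨fun _ _ _ h => h.semTy, fun _ _ _ _ _ _ h => h.semTmEq,
      fun _ _ _ _ _ _ h => h.semLSubEq⟩,
    ⟨fun _ h => h.validGCtx, fun _ _ _ h => h.validTy, fun _ _ _ h => h.validLCtx⟩,
    ⟨fun _ _ _ _ _ h => CtxModal.ValidAt.validTmEq h.validAt h.wf.2,
      fun _ _ _ _ _ h => CtxModal.ValidSubAt.validLSubEq h.validAt h.wf.2,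
      fun _ _ _ _ _ _ h => CtxModal.ValidAt.validTmEq h.validAt h.typed.1.wf.2,
      fun _ _ _ _ _ _ h => CtxModal.ValidSubAt.validLSubEq h.validAt h.typed.1.wf.2⟩⟩
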